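/- **Setting.** Let $M^n$ be a connected smooth $n$-manifold and $x:M^n\to\mathbb R^{n+1}$ a locally strongly convex centroaffine hypersurface: $x$ is a smooth immersion whose position vector is everywhere transversal to the tangent plane, and, for a suitable $\varepsilon\in\{1,-1\}$, the centroaffine metric $h$ in the Gauss formula $D_Xx_*(Y)=x_*(\nabla_XY)+h(X,Y)(-\varepsilon x)$ is positive definite. Let $\hat\nabla$ be the Levi-Civita connection of $h$, $K_XY=\nabla_XY-\hat\nabla_XY$ the difference tensor and $C=\nabla h$ the cubic form. Assume that $C$ is parallel, $\hat\nabla C=0$, and vanishes at no point. **Case $\mathfrak C_m$ ($2\le m\le n-1$).** Let $p\in M$ and let $e_1,\dots,e_n$ be an $h$-orthonormal basis of $T_pM$ such that $e_1$ is an absolute maximum of $u\mapsto h(K_uu,u)$ on the unit sphere $\{u\in T_pM: h(u,u)=1\}$ and $K_{e_1}e_i=\lambda_ie_i$ for all $i$. Assume that $\lambda_1^2-4\varepsilon>0$, $\lambda_2=\dots=\lambda_m=\tfrac12\lambda_1$ and $\lambda_{m+1}=\dots=\lambda_n=\tfrac12\big(\lambda_1-\sqrt{\lambda_1^2-4\varepsilon}\big)$.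 **The integer $k_0$.** Put $\mathcal D_2=\mathrm{span}\{e_2,\dots,e_m\}$, $L(v,v')=K_vv'-\tfrac12\lambda_1h(v,v')e_1$ and $P_vv'=K_vL(v,v')$ for $v,v'\in\mathcal D_2$, and for a unit vector $v\in\mathcal D_2$ let $V_v(0)=\{u\in\mathcal D_2: h(u,v)=0,\ P_vu=0\}$. Let $v_1,\dots,v_{k_0}\in\mathcal D_2$ be unit vectors with $$\mathcal D_2=\{v_1\}\oplus V_{v_1}(0)\oplus\dots\oplus\{v_{k_0}\}\oplus V_{v_{k_0}}(0),$$ where $\{v_j\}$ denotes the line spanned by $v_j$. **Theorem 7.1.** If $k_0=1$, then $M^n$ is locally a Calabi product. More precisely, one of the following holds. 1. Every point of $M$ has an open neighbourhood, diffeomorphic to a product $I\times M_1\times M_2$ with $I\subseteq\mathbb R$ open, on which, up to a linear transformation of $\mathbb R^{n+1}$, $$x(u,p_1,p_2)=\big(e^{u}\psi_1(p_1),\,e^{-\lambda u}\psi_2(p_2)\big)$$ for a constant $\lambda\ne0,-1$ and locally strongly convex centroaffine hypersurfaces $\psi_i:M_i\to\mathbb R^{n_i+1}$ with parallel cubic form,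 where $n_i=\dim M_i\ge1$ and $n_1+n_2+1=n$. 2. Every point of $M$ has an open neighbourhood, diffeomorphic to a product $I\times M_1$ with $I\subseteq\mathbb R$ open, on which, up to a linear transformation of $\mathbb R^{n+1}$, $$x(u,p_1)=\big(e^{u}\psi_1(p_1),\,e^{-\lambda u}\big)$$ for a constant $\lambda\ne0,-1$ and a locally strongly convex centroaffine hypersurface $\psi_1:M_1\to\mathbb R^{n}$ with parallel cubic form, where $\dim M_1=n-1$. -/

import Mathlib

open scoped Manifold ContDiff

namespace Centroaffine

noncomputable section

/-- The standard `k`-dimensional real space. -/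
abbrev Eu (k : ℕ) : Type := EuclideanSpace ℝ (Fin k)

/-! ### Local centroaffine geometry of a parametrized hypersurface `f : U ⊆ E → V` -/

section Local

variable {E V : Type*} [NormedAddCommGroup E] [NormedSpace ℝ E]
  [NormedAddCommGroup V] [NormedSpace ℝ V]

/-- `(u, t) ↦ df_y(u) + t f(y)`. If `dim V = dim E + 1`, this is an isomorphism exactly when `f` is
an immersion at `y` whose position vector `f y` is transversal to the tangent plane. -/
def frame (f : E → V) (y : E) : E × ℝ →L[ℝ] V :=
  (fderiv ℝ f y).coprod (ContinuousLinearMap.toSpanSingleton ℝ (f y))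

/-- The induced connection `∇` in the coordinates of `E` (its Christoffel map): the tangential part
in the Gauss formula `D²f(u, v) = df(Γ(u, v)) + h(u, v) (-ε f)`. -/
def inducedConn (f : E → V) (y : E) : E →L[ℝ] E →L[ℝ] E :=
  (ContinuousLinearMap.compL ℝ E V E
    ((ContinuousLinearMap.fst ℝ E ℝ).comp (frame f y).inverse)).comp
      (fderiv ℝ (fderiv ℝ f) y)

/-- The centroaffine metric `h` induced by the centroaffine normal `-ε f`, `ε = ±1`, i.e. the
coefficient of `-ε f` in the Gauss formula `D²f(u, v) = df(Γ(u, v)) + h(u, v) (-ε f)`. -/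
def metric (ε : ℝ) (f : E → V) (y : E) : E →L[ℝ] E →L[ℝ] ℝ :=
  (-ε) • (ContinuousLinearMap.compL ℝ E V ℝ
    ((ContinuousLinearMap.snd ℝ E ℝ).comp (frame f y).inverse)).comp
      (fderiv ℝ (fderiv ℝ f) y)

/-- The Levi-Civita connection `∇̂` of a field `h` of nondegenerate symmetric bilinear forms
(its Christoffel map `Γ̂`), given by
`h(Γ̂(u, v), w) = ½ (∂_u h(v, w) + ∂_v h(u, w) - ∂_w h(u, v))`.
Here `R` raises the last index of a trilinear form by means of `h_y`. -/
def leviCivita (h : E → E →L[ℝ] E →L[ℝ] ℝ) (y : E) : E →L[ℝ] E →L[ℝ] E :=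
  let R : (E →L[ℝ] E →L[ℝ] ℝ) →L[ℝ] (E →L[ℝ] E) :=
    ContinuousLinearMap.compL ℝ E (E →L[ℝ] ℝ) E (h y).inverse
  let B : E →L[ℝ] E →L[ℝ] E →L[ℝ] ℝ := fderiv ℝ h y
  let swap : (E →L[ℝ] E →L[ℝ] ℝ) →L[ℝ] (E →L[ℝ] E →L[ℝ] ℝ) :=
    (ContinuousLinearMap.flipₗᵢ ℝ E E ℝ).toContinuousLinearEquiv.toContinuousLinearMap
  (1 / 2 : ℝ) • (R.comp B + R.comp B.flip - R.comp (swap.comp B.flip))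

/-- The difference tensor `K = ∇ - ∇̂`. -/
def diffTensor (ε : ℝ) (f : E → V) (y : E) : E →L[ℝ] E →L[ℝ] E :=
  inducedConn f y - leviCivita (metric ε f) y

/-- The cubic form `C = ∇h`, `C(u, v, w) = (∇_u h)(v, w)`. -/
def cubicForm (ε : ℝ) (f : E → V) (y u v w : E) : ℝ :=
  fderiv ℝ (metric ε f) y u v w
    - metric ε f y (inducedConn f y u v) w - metric ε f y v (inducedConn f y u w)

/-- The covariant derivative `(∇̂_z C)(u, v, w)` of the cubic form. -/
def covDerivCubicForm (ε : ℝ) (f : E → V) (y z u v w : E) : ℝ :=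
  fderiv ℝ (fun y' => cubicForm ε f y' u v w) y z
    - cubicForm ε f y (leviCivita (metric ε f) y z u) v w
    - cubicForm ε f y u (leviCivita (metric ε f) y z v) w
    - cubicForm ε f y u v (leviCivita (metric ε f) y z w)

/-- `f` is, on the open set `U`, a smooth centroaffine immersion (an immersion with transversal
position vector) whose centroaffine metric with respect to `-ε f`, `ε = ±1`, is positive definite.
It is used with `dim V = dim E + 1`. -/
structure IsConvexOn (ε : ℝ) (f : E → V) (U : Set E) : Prop where
  sign : ε = 1 ∨ ε = -1
  isOpen : IsOpen U
  smooth : ContDiffOn ℝ ∞ f U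
  immersion : ∀ y ∈ U, Function.Injective (fderiv ℝ f y)
  transversal : ∀ y ∈ U, ∀ u : E, fderiv ℝ f y u ≠ f y
  metric_pos : ∀ y ∈ U, ∀ u : E, u ≠ 0 → 0 < metric ε f y u u

/-- `∇̂C = 0` on `U`. -/
def IsParallelOn (ε : ℝ) (f : E → V) (U : Set E) : Prop :=
  ∀ y ∈ U, ∀ z u v w : E, covDerivCubicForm ε f y z u v w = 0

end Local

/-! ### Hypersurfaces `x : M → ℝⁿ⁺¹` on a manifold -/

section Manifold

variable {n : ℕ} {M : Type*} [TopologicalSpace M] [ChartedSpace (Eu n) M]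

/-- `x : M → ℝⁿ⁺¹` is a locally strongly convex centroaffine hypersurface and its centroaffine
metric with respect to `-ε x` is positive definite (expressed in all smooth charts of `M`). -/
def IsConvexHypersurface (ε : ℝ) (x : M → Eu (n + 1)) : Prop :=
  ∀ φ ∈ IsManifold.maximalAtlas (𝓡 n) ∞ M, IsConvexOn ε (x ∘ φ.symm) φ.target

/-- The cubic form of `x` is parallel, `∇̂C = 0` (expressed in all smooth charts of `M`). -/
def HasParallelCubicForm (ε : ℝ) (x : M → Eu (n + 1)) : Prop :=
  ∀ φ ∈ IsManifold.maximalAtlas (𝓡 n) ∞ M, IsParallelOn ε (x ∘ φ.symm) φ.target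

/-- The cubic form of `x` vanishes at no point (expressed in all smooth charts of `M`). -/
def HasNonvanishingCubicForm (ε : ℝ) (x : M → Eu (n + 1)) : Prop :=
  ∀ φ ∈ IsManifold.maximalAtlas (𝓡 n) ∞ M, ∀ y ∈ φ.target,
    ∃ u v w : Eu n, cubicForm ε (x ∘ φ.symm) y u v w ≠ 0

/-- The centroaffine metric on `T_pM`, where `T_pM` is identified with `ℝⁿ` by the preferred
chart at `p`. -/
def metricAt (ε : ℝ) (x : M → Eu (n + 1)) (p : M) : Eu n →L[ℝ] Eu n →L[ℝ] ℝ :=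
  metric ε (x ∘ (chartAt (Eu n) p).symm) (chartAt (Eu n) p p)

/-- The difference tensor on `T_pM`, where `T_pM` is identified with `ℝⁿ` by the preferred
chart at `p`. -/
def diffTensorAt (ε : ℝ) (x : M → Eu (n + 1)) (p : M) : Eu n →L[ℝ] Eu n →L[ℝ] Eu n :=
  diffTensor ε (x ∘ (chartAt (Eu n) p).symm) (chartAt (Eu n) p p)

end Manifold

/-! ### The typical basis, the cases `ℭ_m` and the decomposition of `𝒟₂`

Here `h` and `K` are the centroaffine metric and the difference tensor on one tangent space `E`.
The indices `1, …, n` of the text are `0, …, n - 1` here, so `e 0` is `e₁`. -/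

section Pointwise

variable {E : Type*} [NormedAddCommGroup E] [NormedSpace ℝ E]

/-- Typical basis: `e` is `h`-orthonormal, `e₁` is an absolute maximum of `f(u) = h(K_u u, u)` on
the `h`-unit sphere, and `K_{e₁} e_i = λ_i e_i` for all `i`. -/
structure IsTypicalBasis {n : ℕ} [NeZero n] (h : E →L[ℝ] E →L[ℝ] ℝ) (K : E →L[ℝ] E →L[ℝ] E)
    (e : Fin n → E) (lam : Fin n → ℝ) : Prop where
  orthonormal : ∀ i j, h (e i) (e j) = if i = j then 1 else 0
  isMax : ∀ u : E, h u u = 1 → h (K u u) u ≤ h (K (e 0) (e 0)) (e 0)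
  eigen : ∀ i, K (e 0) (e i) = lam i • e i

/-- Case `ℭ_m` (for `2 ≤ m ≤ n - 1`): `λ₁² - 4ε > 0`, `λ_2 = ⋯ = λ_m = λ₁ / 2` and
`λ_{m+1} = ⋯ = λ_n = μ = (λ₁ - √(λ₁² - 4ε)) / 2`, for a typical basis `e`. -/
structure IsCaseC {n : ℕ} [NeZero n] (ε : ℝ) (h : E →L[ℝ] E →L[ℝ] ℝ) (K : E →L[ℝ] E →L[ℝ] E)
    (m : ℕ) (e : Fin n → E) (lam : Fin n → ℝ) : Prop where
  typical : IsTypicalBasis h K e lam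
  discr_pos : 0 < lam 0 ^ 2 - 4 * ε
  eig_D2 : ∀ i : Fin n, 1 ≤ (i : ℕ) → (i : ℕ) < m → lam i = lam 0 / 2
  eig_D3 : ∀ i : Fin n, m ≤ (i : ℕ) → lam i = (lam 0 - √(lam 0 ^ 2 - 4 * ε)) / 2

/-- `𝒟₂ = span {e_2, …, e_m}`. -/
def D2 {n : ℕ} (m : ℕ) (e : Fin n → E) : Submodule ℝ E :=
  Submodule.span ℝ (e '' {i : Fin n | 1 ≤ (i : ℕ) ∧ (i : ℕ) < m})

/-- `L(v, ·)`, where `L(v, v') = K_v v' - (λ₁ / 2) h(v, v') e₁` (for `v, v' ∈ 𝒟₂`). -/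
def isoL (h : E →L[ℝ] E →L[ℝ] ℝ) (K : E →L[ℝ] E →L[ℝ] E) (lam1 : ℝ) (e1 v : E) : E →L[ℝ] E :=
  K v - (lam1 / 2) • (h v).smulRight e1

/-- `P_v v' = K_v L(v, v')`. -/
def opP (h : E →L[ℝ] E →L[ℝ] ℝ) (K : E →L[ℝ] E →L[ℝ] E) (lam1 : ℝ) (e1 v : E) : E →L[ℝ] E :=
  (K v).comp (isoL h K lam1 e1 v)

/-- `V_v(0)`: the eigenspace for the eigenvalue `0` of `P_v` in the `h`-orthogonal complement of
`v` in `D = 𝒟₂`. -/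
def nullV (h : E →L[ℝ] E →L[ℝ] ℝ) (K : E →L[ℝ] E →L[ℝ] E) (lam1 : ℝ) (e1 : E)
    (D : Submodule ℝ E) (v : E) : Submodule ℝ E :=
  D ⊓ LinearMap.ker (h v : E →ₗ[ℝ] ℝ) ⊓ LinearMap.ker (opP h K lam1 e1 v : E →ₗ[ℝ] E)

/-- The unit vectors `v_1, …, v_{k₀} ∈ D = 𝒟₂` give the direct sum decomposition
`𝒟₂ = {v_1} ⊕ V_{v_1}(0) ⊕ ⋯ ⊕ {v_{k₀}} ⊕ V_{v_{k₀}}(0)`. The sum `{v_j} ⊕ V_{v_j}(0)` is direct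
in any case, by orthogonality. -/
structure IsD2Decomposition (h : E →L[ℝ] E →L[ℝ] ℝ) (K : E →L[ℝ] E →L[ℝ] E) (lam1 : ℝ) (e1 : E)
    (D : Submodule ℝ E) {k₀ : ℕ} (v : Fin k₀ → E) : Prop where
  mem : ∀ j, v j ∈ D
  unit : ∀ j, h (v j) (v j) = 1
  indep : iSupIndep fun j => Submodule.span ℝ {v j} ⊔ nullV h K lam1 e1 D (v j)
  sum : ⨆ j, (Submodule.span ℝ {v j} ⊔ nullV h K lam1 e1 D (v j)) = D

end Pointwise

/-! ### Local decomposition as a Calabi product -/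

section Calabi

variable {n : ℕ} {M : Type*} [TopologicalSpace M] [ChartedSpace (Eu n) M]

/-- Near `q`, the hypersurface `x` is, up to a linear transformation of `ℝⁿ⁺¹`, the Calabi product
`(u, p, r) ↦ (e^u ψ₁(p), e^{-λu} ψ₂(r))`, `λ ≠ 0, -1`, of two locally strongly convex centroaffine
hypersurfaces `ψ₁ : U₁ → ℝ^{n₁+1}`, `ψ₂ : U₂ → ℝ^{n₂+1}` of positive dimensions `n₁`, `n₂` with
parallel cubic form; `Φ` is a diffeomorphism from `I × U₁ × U₂` onto a neighbourhood of `q`. -/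
def IsCalabiProductNear (x : M → Eu (n + 1)) (q : M) : Prop :=
  ∃ n₁ n₂ : ℕ, 1 ≤ n₁ ∧ 1 ≤ n₂ ∧ n₁ + n₂ + 1 = n ∧
  ∃ lam : ℝ, lam ≠ 0 ∧ lam ≠ -1 ∧
  ∃ (I : Set ℝ) (U₁ : Set (Eu n₁)) (U₂ : Set (Eu n₂))
    (ψ₁ : Eu n₁ → Eu (n₁ + 1)) (ψ₂ : Eu n₂ → Eu (n₂ + 1))
    (A : (Eu (n₁ + 1) × Eu (n₂ + 1)) ≃L[ℝ] Eu (n + 1))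
    (Φ : OpenPartialHomeomorph (ℝ × Eu n₁ × Eu n₂) M),
    (∃ ε₁ : ℝ, IsConvexOn ε₁ ψ₁ U₁ ∧ IsParallelOn ε₁ ψ₁ U₁) ∧
    (∃ ε₂ : ℝ, IsConvexOn ε₂ ψ₂ U₂ ∧ IsParallelOn ε₂ ψ₂ U₂) ∧
    Φ.source = I ×ˢ U₁ ×ˢ U₂ ∧ q ∈ Φ.target ∧
    ContMDiffOn 𝓘(ℝ, ℝ × Eu n₁ × Eu n₂) (𝓡 n) ∞ Φ Φ.source ∧
    ContMDiffOn (𝓡 n) 𝓘(ℝ, ℝ × Eu n₁ × Eu n₂) ∞ Φ.symm Φ.target ∧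
    ∀ u ∈ I, ∀ p ∈ U₁, ∀ r ∈ U₂,
      x (Φ (u, p, r)) = A (Real.exp u • ψ₁ p, Real.exp (-lam * u) • ψ₂ r)

/-- Near `q`, the hypersurface `x` is, up to a linear transformation of `ℝⁿ⁺¹`, the Calabi product
`(u, p) ↦ (e^u ψ₁(p), e^{-λu})`, `λ ≠ 0, -1`, of a locally strongly convex centroaffine
hypersurface `ψ₁ : U₁ → ℝ^{n₁+1}`, `n₁ = n - 1`, with parallel cubic form and a point;
`Φ` is a diffeomorphism from `I × U₁` onto a neighbourhood of `q`. -/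
def IsCalabiProductWithPointNear (x : M → Eu (n + 1)) (q : M) : Prop :=
  ∃ n₁ : ℕ, 1 ≤ n₁ ∧ n₁ + 1 = n ∧
  ∃ lam : ℝ, lam ≠ 0 ∧ lam ≠ -1 ∧
  ∃ (I : Set ℝ) (U₁ : Set (Eu n₁)) (ψ₁ : Eu n₁ → Eu (n₁ + 1))
    (A : (Eu (n₁ + 1) × ℝ) ≃L[ℝ] Eu (n + 1))
    (Φ : OpenPartialHomeomorph (ℝ × Eu n₁) M),
    (∃ ε₁ : ℝ, IsConvexOn ε₁ ψ₁ U₁ ∧ IsParallelOn ε₁ ψ₁ U₁) ∧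
    Φ.source = I ×ˢ U₁ ∧ q ∈ Φ.target ∧
    ContMDiffOn 𝓘(ℝ, ℝ × Eu n₁) (𝓡 n) ∞ Φ Φ.source ∧
    ContMDiffOn (𝓡 n) 𝓘(ℝ, ℝ × Eu n₁) ∞ Φ.symm Φ.target ∧
    ∀ u ∈ I, ∀ p ∈ U₁,
      x (Φ (u, p)) = A (Real.exp u • ψ₁ p, Real.exp (-lam * u))

end Calabi

end

end Centroaffine

set_option linter.unusedSectionVars false
set_option maxSynthPendingDepth 3

namespace Centroaffine

section Calculus

variable {E V : Type*} [NormedAddCommGroup E] [NormedSpace ℝ E] [FiniteDimensional ℝ E]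
  [NormedAddCommGroup V] [NormedSpace ℝ V] [FiniteDimensional ℝ V]
  {ε : ℝ} {f : E → V} {U : Set E} {y : E}

@[simp] lemma frame_apply (f : E → V) (y : E) (p : E × ℝ) :
    frame f y p = fderiv ℝ f y p.1 + p.2 • f y := by
  simp [frame]

lemma frame_isInvertible_of_injective (hd : Module.finrank ℝ V = Module.finrank ℝ E + 1)
    (hinj : ∀ u : E, ∀ s : ℝ, fderiv ℝ f y u + s • f y = 0 → u = 0 ∧ s = 0) :
    (frame f y).IsInvertible := by
  have hi : Function.Injective (frame f y).toLinearMap := by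
    rw [← LinearMap.ker_eq_bot, LinearMap.ker_eq_bot']
    rintro ⟨u, s⟩ h
    have := hinj u s (by simpa using h)
    simp [this.1, this.2]
  have hd' : Module.finrank ℝ (E × ℝ) = Module.finrank ℝ V := by
    rw [Module.finrank_prod, hd]; simp
  refine ⟨(LinearEquiv.ofInjectiveOfFinrankEq _ hi hd').toContinuousLinearEquiv, ?_⟩
  ext p <;> rfl

lemma IsConvexOn.frame_injective (hf : IsConvexOn ε f U) (hy : y ∈ U) (u : E) (s : ℝ)
    (h : fderiv ℝ f y u + s • f y = 0) : u = 0 ∧ s = 0 := by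
  have hs : s = 0 := by
    by_contra hs
    refine hf.transversal y hy (-s⁻¹ • u) ?_
    rw [map_smul, eq_neg_of_add_eq_zero_left h, smul_neg, neg_smul, neg_neg, smul_smul,
      inv_mul_cancel₀ hs, one_smul]
  subst hs
  refine ⟨hf.immersion y hy ?_, rfl⟩
  simpa using h

lemma IsConvexOn.frame_isInvertible (hf : IsConvexOn ε f U)
    (hd : Module.finrank ℝ V = Module.finrank ℝ E + 1) (hy : y ∈ U) :
    (frame f y).IsInvertible :=
  frame_isInvertible_of_injective hd (hf.frame_injective hy)

lemma IsConvexOn.sq_sign (hf : IsConvexOn ε f U) : ε * ε = 1 := by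
  rcases hf.sign with h | h <;> simp [h]

lemma frame_inverse_eq (hinv : (frame f y).IsInvertible) {w : V} {a : E} {s : ℝ}
    (h : w = fderiv ℝ f y a + s • f y) : (frame f y).inverse w = (a, s) := by
  have : w = frame f y (a, s) := by simpa using h
  rw [this, hinv.inverse_apply_self]

lemma frame_eq_iff (hinv : (frame f y).IsInvertible) {a b : E} {s r : ℝ}
    (h : fderiv ℝ f y a + s • f y = fderiv ℝ f y b + r • f y) : a = b ∧ s = r := by
  have := hinv.injective (a₁ := (a, s)) (a₂ := (b, r)) (by simpa using h)
  simpa using this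

lemma exists_frame_coord (hinv : (frame f y).IsInvertible) (w : V) :
    w = fderiv ℝ f y ((frame f y).inverse w).1 + ((frame f y).inverse w).2 • f y := by
  have := hinv.self_apply_inverse w
  rw [frame_apply] at this
  exact this.symm

lemma inducedConn_apply (u v : E) : inducedConn f y u v =
    ((frame f y).inverse (fderiv ℝ (fderiv ℝ f) y u v)).1 := by
  simp [inducedConn]

lemma metric_apply (u v : E) : metric ε f y u v =
    -ε * ((frame f y).inverse (fderiv ℝ (fderiv ℝ f) y u v)).2 := by
  simp [metric]

lemma gauss_formula (hε : ε * ε = 1) (hinv : (frame f y).IsInvertible) (u v : E) :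
    fderiv ℝ (fderiv ℝ f) y u v =
      fderiv ℝ f y (inducedConn f y u v) + (-ε * metric ε f y u v) • f y := by
  rw [metric_apply, inducedConn_apply, ← mul_assoc, neg_mul_neg, hε, one_mul]
  exact exists_frame_coord hinv _

lemma gauss_unique (hε : ε * ε = 1) (hinv : (frame f y).IsInvertible) {u v a : E} {s : ℝ}
    (h : fderiv ℝ (fderiv ℝ f) y u v = fderiv ℝ f y a + (-ε * s) • f y) :
    inducedConn f y u v = a ∧ metric ε f y u v = s := by
  rw [inducedConn_apply, metric_apply, frame_inverse_eq hinv h]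
  refine ⟨rfl, ?_⟩
  simp only
  rw [← mul_assoc, neg_mul_neg, hε, one_mul]

lemma fderiv_fderiv_symm (hf : ContDiffOn ℝ ∞ f U) (hU : IsOpen U) (hy : y ∈ U) (u v : E) :
    fderiv ℝ (fderiv ℝ f) y u v = fderiv ℝ (fderiv ℝ f) y v u :=
  ((hf.contDiffAt (hU.mem_nhds hy)).isSymmSndFDerivAt (by
    rw [minSmoothness_of_isRCLikeNormedField]; exact WithTop.coe_le_coe.2 le_top)) u v

lemma IsConvexOn.inducedConn_symm (hf : IsConvexOn ε f U) (hy : y ∈ U) (u v : E) :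
    inducedConn f y u v = inducedConn f y v u := by
  rw [inducedConn_apply, inducedConn_apply, fderiv_fderiv_symm hf.smooth hf.isOpen hy]

lemma IsConvexOn.metric_symm (hf : IsConvexOn ε f U) (hy : y ∈ U) (u v : E) :
    metric ε f y u v = metric ε f y v u := by
  rw [metric_apply, metric_apply, fderiv_fderiv_symm hf.smooth hf.isOpen hy]

/-! ### Smoothness -/

lemma contDiffOn_fderiv {F : Type*} [NormedAddCommGroup F] [NormedSpace ℝ F] {g : E → F}
    (hg : ContDiffOn ℝ ∞ g U) (hU : IsOpen U) : ContDiffOn ℝ ∞ (fderiv ℝ g) U :=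
  hg.fderiv_of_isOpen hU (by simp)

lemma contDiffOn_frame (hf : ContDiffOn ℝ ∞ f U) (hU : IsOpen U) :
    ContDiffOn ℝ ∞ (frame f) U := by
  have h1 := contDiffOn_fderiv hf hU
  have : frame f = fun y => (fderiv ℝ f y).comp (ContinuousLinearMap.fst ℝ E ℝ) +
      ((ContinuousLinearMap.toSpanSingletonCLE (𝕜 := ℝ) (E := V)) (f y)).comp
        (ContinuousLinearMap.snd ℝ E ℝ) := by
    ext y p <;> simp
  rw [this]
  exact (h1.clm_comp contDiffOn_const).add
    (((ContinuousLinearEquiv.contDiff _).comp_contDiffOn hf).clm_comp contDiffOn_const)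

lemma IsConvexOn.contDiffOn_inverse_frame (hf : IsConvexOn ε f U)
    (hd : Module.finrank ℝ V = Module.finrank ℝ E + 1) :
    ContDiffOn ℝ ∞ (fun y => (frame f y).inverse) U := fun y hy =>
  ((hf.frame_isInvertible hd hy).contDiffAt_map_inverse (n := ∞)).comp_contDiffWithinAt y
    (contDiffOn_frame hf.smooth hf.isOpen y hy)

lemma IsConvexOn.contDiffOn_inducedConn (hf : IsConvexOn ε f U)
    (hd : Module.finrank ℝ V = Module.finrank ℝ E + 1) :
    ContDiffOn ℝ ∞ (inducedConn f) U := by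
  have h1 := hf.contDiffOn_inverse_frame hd
  have h2 := contDiffOn_fderiv (contDiffOn_fderiv hf.smooth hf.isOpen) hf.isOpen
  exact ((ContinuousLinearMap.contDiff _).comp_contDiffOn
    (contDiffOn_const.clm_comp h1)).clm_comp h2

lemma IsConvexOn.contDiffOn_metric (hf : IsConvexOn ε f U)
    (hd : Module.finrank ℝ V = Module.finrank ℝ E + 1) :
    ContDiffOn ℝ ∞ (metric ε f) U := by
  have h1 := hf.contDiffOn_inverse_frame hd
  have h2 := contDiffOn_fderiv (contDiffOn_fderiv hf.smooth hf.isOpen) hf.isOpen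
  exact ContDiffOn.const_smul _ (((ContinuousLinearMap.contDiff _).comp_contDiffOn
    (contDiffOn_const.clm_comp h1)).clm_comp h2)

/-- A positive definite form on a finite-dimensional space is an invertible map to the dual. -/
lemma isInvertible_of_pos {h : E →L[ℝ] E →L[ℝ] ℝ} (hpos : ∀ u, u ≠ 0 → 0 < h u u) :
    h.IsInvertible := by
  let T : E →ₗ[ℝ] (Module.Dual ℝ E) := (ContinuousLinearMap.coeLM ℝ).comp h.toLinearMap
  have hi : Function.Injective h.toLinearMap := by
    rw [← LinearMap.ker_eq_bot, LinearMap.ker_eq_bot']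
    intro u hu
    by_contra hne
    have := hpos u hne
    rw [show h u = 0 from hu] at this
    simp at this
  have hd : Module.finrank ℝ E = Module.finrank ℝ (E →L[ℝ] ℝ) := by
    rw [← (LinearMap.toContinuousLinearMap (𝕜 := ℝ) (E := E) (F' := ℝ)).finrank_eq]
    exact (Subspace.dual_finrank_eq).symm
  refine ⟨(LinearEquiv.ofInjectiveOfFinrankEq _ hi hd).toContinuousLinearEquiv, ?_⟩
  ext p
  rfl

lemma contDiffOn_leviCivita {h : E → E →L[ℝ] E →L[ℝ] ℝ} (hh : ContDiffOn ℝ ∞ h U)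
    (hU : IsOpen U) (hpos : ∀ y ∈ U, ∀ u, u ≠ 0 → 0 < h y u u) :
    ContDiffOn ℝ ∞ (leviCivita h) U := by
  have h1 : ContDiffOn ℝ ∞ (fun y => (h y).inverse) U := fun y hy =>
    ((isInvertible_of_pos (hpos y hy)).contDiffAt_map_inverse (n := ∞)).comp_contDiffWithinAt y
      (hh y hy)
  have h2 : ContDiffOn ℝ ∞ (fun y => ContinuousLinearMap.compL ℝ E (E →L[ℝ] ℝ) E (h y).inverse) U :=
    (ContinuousLinearMap.contDiff _).comp_contDiffOn h1
  have h3 := contDiffOn_fderiv hh hU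
  have h4 : ContDiffOn ℝ ∞ (fun y => (fderiv ℝ h y).flip) U :=
    (ContinuousLinearMap.flipₗᵢ ℝ E E (E →L[ℝ] ℝ)).contDiff.comp_contDiffOn h3
  exact ContDiffOn.const_smul _ (((h2.clm_comp h3).add (h2.clm_comp h4)).sub
    (h2.clm_comp (contDiffOn_const.clm_comp h4)))

lemma IsConvexOn.contDiffOn_leviCivita (hf : IsConvexOn ε f U)
    (hd : Module.finrank ℝ V = Module.finrank ℝ E + 1) :
    ContDiffOn ℝ ∞ (leviCivita (metric ε f)) U :=
  Centroaffine.contDiffOn_leviCivita (hf.contDiffOn_metric hd) hf.isOpen hf.metric_pos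

lemma IsConvexOn.contDiffOn_diffTensor (hf : IsConvexOn ε f U)
    (hd : Module.finrank ℝ V = Module.finrank ℝ E + 1) :
    ContDiffOn ℝ ∞ (diffTensor ε f) U :=
  (hf.contDiffOn_inducedConn hd).sub (hf.contDiffOn_leviCivita hd)

/-! ### The Levi-Civita connection -/

lemma leviCivita_inner {h : E → E →L[ℝ] E →L[ℝ] ℝ} (hpos : ∀ u, u ≠ 0 → 0 < h y u u)
    (u v w : E) :
    h y (leviCivita h y u v) w = 1 / 2 * (fderiv ℝ h y u v w + fderiv ℝ h y v u w
      - fderiv ℝ h y w u v) := by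
  have hi := isInvertible_of_pos hpos
  simp only [leviCivita]
  simp [ContinuousLinearMap.flipₗᵢ, hi.self_apply_inverse]

lemma ext_of_pos {h : E →L[ℝ] E →L[ℝ] ℝ} (hpos : ∀ u, u ≠ 0 → 0 < h u u) {a b : E}
    (hab : ∀ w, h a w = h b w) : a = b := by
  by_contra hne
  have := hpos (a - b) (sub_ne_zero.2 hne)
  rw [map_sub (h (a - b)), map_sub h, sub_apply, sub_apply, hab, hab] at this
  simp only [sub_self] at this
  exact lt_irrefl _ this

lemma fderiv_symm_of_symm {h : E → E →L[ℝ] E →L[ℝ] ℝ} (hU : IsOpen U) (hy : y ∈ U)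
    (hh : DifferentiableOn ℝ h U) (hsymm : ∀ y ∈ U, ∀ u v, h y u v = h y v u) (w u v : E) :
    fderiv ℝ h y w u v = fderiv ℝ h y w v u := by
  have hd := hh.differentiableAt (hU.mem_nhds hy)
  have h1 : ∀ a b : E, HasFDerivAt (fun y => h y a b)
      (((ContinuousLinearMap.apply ℝ ℝ b).comp (ContinuousLinearMap.apply ℝ (E →L[ℝ] ℝ) a)).comp
        (fderiv ℝ h y)) y := fun a b =>
    ((ContinuousLinearMap.apply ℝ ℝ b).comp
      (ContinuousLinearMap.apply ℝ (E →L[ℝ] ℝ) a)).hasFDerivAt.comp y hd.hasFDerivAt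
  have h2 : (fun y => h y u v) =ᶠ[nhds y] fun y => h y v u :=
    Filter.eventually_of_mem (hU.mem_nhds hy) fun y hy => hsymm y hy u v
  have := ((h1 u v).congr_of_eventuallyEq h2.symm).unique (h1 v u)
  simpa using congrArg (fun L => L w) this

/-- The data of a smooth Riemannian metric on an open set. -/
structure IsRiemannianOn (h : E → E →L[ℝ] E →L[ℝ] ℝ) (U : Set E) : Prop where
  isOpen : IsOpen U
  smooth : ContDiffOn ℝ ∞ h U
  symm : ∀ y ∈ U, ∀ u v, h y u v = h y v u
  pos : ∀ y ∈ U, ∀ u, u ≠ 0 → 0 < h y u u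

lemma IsConvexOn.isRiemannianOn (hf : IsConvexOn ε f U)
    (hd : Module.finrank ℝ V = Module.finrank ℝ E + 1) : IsRiemannianOn (metric ε f) U :=
  ⟨hf.isOpen, hf.contDiffOn_metric hd, fun _ hy => hf.metric_symm hy, hf.metric_pos⟩

section LC

variable {h : E → E →L[ℝ] E →L[ℝ] ℝ}

lemma IsRiemannianOn.leviCivita_symm (hh : IsRiemannianOn h U) (hy : y ∈ U) (u v : E) :
    leviCivita h y u v = leviCivita h y v u := by
  have hs := fderiv_symm_of_symm hh.isOpen hy (hh.smooth.differentiableOn (by simp)) hh.symm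
  refine ext_of_pos (hh.pos y hy) fun w => ?_
  rw [leviCivita_inner (hh.pos y hy), leviCivita_inner (hh.pos y hy),
    hs w u v]
  ring

lemma IsRiemannianOn.compat (hh : IsRiemannianOn h U) (hy : y ∈ U) (w u v : E) :
    fderiv ℝ h y w u v = h y (leviCivita h y w u) v + h y u (leviCivita h y w v) := by
  have hs := fderiv_symm_of_symm hh.isOpen hy (hh.smooth.differentiableOn (by simp)) hh.symm
  rw [hh.symm y hy u, leviCivita_inner (hh.pos y hy),
    leviCivita_inner (hh.pos y hy), hs w v u]
  ring

lemma IsRiemannianOn.leviCivita_unique (hh : IsRiemannianOn h U) (hy : y ∈ U) {G : E → E → E}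
    (hG : ∀ u v, G u v = G v u)
    (hc : ∀ w u v, fderiv ℝ h y w u v = h y (G w u) v + h y u (G w v)) (u v : E) :
    leviCivita h y u v = G u v := by
  refine ext_of_pos (hh.pos y hy) fun w => ?_
  rw [leviCivita_inner (hh.pos y hy), hc, hc, hc, hG v u, hG w u, hG w v,
    hh.symm y hy v, hh.symm y hy u (G v w)]
  ring

end LC

end Calculus

section Codazzi

variable {E V : Type*} [NormedAddCommGroup E] [NormedSpace ℝ E] [FiniteDimensional ℝ E]
  [NormedAddCommGroup V] [NormedSpace ℝ V] [FiniteDimensional ℝ V]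
  {ε : ℝ} {f : E → V} {U : Set E} {y : E}

lemma fderiv_eval {F G : Type*} [NormedAddCommGroup F] [NormedSpace ℝ F]
    [NormedAddCommGroup G] [NormedSpace ℝ G] {A : E → F →L[ℝ] G} {b : E → F}
    (hA : DifferentiableAt ℝ A y) (hb : DifferentiableAt ℝ b y) (w : E) :
    fderiv ℝ (fun y => A y (b y)) y w = fderiv ℝ A y w (b y) + A y (fderiv ℝ b y w) := by
  rw [fderiv_clm_apply hA hb]
  simp [add_comm]

lemma fderiv_eval_const {F G : Type*} [NormedAddCommGroup F] [NormedSpace ℝ F]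
    [NormedAddCommGroup G] [NormedSpace ℝ G] {A : E → F →L[ℝ] G}
    (hA : DifferentiableAt ℝ A y) (b : F) (w : E) :
    fderiv ℝ (fun y => A y b) y w = fderiv ℝ A y w b := by
  rw [fderiv_eval hA (differentiableAt_const b)]
  simp

lemma fderiv_eval_const₂ {F F' G : Type*} [NormedAddCommGroup F] [NormedSpace ℝ F]
    [NormedAddCommGroup F'] [NormedSpace ℝ F']
    [NormedAddCommGroup G] [NormedSpace ℝ G] {A : E → F →L[ℝ] F' →L[ℝ] G}
    (hA : DifferentiableAt ℝ A y) (b : F) (c : F') (w : E) :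
    fderiv ℝ (fun y => A y b c) y w = fderiv ℝ A y w b c := by
  have h1 : DifferentiableAt ℝ (fun y => A y b) y := hA.clm_apply (differentiableAt_const b)
  rw [fderiv_eval_const h1, fderiv_eval_const hA]

lemma ContDiffOn.diffAt {F : Type*} [NormedAddCommGroup F] [NormedSpace ℝ F] {g : E → F}
    (hg : ContDiffOn ℝ ∞ g U) (hU : IsOpen U) (hy : y ∈ U) : DifferentiableAt ℝ g y :=
  (hg.differentiableOn (by simp)).differentiableAt (hU.mem_nhds hy)

lemma fderiv_congr_on {F : Type*} [NormedAddCommGroup F] [NormedSpace ℝ F] {g g' : E → F}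
    (hU : IsOpen U) (hy : y ∈ U) (h : ∀ y ∈ U, g y = g' y) : fderiv ℝ g y = fderiv ℝ g' y :=
  Filter.EventuallyEq.fderiv_eq (Filter.eventually_of_mem (hU.mem_nhds hy) h)

lemma IsConvexOn.third_fderiv (hf : IsConvexOn ε f U)
    (hd : Module.finrank ℝ V = Module.finrank ℝ E + 1) (hy : y ∈ U) (w u v : E) :
    fderiv ℝ (fderiv ℝ (fderiv ℝ f)) y w u v =
      fderiv ℝ f y (inducedConn f y w (inducedConn f y u v) + fderiv ℝ (inducedConn f) y w u v +
        (-ε * metric ε f y u v) • w) +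
      (-ε * (metric ε f y w (inducedConn f y u v) + fderiv ℝ (metric ε f) y w u v)) • f y := by
  have d0 := ContDiffOn.diffAt hf.smooth hf.isOpen hy
  have d1 := ContDiffOn.diffAt (contDiffOn_fderiv hf.smooth hf.isOpen) hf.isOpen hy
  have d2 := ContDiffOn.diffAt (contDiffOn_fderiv (contDiffOn_fderiv hf.smooth hf.isOpen)
    hf.isOpen) hf.isOpen hy
  have dG := ContDiffOn.diffAt (hf.contDiffOn_inducedConn hd) hf.isOpen hy
  have dh := ContDiffOn.diffAt (hf.contDiffOn_metric hd) hf.isOpen hy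
  have dG1 : DifferentiableAt ℝ (fun y => inducedConn f y u v) y :=
    (dG.clm_apply (differentiableAt_const u)).clm_apply (differentiableAt_const v)
  have dh1 : DifferentiableAt ℝ (fun y => metric ε f y u v) y :=
    (dh.clm_apply (differentiableAt_const u)).clm_apply (differentiableAt_const v)
  rw [← fderiv_eval_const₂ d2, fderiv_congr_on hf.isOpen hy fun y hy =>
    gauss_formula hf.sq_sign (hf.frame_isInvertible hd hy) u v,
    fderiv_fun_add (d1.clm_apply dG1) ((dh1.const_mul (-ε)).fun_smul d0), add_apply,
    fderiv_eval d1 dG1, fderiv_eval_const₂ dG, fderiv_fun_smul (dh1.const_mul (-ε)) d0,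
    fderiv_const_mul dh1]
  simp only [add_apply, smul_apply, ContinuousLinearMap.smulRight_apply,
    fderiv_eval_const₂ dh]
  rw [gauss_formula hf.sq_sign (hf.frame_isInvertible hd hy)]
  simp only [map_add, map_smul, smul_eq_mul]
  module

lemma IsConvexOn.cubicForm_symm_left (hf : IsConvexOn ε f U)
    (hd : Module.finrank ℝ V = Module.finrank ℝ E + 1) (hy : y ∈ U) (u v w : E) :
    cubicForm ε f y u v w = cubicForm ε f y v u w := by
  have hs := fderiv_fderiv_symm (contDiffOn_fderiv hf.smooth hf.isOpen) hf.isOpen hy u v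
  have hs' := congrArg (fun L => L w) hs
  simp only [hf.third_fderiv hd hy] at hs'
  have h1 := (frame_eq_iff (hf.frame_isInvertible hd hy) hs').2
  have hε : -ε ≠ 0 := by rcases hf.sign with h | h <;> simp [h]
  have h2 := mul_left_cancel₀ hε h1
  have e1 := hf.metric_symm hy u (inducedConn f y v w)
  have e2 := hf.metric_symm hy v (inducedConn f y u w)
  simp only [cubicForm]
  rw [hf.inducedConn_symm hy v u]
  linarith

lemma IsConvexOn.cubicForm_symm_right (hf : IsConvexOn ε f U)
    (hd : Module.finrank ℝ V = Module.finrank ℝ E + 1) (hy : y ∈ U) (u v w : E) :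
    cubicForm ε f y u v w = cubicForm ε f y u w v := by
  have hs := fderiv_symm_of_symm hf.isOpen hy
    ((hf.contDiffOn_metric hd).differentiableOn (by simp)) (fun y hy => hf.metric_symm hy) u v w
  simp only [cubicForm]
  rw [hs, hf.metric_symm hy _ w, hf.metric_symm hy v]
  ring

lemma IsConvexOn.diffTensor_symm (hf : IsConvexOn ε f U)
    (hd : Module.finrank ℝ V = Module.finrank ℝ E + 1) (hy : y ∈ U) (u v : E) :
    diffTensor ε f y u v = diffTensor ε f y v u := by
  simp only [diffTensor, sub_apply]
  rw [hf.inducedConn_symm hy, (hf.isRiemannianOn hd).leviCivita_symm hy]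

lemma inducedConn_eq (u v : E) : inducedConn f y u v =
    leviCivita (metric ε f) y u v + diffTensor ε f y u v := by
  simp [diffTensor]

lemma IsConvexOn.cubicForm_eq_neg_two (hf : IsConvexOn ε f U)
    (hd : Module.finrank ℝ V = Module.finrank ℝ E + 1) (hy : y ∈ U) (u v w : E) :
    cubicForm ε f y u v w = -2 * metric ε f y (diffTensor ε f y u v) w := by
  have key : ∀ u v w, cubicForm ε f y u v w = -metric ε f y (diffTensor ε f y u v) w
      - metric ε f y (diffTensor ε f y u w) v := by
    intro u v w
    simp only [cubicForm, (hf.isRiemannianOn hd).compat hy u v w, diffTensor, sub_apply]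
    rw [hf.metric_symm hy v, hf.metric_symm hy v, map_sub, map_sub, sub_apply, sub_apply]
    ring
  have k1 := key u v w
  have k2 := key v w u
  have k3 := key w u v
  have s1 := hf.cubicForm_symm_left hd hy w u v
  have s2 := hf.cubicForm_symm_right hd hy u w v
  have s3 := hf.cubicForm_symm_right hd hy v w u
  have s4 := hf.cubicForm_symm_left hd hy v u w
  rw [hf.diffTensor_symm hd hy v u] at k2
  rw [hf.diffTensor_symm hd hy w v, hf.diffTensor_symm hd hy w u] at k3
  linarith

lemma IsConvexOn.diffTensor_adjoint (hf : IsConvexOn ε f U)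
    (hd : Module.finrank ℝ V = Module.finrank ℝ E + 1) (hy : y ∈ U) (u v w : E) :
    metric ε f y (diffTensor ε f y u v) w = metric ε f y v (diffTensor ε f y u w) := by
  have h1 := hf.cubicForm_eq_neg_two hd hy u v w
  have h2 := hf.cubicForm_eq_neg_two hd hy u w v
  have h3 := hf.cubicForm_symm_right hd hy u v w
  rw [hf.metric_symm hy v]
  linarith

lemma IsConvexOn.fderiv_metric_eval (hf : IsConvexOn ε f U)
    (hd : Module.finrank ℝ V = Module.finrank ℝ E + 1) (hy : y ∈ U) {a : E → E}
    (ha : DifferentiableAt ℝ a y) (z w : E) :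
    fderiv ℝ (fun y => metric ε f y (a y) w) y z =
      metric ε f y (fderiv ℝ a y z + leviCivita (metric ε f) y z (a y)) w
        + metric ε f y (a y) (leviCivita (metric ε f) y z w) := by
  have dh := ContDiffOn.diffAt (hf.contDiffOn_metric hd) hf.isOpen hy
  rw [fderiv_eval_const (dh.clm_apply ha), fderiv_eval dh ha, add_apply,
    (hf.isRiemannianOn hd).compat hy, map_add, add_apply]
  ring

lemma IsConvexOn.fderiv_diffTensor (hf : IsConvexOn ε f U) (hp : IsParallelOn ε f U)
    (hd : Module.finrank ℝ V = Module.finrank ℝ E + 1) (hy : y ∈ U) (z u v : E) :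
    fderiv ℝ (diffTensor ε f) y z u v =
      diffTensor ε f y (leviCivita (metric ε f) y z u) v
      + diffTensor ε f y u (leviCivita (metric ε f) y z v)
      - leviCivita (metric ε f) y z (diffTensor ε f y u v) := by
  have dK := ContDiffOn.diffAt (hf.contDiffOn_diffTensor hd) hf.isOpen hy
  have dh := ContDiffOn.diffAt (hf.contDiffOn_metric hd) hf.isOpen hy
  have dK1 : DifferentiableAt ℝ (fun y => diffTensor ε f y u v) y :=
    (dK.clm_apply (differentiableAt_const u)).clm_apply (differentiableAt_const v)
  refine ext_of_pos (hf.metric_pos y hy) fun w => ?_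
  have h := hp y hy z u v w
  have dm : DifferentiableAt ℝ (fun y => metric ε f y (diffTensor ε f y u v) w) y :=
    (dh.clm_apply dK1).clm_apply (differentiableAt_const w)
  simp only [covDerivCubicForm] at h
  rw [fderiv_congr_on hf.isOpen hy (fun y hy => hf.cubicForm_eq_neg_two hd hy u v w),
    fderiv_const_mul dm, smul_apply, hf.fderiv_metric_eval hd hy dK1,
    fderiv_eval_const₂ dK] at h
  simp only [hf.cubicForm_eq_neg_two hd hy, smul_eq_mul, map_add, add_apply] at h
  simp only [map_add, map_sub, add_apply, sub_apply]
  linarith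

end Codazzi

section GaussOp

variable {E V : Type*} [NormedAddCommGroup E] [NormedSpace ℝ E] [FiniteDimensional ℝ E]
  [NormedAddCommGroup V] [NormedSpace ℝ V] [FiniteDimensional ℝ V]
  {ε : ℝ} {f : E → V} {U : Set E} {y : E}

/-- The operator `(u, s) ↦ (K_z u + s z, -ε h(z, u))`, in the frame `(df, f)`. -/
noncomputable def frameOp (ε : ℝ) (f : E → V) (y : E) : E →L[ℝ] (E × ℝ →L[ℝ] E × ℝ) :=
  (ContinuousLinearMap.compL ℝ (E × ℝ) E (E × ℝ) (ContinuousLinearMap.inl ℝ E ℝ)).comp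
    (((ContinuousLinearMap.compL ℝ (E × ℝ) E E).flip (ContinuousLinearMap.fst ℝ E ℝ)).comp
        (diffTensor ε f y) +
      ContinuousLinearMap.smulRightL ℝ (E × ℝ) E (ContinuousLinearMap.snd ℝ E ℝ)) +
  (-ε) • (ContinuousLinearMap.compL ℝ (E × ℝ) ℝ (E × ℝ) (ContinuousLinearMap.inr ℝ E ℝ)).comp
    (((ContinuousLinearMap.compL ℝ (E × ℝ) E ℝ).flip (ContinuousLinearMap.fst ℝ E ℝ)).comp
      (metric ε f y))

lemma frameOp_apply (z u : E) (s : ℝ) :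
    frameOp ε f y z (u, s) = (diffTensor ε f y z u + s • z, -ε * metric ε f y z u) := by
  simp [frameOp]

/-- The difference `D_z - ∇̂_z` of the flat connection and the Levi-Civita connection (extended
trivially to the line spanned by the position vector), as an endomorphism of the ambient space. -/
noncomputable def gaussOp (ε : ℝ) (f : E → V) (y : E) : E →L[ℝ] V →L[ℝ] V :=
  (ContinuousLinearMap.compL ℝ V (E × ℝ) V (frame f y)).comp
    (((ContinuousLinearMap.compL ℝ V (E × ℝ) (E × ℝ)).flip (frame f y).inverse).comp
      (frameOp ε f y))

lemma gaussOp_fderiv (hinv : (frame f y).IsInvertible) (z u : E) :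
    gaussOp ε f y z (fderiv ℝ f y u) =
      fderiv ℝ f y (diffTensor ε f y z u) + (-ε * metric ε f y z u) • f y := by
  simp only [gaussOp, ContinuousLinearMap.comp_apply, ContinuousLinearMap.compL_apply,
    ContinuousLinearMap.flip_apply]
  rw [frame_inverse_eq hinv (a := u) (s := 0) (by simp), frameOp_apply, frame_apply]
  simp

lemma gaussOp_self (hinv : (frame f y).IsInvertible) (z : E) :
    gaussOp ε f y z (f y) = fderiv ℝ f y z := by
  simp only [gaussOp, ContinuousLinearMap.comp_apply, ContinuousLinearMap.compL_apply,
    ContinuousLinearMap.flip_apply]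
  rw [frame_inverse_eq hinv (a := 0) (s := 1) (by simp), frameOp_apply, frame_apply]
  simp

lemma gaussOp_fderiv' (hε : ε * ε = 1) (hinv : (frame f y).IsInvertible) (z u : E) :
    gaussOp ε f y z (fderiv ℝ f y u) =
      fderiv ℝ (fderiv ℝ f) y z u - fderiv ℝ f y (leviCivita (metric ε f) y z u) := by
  rw [gaussOp_fderiv hinv, gauss_formula hε hinv, inducedConn_eq (ε := ε), map_add]
  abel

lemma frame_hom_ext {F : Type*} [AddCommGroup F] [Module ℝ F]
    (hinv : (frame f y).IsInvertible) {A B : V →ₗ[ℝ] F}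
    (h1 : ∀ u, A (fderiv ℝ f y u) = B (fderiv ℝ f y u)) (h2 : A (f y) = B (f y)) (x : V) :
    A x = B x := by
  rw [exists_frame_coord hinv x]
  simp [h1, h2]

lemma IsConvexOn.contDiffOn_gaussOp (hf : IsConvexOn ε f U)
    (hd : Module.finrank ℝ V = Module.finrank ℝ E + 1) :
    ContDiffOn ℝ ∞ (gaussOp ε f) U := by
  have h1 := contDiffOn_frame hf.smooth hf.isOpen
  have h2 := hf.contDiffOn_inverse_frame hd
  have h3 : ContDiffOn ℝ ∞ (frameOp ε f) U :=
    (contDiffOn_const.clm_comp ((contDiffOn_const.clm_comp (hf.contDiffOn_diffTensor hd)).add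
      contDiffOn_const)).add (ContDiffOn.const_smul _ (contDiffOn_const.clm_comp
        (contDiffOn_const.clm_comp (hf.contDiffOn_metric hd))))
  exact ((ContinuousLinearMap.contDiff _).comp_contDiffOn h1).clm_comp
    (((ContinuousLinearMap.contDiff _).comp_contDiffOn h2).clm_comp h3)

lemma IsConvexOn.fderiv_gaussOp (hf : IsConvexOn ε f U) (hp : IsParallelOn ε f U)
    (hd : Module.finrank ℝ V = Module.finrank ℝ E + 1) (hy : y ∈ U) (w z : E) (x : V) :
    fderiv ℝ (gaussOp ε f) y w z x = gaussOp ε f y (leviCivita (metric ε f) y w z) x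
      + gaussOp ε f y w (gaussOp ε f y z x) - gaussOp ε f y z (gaussOp ε f y w x) := by
  have hinv := hf.frame_isInvertible hd hy
  have d0 := ContDiffOn.diffAt hf.smooth hf.isOpen hy
  have d1 := ContDiffOn.diffAt (contDiffOn_fderiv hf.smooth hf.isOpen) hf.isOpen hy
  have dN := ContDiffOn.diffAt (hf.contDiffOn_gaussOp hd) hf.isOpen hy
  have dNz : DifferentiableAt ℝ (fun y => gaussOp ε f y z) y :=
    dN.clm_apply (differentiableAt_const z)
  have dh := ContDiffOn.diffAt (hf.contDiffOn_metric hd) hf.isOpen hy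
  have dK := ContDiffOn.diffAt (hf.contDiffOn_diffTensor hd) hf.isOpen hy
  refine frame_hom_ext hinv (A := (fderiv ℝ (gaussOp ε f) y w z).toLinearMap)
    (B := ((gaussOp ε f y (leviCivita (metric ε f) y w z)).toLinearMap
      + (gaussOp ε f y w).toLinearMap ∘ₗ (gaussOp ε f y z).toLinearMap
      - (gaussOp ε f y z).toLinearMap ∘ₗ (gaussOp ε f y w).toLinearMap)) (fun u => ?_) ?_ x
  · have dK1 : DifferentiableAt ℝ (fun y => diffTensor ε f y z u) y :=
      (dK.clm_apply (differentiableAt_const z)).clm_apply (differentiableAt_const u)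
    have dh1 : DifferentiableAt ℝ (fun y => metric ε f y z u) y :=
      (dh.clm_apply (differentiableAt_const z)).clm_apply (differentiableAt_const u)
    have d1u : DifferentiableAt ℝ (fun y => fderiv ℝ f y u) y :=
      d1.clm_apply (differentiableAt_const u)
    have h1 := DFunLike.congr_fun (fderiv_congr_on (g := fun y => gaussOp ε f y z (fderiv ℝ f y u))
      hf.isOpen hy fun y hy => gaussOp_fderiv (hf.frame_isInvertible hd hy) z u) w
    rw [fderiv_fun_add (d1.clm_apply dK1) ((dh1.const_mul (-ε)).fun_smul d0), add_apply,
      fderiv_eval d1 dK1, fderiv_eval_const₂ dK, fderiv_fun_smul (dh1.const_mul (-ε)) d0,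
      fderiv_const_mul dh1] at h1
    rw [fderiv_eval dNz d1u, fderiv_eval_const dN, fderiv_eval_const d1,
      hf.fderiv_diffTensor hp hd hy] at h1
    simp only [add_apply, smul_apply, ContinuousLinearMap.smulRight_apply,
      fderiv_eval_const₂ dh, (hf.isRiemannianOn hd).compat hy,
      gauss_formula hf.sq_sign hinv, inducedConn_eq (ε := ε), map_add, map_smul, map_sub,
      gaussOp_fderiv hinv, gaussOp_self hinv, smul_eq_mul] at h1
    simp only [LinearMap.add_apply, LinearMap.sub_apply, LinearMap.comp_apply,
      ContinuousLinearMap.coe_coe, gaussOp_fderiv hinv, gaussOp_self hinv, map_add, map_smul]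
    rw [← sub_eq_zero] at h1 ⊢
    rw [← h1]
    module
  · have h1 : fderiv ℝ (fun y => gaussOp ε f y z (f y)) y w = fderiv ℝ (fderiv ℝ f) y w z := by
      rw [fderiv_congr_on hf.isOpen hy fun y hy =>
          gaussOp_self (hf.frame_isInvertible hd hy) z, fderiv_eval_const d1]
    rw [fderiv_eval dNz d0, fderiv_eval_const dN] at h1
    simp only [LinearMap.add_apply, LinearMap.sub_apply, LinearMap.comp_apply,
      ContinuousLinearMap.coe_coe, gaussOp_self hinv]
    rw [eq_sub_iff_add_eq, h1, gaussOp_fderiv' hf.sq_sign hinv]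
    abel

lemma IsConvexOn.exists_gaussOp_lie_triple (hf : IsConvexOn ε f U) (hp : IsParallelOn ε f U)
    (hd : Module.finrank ℝ V = Module.finrank ℝ E + 1) (hy : y ∈ U) (v w z : E) :
    ∃ r : E, ∀ x : V, gaussOp ε f y r x =
      gaussOp ε f y z (gaussOp ε f y v (gaussOp ε f y w x)
        - gaussOp ε f y w (gaussOp ε f y v x))
      - (gaussOp ε f y v (gaussOp ε f y w (gaussOp ε f y z x))
        - gaussOp ε f y w (gaussOp ε f y v (gaussOp ε f y z x))) := by
  set L := leviCivita (metric ε f) with hL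
  set N := gaussOp ε f with hN
  have sN := hf.contDiffOn_gaussOp hd
  have dN : DifferentiableAt ℝ N y := ContDiffOn.diffAt sN hf.isOpen hy
  have dN' : DifferentiableAt ℝ (fderiv ℝ N) y :=
    ContDiffOn.diffAt (contDiffOn_fderiv sN hf.isOpen) hf.isOpen hy
  have dL : DifferentiableAt ℝ L y :=
    ContDiffOn.diffAt (hf.contDiffOn_leviCivita hd) hf.isOpen hy
  have dN1 : ∀ a : E, DifferentiableAt ℝ (fun y => N y a) y := fun a =>
    dN.clm_apply (differentiableAt_const a)
  have dN2 : ∀ (a : E) (x : V), DifferentiableAt ℝ (fun y => N y a x) y := fun a x =>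
    (dN1 a).clm_apply (differentiableAt_const x)
  have dL2 : ∀ a b : E, DifferentiableAt ℝ (fun y => L y a b) y := fun a b =>
    (dL.clm_apply (differentiableAt_const a)).clm_apply (differentiableAt_const b)
  have E1 : ∀ (w z : E) (x : V), fderiv ℝ N y w z x = N y (L y w z) x
      + N y w (N y z x) - N y z (N y w x) := hf.fderiv_gaussOp hp hd hy
  have key : ∀ (v w : E) (x : V), fderiv ℝ (fderiv ℝ N) y v w z x =
      (fderiv ℝ N y v (L y w z) x + N y (fderiv ℝ L y v w z) x)
      + (fderiv ℝ N y v w (N y z x) + N y w (fderiv ℝ N y v z x))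
      - (fderiv ℝ N y v z (N y w x) + N y z (fderiv ℝ N y v w x)) := by
    intro v w x
    have dNL : DifferentiableAt ℝ (fun y => N y (L y w z)) y := dN.clm_apply (dL2 w z)
    have h1 : fderiv ℝ (fun y => fderiv ℝ N y w z x) y v = fderiv ℝ (fderiv ℝ N) y v w z x := by
      rw [fderiv_eval_const ((dN'.clm_apply (differentiableAt_const w)).clm_apply
        (differentiableAt_const z)), fderiv_eval_const₂ dN']
    rw [← h1, fderiv_congr_on hf.isOpen hy fun y hy => hf.fderiv_gaussOp hp hd hy w z x]
    have dA : DifferentiableAt ℝ (fun y => N y (L y w z) x) y :=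
      dNL.clm_apply (differentiableAt_const x)
    have dB : DifferentiableAt ℝ (fun y => N y w (N y z x)) y := (dN1 w).clm_apply (dN2 z x)
    have dC : DifferentiableAt ℝ (fun y => N y z (N y w x)) y := (dN1 z).clm_apply (dN2 w x)
    rw [fderiv_fun_sub (dA.fun_add dB) dC, sub_apply, fderiv_fun_add dA dB, add_apply,
      fderiv_eval_const dNL, fderiv_eval dN (dL2 w z), fderiv_eval (dN1 w) (dN2 z x),
      fderiv_eval (dN1 z) (dN2 w x), fderiv_eval_const₂ dN, fderiv_eval_const₂ dN,
      fderiv_eval_const dN, fderiv_eval_const dN, fderiv_eval_const₂ dL, add_apply]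
  refine ⟨fderiv ℝ L y v w z - fderiv ℝ L y w v z + L y v (L y w z) - L y w (L y v z),
    fun x => ?_⟩
  have hs : fderiv ℝ (fderiv ℝ N) y v w z x = fderiv ℝ (fderiv ℝ N) y w v z x := by
    rw [fderiv_fderiv_symm sN hf.isOpen hy]
  have hLs : L y v w = L y w v := (hf.isRiemannianOn hd).leviCivita_symm hy v w
  rw [key, key] at hs
  simp only [E1, map_add, map_sub, hLs] at hs
  simp only [map_add, map_sub, add_apply, sub_apply]
  rw [← sub_eq_zero] at hs ⊢
  rw [← hs]
  abel

end GaussOp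
section Algebra

variable {E : Type*} [NormedAddCommGroup E] [NormedSpace ℝ E]

/-- The curvature operator `ε (h(w, z) v - h(v, z) w) - [K_v, K_w] z`. -/
noncomputable def curv (ε : ℝ) (h : E →L[ℝ] E →L[ℝ] ℝ) (K : E →L[ℝ] E →L[ℝ] E) (v w z : E) : E :=
  ε • (h w z • v - h v z • w) - K v (K w z) + K w (K v z)

/-- The algebraic properties of the metric and the difference tensor at a point of a locally
strongly convex centroaffine hypersurface with parallel cubic form. -/
structure IsCubicModel (ε : ℝ) (h : E →L[ℝ] E →L[ℝ] ℝ) (K : E →L[ℝ] E →L[ℝ] E) : Prop where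
  symm : ∀ u v, h u v = h v u
  pos : ∀ u, u ≠ 0 → 0 < h u u
  symmK : ∀ u v, K u v = K v u
  adj : ∀ u v w, h (K u v) w = h v (K u w)
  curv_act : ∀ v w z u, curv ε h K v w (K z u) =
    K (curv ε h K v w z) u + K z (curv ε h K v w u)

namespace IsCubicModel

variable {ε : ℝ} {h : E →L[ℝ] E →L[ℝ] ℝ} {K : E →L[ℝ] E →L[ℝ] E}

lemma eq_zero (hM : IsCubicModel ε h K) {x : E} (hx : h x x = 0) : x = 0 := by
  by_contra hne
  exact (hM.pos x hne).ne' hx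

lemma sum_symm (hM : IsCubicModel ε h K) (u v w : E) : h (K u v) w = h (K u w) v := by
  rw [hM.adj, hM.symm]

lemma inner_eigen (hM : IsCubicModel ε h K) {e a : E} {c : ℝ} (ha : K e a = c • a) (x : E) :
    h (K e x) a = c * h x a := by
  rw [hM.adj, ha, map_smul, smul_eq_mul]

section TypicalVector

variable {D : Submodule ℝ E} {e₁ v₁ : E} {l η : ℝ}

lemma curv_self (hM : IsCubicModel ε h K) (he : h e₁ e₁ = 1) (hK : K e₁ e₁ = l • e₁)
    {v : E} (hv : K e₁ v = (l / 2) • v) (hev : h e₁ v = 0) :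
    curv ε h K e₁ v e₁ = (l ^ 2 / 4 - ε) • v := by
  have hev' : h v e₁ = 0 := by rw [hM.symm, hev]
  have hv' : K v e₁ = (l / 2) • v := by rw [hM.symmK, hv]
  simp only [curv, he, hK, hev', hv', hv, map_smul]
  module

lemma inner_eq_zero_of_eigen (hM : IsCubicModel ε h K) (he : h e₁ e₁ = 1)
    (hK : K e₁ e₁ = l • e₁) (hl : l ^ 2 / 4 - ε ≠ 0)
    {v a b : E} {κ : ℝ} (hv : K e₁ v = (l / 2) • v) (hev : h e₁ v = 0)
    (ha : K e₁ a = κ • a) (hb : K e₁ b = κ • b) (hea : h e₁ a = 0) (heb : h e₁ b = 0) :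
    h (K v a) b = 0 := by
  have h1 := hM.curv_act e₁ v e₁ a
  have h2 : h (curv ε h K e₁ v a) b = 0 := by
    simp only [curv, ha, hea, map_add, map_sub, map_smul, add_apply, sub_apply, smul_apply,
      smul_eq_mul, hM.inner_eigen hb, heb]
    ring
  have h3 := congrArg (fun x => h x b) h1
  have h4 : h (curv ε h K e₁ v (κ • a)) b = κ * h (curv ε h K e₁ v a) b := by
    simp only [curv, map_add, map_sub, map_smul, add_apply, sub_apply, smul_apply, smul_eq_mul]
    ring
  simp only [hM.curv_self he hK hv hev, ha, h4, h2, map_add, map_smul, add_apply, smul_apply,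
    hM.inner_eigen hb, smul_eq_mul, mul_zero, add_zero] at h3
  exact (mul_eq_zero.1 h3.symm).resolve_left hl

lemma apply_apply_self (hM : IsCubicModel ε h K) (he : h e₁ e₁ = 1)
    (hK : K e₁ e₁ = l • e₁) (hD : ∀ v ∈ D, K e₁ v = (l / 2) • v) (hDe : ∀ v ∈ D, h e₁ v = 0)
    (hF : ∀ y, h e₁ y = 0 → (∀ v ∈ D, h v y = 0) → K e₁ y = ((l - η) / 2) • y)
    (hη : 0 < η) (hη2 : η ^ 2 = l ^ 2 - 4 * ε) {v : E} (hv : v ∈ D) :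
    K v (K v v) = (l * (l + η) / 4 * h v v) • v := by
  have hl : l ^ 2 / 4 - ε ≠ 0 := by nlinarith
  have hve : K v e₁ = (l / 2) • v := by rw [hM.symmK, hD v hv]
  set s := h v v with hs
  set L := K v v - (l / 2 * s) • e₁ with hL
  have hX : K v v = (l / 2 * s) • e₁ + L := by rw [hL]; abel
  have heL : h e₁ L = 0 := by
    rw [hL, map_sub, map_smul, he, hM.symm, hM.adj, hve, map_smul, smul_eq_mul, smul_eq_mul]
    ring
  have hDL : ∀ d ∈ D, h d L = 0 := fun d hd => by
    rw [hL, map_sub, map_smul, hM.symm d e₁, hDe d hd, hM.symm,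
      hM.inner_eq_zero_of_eigen he hK hl (hD v hv) (hDe v hv) (hD v hv) (hD d hd)
        (hDe v hv) (hDe d hd)]
    simp
  have hKL := hF L heL hDL
  have hR1 : curv ε h K e₁ v v = (s * (ε - l ^ 2 / 4)) • e₁ + (η / 2) • L := by
    simp only [curv, hDe v hv, hD v hv, map_smul, ← hs]
    rw [hX]
    simp only [map_add, map_smul, hK, hKL]
    module
  have hR2 : curv ε h K e₁ v L = -K e₁ (K v L) + ((l - η) / 2) • K v L := by
    simp only [curv, heL, hDL v hv, hKL, map_smul]
    module
  have h1 := hM.curv_act e₁ v v v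
  have h2 : curv ε h K e₁ v (K v v) = (l / 2 * s) • curv ε h K e₁ v e₁ + curv ε h K e₁ v L := by
    rw [hX]
    simp only [curv, map_add, map_smul, smul_eq_mul]
    module
  rw [h2, hM.curv_self he hK (hD v hv) (hDe v hv), hR2, hM.symmK _ v, hR1, map_add, map_smul,
    map_smul, hve] at h1
  set Y := K v L with hY
  set Z := Y - (l * η / 4 * s) • v with hZ
  have hYe : h e₁ Y = 0 := by
    rw [hY, hM.symm, hM.adj, hve, map_smul, hM.symm, hDL v hv, smul_zero]
  have hZe : h e₁ Z = 0 := by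
    rw [hZ, map_sub, hYe, map_smul, hDe v hv]
    simp
  have hZD : ∀ d ∈ D, h d Z = 0 := fun d hd => by
    have h3 := congrArg (fun x => h x d) h1
    simp only [map_add, map_neg, map_smul, add_apply, neg_apply, smul_apply, smul_eq_mul,
      hM.inner_eigen (hD d hd)] at h3
    rw [hZ, map_sub, map_smul, hM.symm d Y, hM.symm d v, smul_eq_mul]
    have h4 : η * (h Y d - l * η / 4 * s * h v d) = 0 := by
      have : ε = (l ^ 2 - η ^ 2) / 4 := by linarith
      subst this
      linarith
    exact (mul_eq_zero.1 h4).resolve_left hη.ne'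
  have hKZ := hF Z hZe hZD
  have hZ0 : Z = 0 := by
    refine hM.eq_zero ?_
    have h5 : h Y Z = 0 := by
      rw [hY, hM.inner_eq_zero_of_eigen he hK hl (hD v hv) (hDe v hv) hKL hKZ heL hZe]
    have h6 : ∀ x, h Z x = h Y x - l * η / 4 * s * h v x := fun x => by
      rw [hZ, map_sub, map_smul, sub_apply, smul_apply, smul_eq_mul]
    rw [h6, h5, hZD v hv, mul_zero, sub_zero]
  have hY' : Y = (l * η / 4 * s) • v := by
    rw [← sub_eq_zero]; exact hZ0
  rw [hX, map_add, map_smul, hve, ← hY, hY']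
  module

lemma exists_apply_eq_inner_smul (hM : IsCubicModel ε h K) {α : ℝ}
    (hKK : ∀ v ∈ D, K v (K v v) = (α * h v v) • v)
    (hv₁ : v₁ ∈ D) (hv₁u : h v₁ v₁ = 1) (hnull : ∀ u ∈ D, h v₁ u = 0 → K v₁ u = 0) :
    ∃ t, h t t = α ∧ t = K v₁ v₁ ∧ ∀ v ∈ D, ∀ w ∈ D, K v w = h v w • t := by
  set t := K v₁ v₁ with ht
  have hut : ∀ u ∈ D, h v₁ u = 0 → K u t = α • u := fun u hu hvu => by
    have h1 := hKK _ (D.add_mem hv₁ hu)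
    have h2 := hKK _ (D.sub_mem hv₁ hu)
    have h3 := hKK _ hu
    have h4 := hKK _ hv₁
    have huv : h u v₁ = 0 := by rw [hM.symm, hvu]
    have hK1 := hnull u hu hvu
    have hK2 : K u v₁ = 0 := by rw [hM.symmK, hK1]
    simp only [map_add, map_sub, add_apply, sub_apply, hK1, hK2, hvu, huv, hv₁u, map_zero,
      ← ht, h3] at h1 h2
    refine smul_right_injective E (two_ne_zero (α := ℝ)) ?_
    have h5 := congrArg₂ (· - ·) h1 h2
    simp only at h5 ⊢
    rw [← sub_eq_zero] at h5 ⊢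
    rw [← h5]
    module
  have htt : h t t = α := by
    nth_rewrite 1 [ht]
    rw [hM.adj, ht, hKK _ hv₁, hv₁u, map_smul, hv₁u]
    simp
  have huu : ∀ u ∈ D, h v₁ u = 0 → K u u = h u u • t := fun u hu hvu => by
    rw [← sub_eq_zero]
    refine hM.eq_zero ?_
    have a1 : h (K u u) t = α * h u u := by rw [hM.adj, hut u hu hvu, map_smul, smul_eq_mul]
    have a2 : h (K u u) (K u u) = α * h u u * h u u := by
      rw [hM.adj, hKK u hu, map_smul, smul_eq_mul]
    have a3 : h t (K u u) = α * h u u := by rw [hM.symm, a1]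
    simp only [map_sub, map_smul, sub_apply, smul_apply, a1, a2, a3, htt, smul_eq_mul]
    ring
  have hvv : ∀ v ∈ D, K v v = h v v • t := fun v hv => by
    set u := v - h v₁ v • v₁ with hu
    have hvu : h v₁ u = 0 := by
      rw [hu, map_sub, map_smul, hv₁u]
      simp
    have huD : u ∈ D := D.sub_mem hv (D.smul_mem _ hv₁)
    have huv : h u v₁ = 0 := by rw [hM.symm, hvu]
    have hK1 := hnull u huD hvu
    have hK2 : K u v₁ = 0 := by rw [hM.symmK, hK1]
    have : v = h v₁ v • v₁ + u := by rw [hu]; abel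
    generalize h v₁ v = c at this
    rw [this]
    simp only [map_add, map_smul, add_apply, smul_apply, hK1, hK2, hvu, huv, ← ht,
      huu u huD hvu, hv₁u, smul_eq_mul]
    module
  refine ⟨t, htt, rfl, fun v hv w hw => ?_⟩
  have h1 := hvv _ (D.add_mem hv hw)
  simp only [map_add, add_apply, hvv v hv, hvv w hw, hM.symmK w v, hM.symm w v] at h1
  have h2 : (2 : ℝ) • (K v w) = (2 : ℝ) • (h v w • t) := by
    rw [← sub_eq_zero] at h1 ⊢
    rw [← h1]
    module
  exact smul_right_injective E two_ne_zero h2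

end TypicalVector

/-- The symmetric operator `K_t - ε - h(·, t) t`. -/
noncomputable def splitOp (ε : ℝ) (h : E →L[ℝ] E →L[ℝ] ℝ) (K : E →L[ℝ] E →L[ℝ] E) (t y : E) : E :=
  K t y - ε • y - h t y • t

section Splitting

variable {D : Submodule ℝ E} {t v₁ : E} {α : ℝ}

lemma splitOp_symm (hM : IsCubicModel ε h K) (y z : E) :
    h (splitOp ε h K t y) z = h y (splitOp ε h K t z) := by
  simp only [splitOp, map_sub, map_smul, sub_apply, smul_apply, smul_eq_mul, hM.adj,
    hM.symm y t]
  ring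

lemma splitOp_add (y z : E) :
    splitOp ε h K t (y + z) = splitOp ε h K t y + splitOp ε h K t z := by
  simp only [splitOp, map_add]
  module

lemma splitOp_act (hM : IsCubicModel ε h K) (hproj : ∀ z, ∃ d ∈ D, ∀ v ∈ D, h v (z - d) = 0)
    (htt : h t t = α) (hDt : ∀ v ∈ D, h v t = 0)
    (hDD : ∀ v ∈ D, ∀ w ∈ D, K v w = h v w • t)
    (hDF : ∀ v ∈ D, ∀ y, (∀ d ∈ D, h d y = 0) → K v y = h t y • v)
    (hv₁ : v₁ ∈ D) (hv₁u : h v₁ v₁ = 1) :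
    splitOp ε h K t t = 0 ∧ ∀ y z, K (splitOp ε h K t y) z =
      h (splitOp ε h K t y) z • t + h t z • splitOp ε h K t y := by
  set B := splitOp ε h K t with hB
  have hDt' : ∀ d ∈ D, h t d = 0 := fun d hd => by rw [hM.symm, hDt d hd]
  have hFF : ∀ y z, (∀ d ∈ D, h d y = 0) → ∀ d ∈ D, h d (K y z) = h t y * h d z := by
    intro y z hy d hd
    rw [hM.symm, hM.adj, hM.symmK, hDF d hd y hy, map_smul, smul_eq_mul, hM.symm z]
  have hBF : ∀ y, (∀ d ∈ D, h d y = 0) → ∀ d ∈ D, h d (B y) = 0 := by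
    intro y hy d hd
    simp only [hB, splitOp, map_sub, map_smul, hy d hd, hDt d hd, smul_zero, sub_zero]
    rw [hFF t y hDt d hd, hy d hd, mul_zero]
  have hv₁v : K v₁ v₁ = t := by rw [hDD v₁ hv₁ v₁ hv₁, hv₁u, one_smul]
  have hR1 : ∀ y, (∀ d ∈ D, h d y = 0) → curv ε h K v₁ y v₁ = B y := by
    intro y hy
    have e1 : h y v₁ = 0 := by rw [hM.symm, hy v₁ hv₁]
    have e2 : K y v₁ = h t y • v₁ := by rw [hM.symmK, hDF v₁ hv₁ y hy]
    simp only [curv, hB, splitOp, e1, e2, hv₁u, hv₁v, map_smul, hM.symmK y t]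
    module
  have hR2 : ∀ y z, (∀ d ∈ D, h d y = 0) → (∀ d ∈ D, h d z = 0) →
      curv ε h K v₁ y z = -h (B y) z • v₁ := by
    intro y z hy hz
    have e3 : ∀ d ∈ D, h d (K y z) = 0 := fun d hd => by rw [hFF y z hy d hd, hz d hd, mul_zero]
    have e4 : K y v₁ = h t y • v₁ := by rw [hM.symmK, hDF v₁ hv₁ y hy]
    have e5 : h t (K y z) = h (K t y) z := by
      rw [hM.symm, hM.sum_symm, hM.symmK]
    simp only [curv, hDF v₁ hv₁ _ e3, hDF v₁ hv₁ z hz, hz v₁ hv₁, e5, e4, map_smul,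
      hB, splitOp, map_sub, sub_apply, smul_apply, smul_eq_mul]
    module
  have hBt : ∀ y, (∀ d ∈ D, h d y = 0) → h (B y) t = 0 := by
    intro y hy
    have h1 := hM.curv_act v₁ y v₁ v₁
    have e6 : h t (B y) = h (B y) t := hM.symm _ _
    rw [hv₁v, hR2 y t hy hDt, hR1 y hy, hM.symmK (B y), hDF v₁ hv₁ (B y) (hBF y hy)] at h1
    have h2 := congrArg (fun x => h v₁ x) h1
    simp only [map_add, map_smul, hv₁u, smul_eq_mul, mul_one, e6] at h2
    linarith
  have hstar : ∀ y z, (∀ d ∈ D, h d y = 0) → (∀ d ∈ D, h d z = 0) →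
      K (B y) z = h (B y) z • t + h t z • B y := by
    intro y z hy hz
    have h1 := hM.curv_act v₁ y v₁ z
    have e7 : curv ε h K v₁ y (K v₁ z) = h t z • B y := by
      rw [hDF v₁ hv₁ z hz, ← hR1 y hy]
      simp only [curv, map_smul, smul_eq_mul]
      module
    rw [e7, hR1 y hy, hR2 y z hy hz, map_smul, hv₁v] at h1
    rw [h1]
    module
  have hBD : ∀ d ∈ D, B d = (α - ε) • d := fun d hd => by
    simp only [hB, splitOp]
    rw [hM.symmK, hDF d hd t hDt, htt, hDt' d hd]
    module
  have hDstar : ∀ d ∈ D, ∀ z, K d z = h d z • t + h t z • d := by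
    intro d hd z
    obtain ⟨a, ha, hza⟩ := hproj z
    have : z = a + (z - a) := by abel
    generalize z - a = b at this hza
    subst this
    rw [map_add, hDD d hd a ha, hDF d hd b hza, map_add, map_add, hDt' a ha, hza d hd]
    module
  have hBt0 : B t = 0 := by
    refine hM.eq_zero ?_
    rw [hM.splitOp_symm, hM.symm]
    have : ∀ d ∈ D, h d (B t) = 0 := hBF t hDt
    exact hBt _ this
  refine ⟨hBt0, fun y z => ?_⟩
  obtain ⟨a, ha, hya⟩ := hproj y
  have hy' : y = a + (y - a) := by abel
  generalize y - a = b at hy' hya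
  subst hy'
  rw [hB, splitOp_add, ← hB, hBD a ha]
  have hb : K (B b) z = h (B b) z • t + h t z • B b := by
    obtain ⟨c, hc, hzc⟩ := hproj z
    have hz' : z = c + (z - c) := by abel
    generalize z - c = d at hz' hzc
    subst hz'
    have e8 : K (B b) c = 0 := by
      rw [hM.symmK, hDF c hc (B b) (hBF b hya), hM.symm, hBt b hya, zero_smul]
    have e9 : h (B b) c = 0 := by rw [hM.symm, hBF b hya c hc]
    rw [map_add, e8, hstar b d hya hzc, map_add, map_add, e9, hDt' c hc]
    module
  simp only [map_add, add_apply, map_smul, smul_apply, hb, hDstar a ha z, smul_eq_mul]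
  module

/-- The endomorphism `K_t` (extended to the ambient space) commutes with all `K_z` and satisfies a
quadratic equation. -/
lemma ext_of_inner (hM : IsCubicModel ε h K) {a b : E} (hab : ∀ w, h a w = h b w) : a = b := by
  rw [← sub_eq_zero]
  refine hM.eq_zero ?_
  rw [map_sub h, sub_apply, hab, sub_self]

lemma commute_of_splitOp (hM : IsCubicModel ε h K) (htt : h t t = α)
    (hBt : splitOp ε h K t t = 0) (hact : ∀ y z, K (splitOp ε h K t y) z =
      h (splitOp ε h K t y) z • t + h t z • splitOp ε h K t y) :
    K t t = (α + ε) • t ∧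
    (∀ z u, K t (K z u) - K z (K t u) = ε • (h z u • t - h t u • z)) ∧
    ∀ z, K t (K t z) = (α + ε) • K t z - (α * ε) • z + (ε * h t z) • t := by
  set B := splitOp ε h K t with hB
  have hK : ∀ y, K t y = B y + ε • y + h t y • t := fun y => by
    simp only [hB, splitOp]; abel
  have htt' : K t t = (α + ε) • t := by
    rw [hK, hBt, htt]; module
  have htB : ∀ y, h t (B y) = 0 := fun y => by
    rw [hM.symm, hM.splitOp_symm, ← hB, hBt, map_zero]
  have hKB : ∀ y, K t (B y) = α • B y := fun y => by
    rw [hM.symmK, hact, hM.symm, htB, htt]; module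
  refine ⟨htt', fun z u => ?_, fun z => ?_⟩
  · have key : B (K z u) = h t z • B u + h t u • B z := by
      refine ext_of_inner hM fun w => ?_
      rw [hM.splitOp_symm, ← hB]
      have e1 : h (K z u) (B w) = h u (K (B w) z) := by
        rw [hM.adj, hM.symmK]
      rw [e1, hact, map_add, map_smul, map_smul, map_add, map_smul, map_smul, add_apply,
        smul_apply, smul_apply, hM.splitOp_symm, hM.splitOp_symm, ← hB, hM.symm u t,
        hM.symm w (B z)]
      simp only [smul_eq_mul]
      ring
    have e2 : h t (K z u) = h (K t z) u := by rw [hM.symm, hM.sum_symm, hM.symmK]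
    rw [hK (K z u), key, hK u, map_add, map_add, hM.symmK z (B u), hact, map_smul, map_smul,
      hM.symmK z t, hK z, e2, hK z]
    simp only [map_add, map_smul, add_apply, smul_apply, smul_eq_mul]
    rw [hM.splitOp_symm, ← hB, hM.symm (B u), ]
    module
  · nth_rewrite 1 [hK z]
    rw [map_add, map_add, hKB, map_smul, map_smul, htt', hK z]
    module

end Splitting

/-- The pointwise splitting: for a typical vector `e₁` with eigenspaces `ℝ e₁`, `D` and their
complement such that `P_{v₁}` vanishes on the complement of `v₁` in `D`. -/
theorem exists_splitting (hM : IsCubicModel ε h K) {D : Submodule ℝ E} {e₁ v₁ : E} {l η : ℝ}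
    (he : h e₁ e₁ = 1) (hK : K e₁ e₁ = l • e₁) (hD : ∀ v ∈ D, K e₁ v = (l / 2) • v)
    (hDe : ∀ v ∈ D, h e₁ v = 0)
    (hF : ∀ y, h e₁ y = 0 → (∀ v ∈ D, h v y = 0) → K e₁ y = ((l - η) / 2) • y)
    (hproj : ∀ z, ∃ d ∈ D, ∀ v ∈ D, h v (z - d) = 0)
    (hl : 0 < l) (hη : 0 < η) (hη2 : η ^ 2 = l ^ 2 - 4 * ε)
    (hv₁ : v₁ ∈ D) (hv₁u : h v₁ v₁ = 1) (hnull : ∀ u ∈ D, h v₁ u = 0 → K v₁ u = 0) :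
    ∃ (t : E) (α : ℝ), h t t = α ∧ 0 < α ∧ ε < α ∧ h t v₁ = 0 ∧ K t v₁ = α • v₁ ∧
      K t t = (α + ε) • t ∧
      (∀ z u, K t (K z u) - K z (K t u) = ε • (h z u • t - h t u • z)) ∧
      ∀ z, K t (K t z) = (α + ε) • K t z - (α * ε) • z + (ε * h t z) • t := by
  have hl4 : l ^ 2 / 4 - ε ≠ 0 := by nlinarith
  obtain ⟨t, htt, ht, hDD⟩ := hM.exists_apply_eq_inner_smul (D := D) (α := l * (l + η) / 4)
    (fun v hv => hM.apply_apply_self he hK hD hDe hF hη hη2 hv) hv₁ hv₁u hnull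
  have hDt : ∀ v ∈ D, h v t = 0 := fun v hv => by
    rw [ht, hM.symm, hM.inner_eq_zero_of_eigen he hK hl4 (hD v₁ hv₁) (hDe v₁ hv₁) (hD v₁ hv₁)
      (hD v hv) (hDe v₁ hv₁) (hDe v hv)]
  have hDF : ∀ v ∈ D, ∀ y, (∀ d ∈ D, h d y = 0) → K v y = h t y • v := by
    intro v hv y hy
    have hF' : ∀ y z, (∀ d ∈ D, h d y = 0) → (∀ d ∈ D, h d z = 0) → h (K v y) z = 0 := by
      intro y z hy hz
      set y' := y - h e₁ y • e₁ with hy'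
      set z' := z - h e₁ z • e₁ with hz'
      have ey : h e₁ y' = 0 := by rw [hy', map_sub, map_smul, he]; simp
      have ez : h e₁ z' = 0 := by rw [hz', map_sub, map_smul, he]; simp
      have dy : ∀ d ∈ D, h d y' = 0 := fun d hd => by
        rw [hy', map_sub, map_smul, hy d hd, hM.symm d, hDe d hd]; simp
      have dz : ∀ d ∈ D, h d z' = 0 := fun d hd => by
        rw [hz', map_sub, map_smul, hz d hd, hM.symm d, hDe d hd]; simp
      have h0 := hM.inner_eq_zero_of_eigen he hK hl4 (hD v hv) (hDe v hv) (hF y' ey dy)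
        (hF z' ez dz) ey ez
      have ey' : y = h e₁ y • e₁ + y' := by rw [hy']; abel
      have ez' : z = h e₁ z • e₁ + z' := by rw [hz']; abel
      have hve : K v e₁ = (l / 2) • v := by rw [hM.symmK, hD v hv]
      have h1 : h (K v y') e₁ = 0 := by
        rw [hM.adj, hve, map_smul, hM.symm, dy v hv, smul_zero]
      rw [ey', map_add, map_smul, map_add, add_apply, hve, map_smul, map_smul, smul_apply,
        smul_apply, hz v hv, ez', map_add, map_smul, h1, h0]
      simp
    rw [← sub_eq_zero]
    have hx : ∀ d ∈ D, h d (K v y - h t y • v) = 0 := fun d hd => by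
      rw [hM.symm, map_sub, sub_apply, map_smul, smul_apply, hM.sum_symm, hDD v hv d hd, map_smul,
        smul_apply, smul_eq_mul, smul_eq_mul]
      ring
    refine hM.eq_zero ?_
    have h2 : ∀ x, h (K v y - h t y • v) x = h (K v y) x - h t y * h v x := fun x => by
      rw [map_sub, map_smul, sub_apply, smul_apply, smul_eq_mul]
    rw [h2, hF' y _ hy hx, hx v hv, mul_zero, sub_zero]
  obtain ⟨hBt, hact⟩ := hM.splitOp_act hproj htt hDt hDD hDF hv₁ hv₁u
  obtain ⟨c1, c2, c3⟩ := hM.commute_of_splitOp htt hBt hact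
  refine ⟨t, _, htt, by positivity, by nlinarith [mul_pos hl hη], by rw [hM.symm, hDt v₁ hv₁], ?_,
    c1, c2, c3⟩
  rw [hM.symmK, hDF v₁ hv₁ t hDt, htt]

end IsCubicModel

end Algebra

section Model

variable {E V : Type*} [NormedAddCommGroup E] [NormedSpace ℝ E] [FiniteDimensional ℝ E]
  [NormedAddCommGroup V] [NormedSpace ℝ V] [FiniteDimensional ℝ V]
  {ε : ℝ} {f : E → V} {U : Set E} {y : E}

lemma IsConvexOn.isCubicModel (hf : IsConvexOn ε f U) (hp : IsParallelOn ε f U)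
    (hd : Module.finrank ℝ V = Module.finrank ℝ E + 1) (hy : y ∈ U) :
    IsCubicModel ε (metric ε f y) (diffTensor ε f y) where
  symm := hf.metric_symm hy
  pos := hf.metric_pos y hy
  symmK := hf.diffTensor_symm hd hy
  adj := hf.diffTensor_adjoint hd hy
  curv_act := by
    intro v w z u
    have hinv := hf.frame_isInvertible hd hy
    obtain ⟨r, hr⟩ := hf.exists_gaussOp_lie_triple hp hd hy v w z
    set N := gaussOp ε f y with hN
    have hadj := hf.diffTensor_adjoint hd hy
    have hsymmK := hf.diffTensor_symm hd hy
    have hsymm := hf.metric_symm hy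
    have hcomm : ∀ a, N v (N w (fderiv ℝ f y a)) - N w (N v (fderiv ℝ f y a)) =
        -fderiv ℝ f y (curv ε (metric ε f y) (diffTensor ε f y) v w a) := by
      intro a
      have e1 : metric ε f y w (diffTensor ε f y v a) = metric ε f y v (diffTensor ε f y w a) := by
        rw [hsymm w, hadj v a w, hsymmK v w, ← hadj, hsymm]
      simp only [hN, gaussOp_fderiv hinv, gaussOp_self hinv, map_add, map_smul, curv, map_sub, e1]
      module
    have hcomm' : N v (N w (f y)) - N w (N v (f y)) = 0 := by
      simp only [hN, gaussOp_fderiv hinv, gaussOp_self hinv]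
      rw [hsymmK v w, hsymm v w, sub_self]
    have h0 := hr (f y)
    rw [hcomm', map_zero, zero_sub, hN, gaussOp_self hinv, gaussOp_self hinv, ← hN, hcomm,
      neg_neg] at h0
    have hr' : r = curv ε (metric ε f y) (diffTensor ε f y) v w z := hf.immersion y hy h0
    subst hr'
    have h1 := hr (fderiv ℝ f y u)
    rw [hcomm, hN, gaussOp_fderiv hinv z u, map_neg, ← hN] at h1
    have h2 : N v (N w (fderiv ℝ f y (diffTensor ε f y z u) + (-ε * metric ε f y z u) • f y))
        - N w (N v (fderiv ℝ f y (diffTensor ε f y z u) + (-ε * metric ε f y z u) • f y))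
        = -fderiv ℝ f y (curv ε (metric ε f y) (diffTensor ε f y) v w (diffTensor ε f y z u)) := by
      rw [← hcomm]
      have : (-ε * metric ε f y z u) • (N v (N w (f y)) - N w (N v (f y))) = 0 := by
        rw [hcomm', smul_zero]
      rw [← sub_eq_zero, ← this]
      simp only [map_add, map_smul]
      module
    rw [h2, hN, gaussOp_fderiv hinv, gaussOp_fderiv hinv] at h1
    have h3 := frame_eq_iff hinv (a := curv ε (metric ε f y) (diffTensor ε f y) v w
        (diffTensor ε f y z u)) (s := ε * metric ε f y (curv ε (metric ε f y)
        (diffTensor ε f y) v w z) u + ε * metric ε f y z (curv ε (metric ε f y)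
        (diffTensor ε f y) v w u))
      (b := diffTensor ε f y (curv ε (metric ε f y) (diffTensor ε f y) v w z) u +
        diffTensor ε f y z (curv ε (metric ε f y) (diffTensor ε f y) v w u)) (r := 0) (by
        rw [map_add]
        rw [← sub_eq_zero] at h1 ⊢
        rw [← neg_eq_zero, ← h1]
        module)
    exact h3.1

end Model

section Reparam

variable {E V : Type*} [NormedAddCommGroup E] [NormedSpace ℝ E] [FiniteDimensional ℝ E]
  [NormedAddCommGroup V] [NormedSpace ℝ V] [FiniteDimensional ℝ V]
  {ε : ℝ} {f f' : E → V} {U U' : Set E} {y : E} {τ : E → E}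

lemma fderiv_reparam (hf : IsConvexOn ε f U) (hU' : IsOpen U') (hτ : ContDiffOn ℝ ∞ τ U')
    (hm : Set.MapsTo τ U' U) (hff : ∀ y ∈ U', f' y = f (τ y)) (hy : y ∈ U') (u : E) :
    fderiv ℝ f' y u = fderiv ℝ f (τ y) (fderiv ℝ τ y u) := by
  rw [fderiv_congr_on hU' hy hff]
  have h1 := ContDiffOn.diffAt hf.smooth hf.isOpen (hm hy)
  have h2 := ContDiffOn.diffAt hτ hU' hy
  have := fderiv_fun_comp (𝕜 := ℝ) y (f := τ) (g := f) h1 h2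
  rw [this, ContinuousLinearMap.comp_apply]

lemma fderiv_fderiv_reparam (hf : IsConvexOn ε f U) (hf' : IsConvexOn ε f' U')
    (hτ : ContDiffOn ℝ ∞ τ U')
    (hm : Set.MapsTo τ U' U) (hff : ∀ y ∈ U', f' y = f (τ y)) (hy : y ∈ U') (z u : E) :
    fderiv ℝ (fderiv ℝ f') y z u =
      fderiv ℝ (fderiv ℝ f) (τ y) (fderiv ℝ τ y z) (fderiv ℝ τ y u)
        + fderiv ℝ f (τ y) (fderiv ℝ (fderiv ℝ τ) y z u) := by
  have hU' := hf'.isOpen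
  have d1' := ContDiffOn.diffAt (contDiffOn_fderiv hf'.smooth hU') hU' hy
  have d1 := ContDiffOn.diffAt (contDiffOn_fderiv hf.smooth hf.isOpen) hf.isOpen (hm hy)
  have dτ := ContDiffOn.diffAt hτ hU' hy
  have dτ' := ContDiffOn.diffAt (contDiffOn_fderiv hτ hU') hU' hy
  have dτu : DifferentiableAt ℝ (fun y => fderiv ℝ τ y u) y :=
    dτ'.clm_apply (differentiableAt_const u)
  have dc : DifferentiableAt ℝ (fun y => fderiv ℝ f (τ y)) y := d1.comp y dτ
  rw [← fderiv_eval_const d1',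
    fderiv_congr_on hU' hy fun y hy => fderiv_reparam hf hU' hτ hm hff hy u,
    fderiv_eval dc dτu, fderiv_eval_const dτ', fderiv_fun_comp (𝕜 := ℝ) y d1 dτ]
  rfl

lemma fderiv_reparam_bijective (hf : IsConvexOn ε f U) (hf' : IsConvexOn ε f' U')
    (hτ : ContDiffOn ℝ ∞ τ U')
    (hm : Set.MapsTo τ U' U) (hff : ∀ y ∈ U', f' y = f (τ y)) (hy : y ∈ U') :
    Function.Bijective (fderiv ℝ τ y) := by
  have hi : Function.Injective (fderiv ℝ τ y) := fun a b hab => hf'.immersion y hy (by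
    rw [fderiv_reparam hf hf'.isOpen hτ hm hff hy, fderiv_reparam hf hf'.isOpen hτ hm hff hy, hab])
  exact ⟨hi, (LinearMap.injective_iff_surjective (f := (fderiv ℝ τ y).toLinearMap)).1 hi⟩

lemma metric_reparam (hf : IsConvexOn ε f U) (hf' : IsConvexOn ε f' U')
    (hd : Module.finrank ℝ V = Module.finrank ℝ E + 1) (hτ : ContDiffOn ℝ ∞ τ U')
    (hm : Set.MapsTo τ U' U) (hff : ∀ y ∈ U', f' y = f (τ y)) (hy : y ∈ U') (z u : E) :
    metric ε f' y z u = metric ε f (τ y) (fderiv ℝ τ y z) (fderiv ℝ τ y u) := by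
  have hinv := hf.frame_isInvertible hd (hm hy)
  obtain ⟨a, ha⟩ := (fderiv_reparam_bijective hf hf' hτ hm hff hy).2
    (inducedConn f (τ y) (fderiv ℝ τ y z) (fderiv ℝ τ y u) + fderiv ℝ (fderiv ℝ τ) y z u)
  refine (gauss_unique hf.sq_sign (hf'.frame_isInvertible hd hy) (a := a) ?_).2
  rw [fderiv_fderiv_reparam hf hf' hτ hm hff hy, gauss_formula hf.sq_sign hinv,
    fderiv_reparam hf hf'.isOpen hτ hm hff hy, ha, map_add, hff y hy]
  abel

lemma leviCivita_reparam (hf : IsConvexOn ε f U) (hf' : IsConvexOn ε f' U')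
    (hd : Module.finrank ℝ V = Module.finrank ℝ E + 1) (hτ : ContDiffOn ℝ ∞ τ U')
    (hm : Set.MapsTo τ U' U) (hff : ∀ y ∈ U', f' y = f (τ y)) (hy : y ∈ U') (z u : E) :
    fderiv ℝ τ y (leviCivita (metric ε f') y z u) =
      leviCivita (metric ε f) (τ y) (fderiv ℝ τ y z) (fderiv ℝ τ y u)
        + fderiv ℝ (fderiv ℝ τ) y z u := by
  have hb := fderiv_reparam_bijective hf hf' hτ hm hff hy
  have hR := hf.isRiemannianOn hd
  have hR' := hf'.isRiemannianOn hd
  have hU' := hf'.isOpen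
  choose G hG using fun z u : E => hb.2 (leviCivita (metric ε f) (τ y) (fderiv ℝ τ y z)
    (fderiv ℝ τ y u) + fderiv ℝ (fderiv ℝ τ) y z u)
  rw [hR'.leviCivita_unique hy (G := G) ?_ ?_, hG]
  · intro u v
    refine hb.1 ?_
    rw [hG, hG, hR.leviCivita_symm (hm hy), fderiv_fderiv_symm hτ hU' hy]
  · intro w u v
    have dτ := ContDiffOn.diffAt hτ hU' hy
    have dτ' := ContDiffOn.diffAt (contDiffOn_fderiv hτ hU') hU' hy
    have dτu : ∀ u, DifferentiableAt ℝ (fun y => fderiv ℝ τ y u) y := fun u =>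
      dτ'.clm_apply (differentiableAt_const u)
    have dh := ContDiffOn.diffAt hR.smooth hf.isOpen (hm hy)
    have dh' := ContDiffOn.diffAt hR'.smooth hU' hy
    have dc : DifferentiableAt ℝ (fun y => metric ε f (τ y)) y := dh.comp y dτ
    rw [← fderiv_eval_const₂ dh',
      fderiv_congr_on hU' hy fun y hy => metric_reparam hf hf' hd hτ hm hff hy u v,
      fderiv_eval (dc.clm_apply (dτu u)) (dτu v), fderiv_eval dc (dτu u),
      fderiv_fun_comp (𝕜 := ℝ) y dh dτ, fderiv_eval_const dτ', fderiv_eval_const dτ',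
      metric_reparam hf hf' hd hτ hm hff hy, metric_reparam hf hf' hd hτ hm hff hy, hG, hG,
      ContinuousLinearMap.comp_apply, add_apply, hR.compat (hm hy)]
    simp only [map_add, add_apply]
    ring

lemma gaussOp_reparam (hf : IsConvexOn ε f U) (hf' : IsConvexOn ε f' U')
    (hd : Module.finrank ℝ V = Module.finrank ℝ E + 1) (hτ : ContDiffOn ℝ ∞ τ U')
    (hm : Set.MapsTo τ U' U) (hff : ∀ y ∈ U', f' y = f (τ y)) (hy : y ∈ U') (z : E) :
    gaussOp ε f' y z = gaussOp ε f (τ y) (fderiv ℝ τ y z) := by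
  have hinv := hf.frame_isInvertible hd (hm hy)
  have hinv' := hf'.frame_isInvertible hd hy
  ext x
  refine frame_hom_ext hinv' (A := (gaussOp ε f' y z).toLinearMap)
    (B := (gaussOp ε f (τ y) (fderiv ℝ τ y z)).toLinearMap) (fun u => ?_) ?_ x
  · simp only [ContinuousLinearMap.coe_coe]
    rw [gaussOp_fderiv' hf.sq_sign hinv', fderiv_fderiv_reparam hf hf' hτ hm hff hy,
      fderiv_reparam hf hf'.isOpen hτ hm hff hy, fderiv_reparam hf hf'.isOpen hτ hm hff hy,
      leviCivita_reparam hf hf' hd hτ hm hff hy, gaussOp_fderiv' hf.sq_sign hinv, map_add]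
    abel
  · simp only [ContinuousLinearMap.coe_coe]
    rw [gaussOp_self hinv', fderiv_reparam hf hf'.isOpen hτ hm hff hy, hff y hy,
      gaussOp_self hinv]

/-- The endomorphism `A` of the ambient space is `D_t - ∇̂_t` for a tangent vector `t` at `y`, and it
commutes with `D_z - ∇̂_z` for all tangent vectors `z` at `y`. -/
def IsSplitAt (ε : ℝ) (f : E → V) (A : V →L[ℝ] V) (y : E) : Prop :=
  (∃ t, gaussOp ε f y t = A) ∧ ∀ z x, A (gaussOp ε f y z x) = gaussOp ε f y z (A x)

lemma isSplitAt_reparam (hf : IsConvexOn ε f U) (hf' : IsConvexOn ε f' U')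
    (hd : Module.finrank ℝ V = Module.finrank ℝ E + 1) (hτ : ContDiffOn ℝ ∞ τ U')
    (hm : Set.MapsTo τ U' U) (hff : ∀ y ∈ U', f' y = f (τ y)) (hy : y ∈ U') {A : V →L[ℝ] V}
    (h : IsSplitAt ε f A (τ y)) : IsSplitAt ε f' A y := by
  obtain ⟨⟨t, ht⟩, hc⟩ := h
  obtain ⟨t', rfl⟩ := (fderiv_reparam_bijective hf hf' hτ hm hff hy).2 t
  refine ⟨⟨t', by rw [gaussOp_reparam hf hf' hd hτ hm hff hy, ht]⟩, fun z x => ?_⟩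
  rw [gaussOp_reparam hf hf' hd hτ hm hff hy, hc]

end Reparam

section Propagation

variable {E V : Type*} [NormedAddCommGroup E] [NormedSpace ℝ E] [FiniteDimensional ℝ E]
  [NormedAddCommGroup V] [NormedSpace ℝ V] [FiniteDimensional ℝ V]
  {ε : ℝ} {f : E → V} {U : Set E} {y : E} {A : V →L[ℝ] V}

/-- The tangential component of `A f`. -/
noncomputable def splitVec (f : E → V) (A : V →L[ℝ] V) (y : E) : E :=
  ((frame f y).inverse (A (f y))).1

/-- The component of `A f` in the direction of `f`. -/
noncomputable def splitCoef (f : E → V) (A : V →L[ℝ] V) (y : E) : ℝ :=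
  ((frame f y).inverse (A (f y))).2

lemma apply_eq_split (hinv : (frame f y).IsInvertible) :
    A (f y) = fderiv ℝ f y (splitVec f A y) + splitCoef f A y • f y :=
  exists_frame_coord hinv _

lemma IsConvexOn.contDiffOn_inverse_apply (hf : IsConvexOn ε f U)
    (hd : Module.finrank ℝ V = Module.finrank ℝ E + 1) :
    ContDiffOn ℝ ∞ (fun y => (frame f y).inverse (A (f y))) U :=
  (hf.contDiffOn_inverse_frame hd).clm_apply (A.contDiff.comp_contDiffOn hf.smooth)

lemma IsConvexOn.contDiffOn_splitVec (hf : IsConvexOn ε f U)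
    (hd : Module.finrank ℝ V = Module.finrank ℝ E + 1) : ContDiffOn ℝ ∞ (splitVec f A) U :=
  contDiff_fst.comp_contDiffOn (hf.contDiffOn_inverse_apply hd)

lemma IsConvexOn.contDiffOn_splitCoef (hf : IsConvexOn ε f U)
    (hd : Module.finrank ℝ V = Module.finrank ℝ E + 1) : ContDiffOn ℝ ∞ (splitCoef f A) U :=
  contDiff_snd.comp_contDiffOn (hf.contDiffOn_inverse_apply hd)

lemma IsConvexOn.fderiv_split (hf : IsConvexOn ε f U)
    (hd : Module.finrank ℝ V = Module.finrank ℝ E + 1) (hy : y ∈ U)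
    (hc : ∀ z x, A (gaussOp ε f y z x) = gaussOp ε f y z (A x)) (w : E) :
    fderiv ℝ (splitVec f A) y w = -leviCivita (metric ε f) y w (splitVec f A y) ∧
      fderiv ℝ (splitCoef f A) y w = 0 := by
  have hinv := hf.frame_isInvertible hd hy
  have d0 := ContDiffOn.diffAt hf.smooth hf.isOpen hy
  have d1 := ContDiffOn.diffAt (contDiffOn_fderiv hf.smooth hf.isOpen) hf.isOpen hy
  have dt := ContDiffOn.diffAt (hf.contDiffOn_splitVec hd (A := A)) hf.isOpen hy
  have dc := ContDiffOn.diffAt (hf.contDiffOn_splitCoef hd (A := A)) hf.isOpen hy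
  have h1 : fderiv ℝ (fun y => A (f y)) y w = A (fderiv ℝ f y w) := by
    have := (A.hasFDerivAt.comp y d0.hasFDerivAt).fderiv
    exact DFunLike.congr_fun this w
  rw [fderiv_congr_on hf.isOpen hy fun y hy =>
      apply_eq_split (A := A) (hf.frame_isInvertible hd hy),
    fderiv_fun_add (d1.clm_apply dt) (dc.fun_smul d0), add_apply, fderiv_eval d1 dt,
    fderiv_fun_smul dc d0, ← gaussOp_self (ε := ε) hinv w, hc, apply_eq_split hinv, map_add,
    map_smul, gaussOp_fderiv' hf.sq_sign hinv, gaussOp_self hinv] at h1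
  simp only [add_apply, smul_apply, ContinuousLinearMap.smulRight_apply] at h1
  have h2 := frame_eq_iff hinv
    (a := fderiv ℝ (splitVec f A) y w) (s := fderiv ℝ (splitCoef f A) y w)
    (b := -leviCivita (metric ε f) y w (splitVec f A y)) (r := 0) (by
      rw [map_neg]
      rw [← sub_eq_zero] at h1 ⊢
      rw [← h1]
      module)
  exact h2

lemma IsConvexOn.gaussOp_eq_of_commute (hf : IsConvexOn ε f U)
    (hd : Module.finrank ℝ V = Module.finrank ℝ E + 1) (hy : y ∈ U)
    (hc : ∀ z x, A (gaussOp ε f y z x) = gaussOp ε f y z (A x)) {t : E}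
    (ht : A (f y) = fderiv ℝ f y t) : gaussOp ε f y t = A := by
  have hinv := hf.frame_isInvertible hd hy
  ext x
  refine frame_hom_ext hinv (A := (gaussOp ε f y t).toLinearMap) (B := A.toLinearMap)
    (fun u => ?_) ?_ x
  · simp only [ContinuousLinearMap.coe_coe]
    rw [← gaussOp_self (ε := ε) hinv u, hc, ht, gaussOp_self hinv, gaussOp_fderiv hinv,
      gaussOp_fderiv hinv, hf.diffTensor_symm hd hy, hf.metric_symm hy]
  · simp only [ContinuousLinearMap.coe_coe]
    rw [ht, gaussOp_self hinv]

lemma IsConvexOn.commute_of_segment (hf : IsConvexOn ε f U) (hp : IsParallelOn ε f U)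
    (hd : Module.finrank ℝ V = Module.finrank ℝ E + 1) (hU : Convex ℝ U) {y₀ y₁ : E}
    (h₀ : y₀ ∈ U) (h₁ : y₁ ∈ U)
    (hc : ∀ z x, A (gaussOp ε f y₀ z x) = gaussOp ε f y₀ z (A x)) (z : E) (x : V) :
    A (gaussOp ε f y₁ z x) = gaussOp ε f y₁ z (A x) := by
  let T : (V →L[ℝ] V) →L[ℝ] (V →L[ℝ] V) :=
    ContinuousLinearMap.compL ℝ V V V A - (ContinuousLinearMap.compL ℝ V V V).flip A
  have hT : ∀ X x, T X x = A (X x) - X (A x) := fun X x => rfl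
  let H : E → E →L[ℝ] V →L[ℝ] V := fun y => T.comp (gaussOp ε f y)
  have sN := hf.contDiffOn_gaussOp hd
  have sH : ContDiffOn ℝ ∞ H U := contDiffOn_const.clm_comp sN
  have hH : ∀ y ∈ U, ∀ w z x, fderiv ℝ H y w z x = H y (leviCivita (metric ε f) y w z) x
      + (H y w (gaussOp ε f y z x) + gaussOp ε f y w (H y z x))
      - (H y z (gaussOp ε f y w x) + gaussOp ε f y z (H y w x)) := by
    intro y hy w z x
    have dN := ContDiffOn.diffAt sN hf.isOpen hy
    have e : fderiv ℝ H y w = T.comp (fderiv ℝ (gaussOp ε f) y w) := by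
      have := ((ContinuousLinearMap.compL ℝ E (V →L[ℝ] V) (V →L[ℝ] V) T).hasFDerivAt.comp y
        dN.hasFDerivAt).fderiv
      exact DFunLike.congr_fun this w
    rw [e, ContinuousLinearMap.comp_apply, hT]
    simp only [hf.fderiv_gaussOp hp hd hy, H, ContinuousLinearMap.comp_apply, hT, map_add, map_sub]
    abel
  set w := y₁ - y₀ with hw
  let γ : ℝ → E := fun s => y₀ + s • w
  have hγ : ∀ s ∈ Set.Icc (0 : ℝ) 1, γ s ∈ U := fun s hs =>
    hU.add_smul_sub_mem h₀ h₁ hs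
  have hγc : Continuous γ := by fun_prop
  have hγd : ∀ s, HasDerivAt γ w s := fun s => by
    have := ((hasDerivAt_id s).smul_const w).const_add y₀
    rw [one_smul] at this
    exact this
  have hmaps : Set.MapsTo γ (Set.Icc 0 1) U := hγ
  have cB : ContinuousOn (fun s => ‖leviCivita (metric ε f) (γ s)‖ * ‖w‖
      + 4 * ‖gaussOp ε f (γ s)‖ * ‖w‖) (Set.Icc (0 : ℝ) 1) := by
    have c1 := ((hf.contDiffOn_leviCivita hd).continuousOn.comp hγc.continuousOn hmaps).norm
    have c2 := (sN.continuousOn.comp hγc.continuousOn hmaps).norm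
    exact (c1.mul continuousOn_const).add ((continuousOn_const.mul c2).mul continuousOn_const)
  obtain ⟨C, hC⟩ := isCompact_Icc.exists_bound_of_continuousOn cB
  have key := eq_zero_of_abs_deriv_le_mul_abs_self_of_eq_zero_right (f := fun s => H (γ s))
    (f' := fun s => fderiv ℝ H (γ s) w) (K := C) (a := 0) (b := 1)
    (sH.continuousOn.comp hγc.continuousOn hmaps) ?_ ?_ ?_ 1 (by simp)
  · have e1 : γ 1 = y₁ := by simp [γ, hw]
    rw [e1] at key
    have := DFunLike.congr_fun (DFunLike.congr_fun key z) x
    simp only [H, ContinuousLinearMap.comp_apply, hT, zero_apply] at this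
    exact sub_eq_zero.1 this
  · intro s hs
    have hs' := hγ s ⟨hs.1, hs.2.le⟩
    exact ((ContDiffOn.diffAt sH hf.isOpen hs').hasFDerivAt.comp_hasDerivAt s
      (hγd s)).hasDerivWithinAt
  · have e0 : γ 0 = y₀ := by simp [γ]
    rw [e0]
    ext z x
    simp [H, hT, hc]
  · intro s hs
    have hs' := hγ s ⟨hs.1, hs.2.le⟩
    have hCs := hC s ⟨hs.1, hs.2.le⟩
    rw [Real.norm_eq_abs] at hCs
    refine le_trans ?_ (mul_le_mul_of_nonneg_right ((le_abs_self _).trans hCs) (norm_nonneg _))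
    refine ContinuousLinearMap.opNorm_le_bound _ (by positivity) fun z => ?_
    refine ContinuousLinearMap.opNorm_le_bound _ (by positivity) fun x => ?_
    rw [hH _ hs']
    set N := gaussOp ε f (γ s)
    set L := leviCivita (metric ε f) (γ s)
    set Q := H (γ s)
    have b1 : ‖Q (L w z) x‖ ≤ ‖Q‖ * (‖L‖ * ‖w‖ * ‖z‖) * ‖x‖ :=
      (Q.le_opNorm₂ _ _).trans (by gcongr; exact L.le_opNorm₂ _ _)
    have b2 : ∀ a b : E, ‖Q a (N b x)‖ ≤ ‖Q‖ * ‖a‖ * (‖N‖ * ‖b‖ * ‖x‖) := fun a b =>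
      (Q.le_opNorm₂ _ _).trans (by gcongr; exact N.le_opNorm₂ _ _)
    have b3 : ∀ a b : E, ‖N a (Q b x)‖ ≤ ‖N‖ * ‖a‖ * (‖Q‖ * ‖b‖ * ‖x‖) := fun a b =>
      (N.le_opNorm₂ _ _).trans (by gcongr; exact Q.le_opNorm₂ _ _)
    calc _ ≤ ‖Q (L w z) x‖ + (‖Q w (N z x)‖ + ‖N w (Q z x)‖)
          + (‖Q z (N w x)‖ + ‖N z (Q w x)‖) := by
          refine (norm_sub_le _ _).trans (add_le_add ((norm_add_le _ _).trans ?_) (norm_add_le _ _))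
          exact add_le_add le_rfl (norm_add_le _ _)
      _ ≤ _ := add_le_add (add_le_add b1 (add_le_add (b2 w z) (b3 w z)))
          (add_le_add (b2 z w) (b3 z w))
      _ = _ := by ring

lemma IsConvexOn.isSplitAt_of_segment (hf : IsConvexOn ε f U) (hp : IsParallelOn ε f U)
    (hd : Module.finrank ℝ V = Module.finrank ℝ E + 1) (hU : Convex ℝ U) {y₀ y₁ : E}
    (h₀ : y₀ ∈ U) (h₁ : y₁ ∈ U) (h : IsSplitAt ε f A y₀) : IsSplitAt ε f A y₁ := by
  obtain ⟨⟨t, ht⟩, hc⟩ := h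
  have hc' : ∀ y ∈ U, ∀ z x, A (gaussOp ε f y z x) = gaussOp ε f y z (A x) := fun y hy =>
    hf.commute_of_segment hp hd hU h₀ hy hc
  have hconst : splitCoef f A y₀ = splitCoef f A y₁ := by
    refine hU.is_const_of_fderivWithin_eq_zero (𝕜 := ℝ)
      ((hf.contDiffOn_splitCoef hd (A := A)).differentiableOn (by simp)) (fun y hy => ?_) h₀ h₁
    rw [fderivWithin_of_isOpen hf.isOpen hy]
    ext w
    exact (hf.fderiv_split hd hy (hc' y hy) w).2
  have hinv₀ := hf.frame_isInvertible hd h₀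
  have h0 : splitCoef f A y₀ = 0 := by
    rw [splitCoef, frame_inverse_eq hinv₀ (a := t) (s := 0)]
    rw [← ht, gaussOp_self hinv₀]
    simp
  refine ⟨⟨splitVec f A y₁, hf.gaussOp_eq_of_commute hd h₁ (hc' y₁ h₁) ?_⟩, hc' y₁ h₁⟩
  rw [apply_eq_split (hf.frame_isInvertible hd h₁), ← hconst, h0, zero_smul, add_zero]

end Propagation

section Factor

variable {E V E₁ V₁ : Type*} [NormedAddCommGroup E] [NormedSpace ℝ E] [FiniteDimensional ℝ E]
  [NormedAddCommGroup V] [NormedSpace ℝ V] [FiniteDimensional ℝ V]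
  [NormedAddCommGroup E₁] [NormedSpace ℝ E₁] [FiniteDimensional ℝ E₁]
  [NormedAddCommGroup V₁] [NormedSpace ℝ V₁] [FiniteDimensional ℝ V₁]
  {ε : ℝ} {f : E → V} {U : Set E}

/-- A factor of a decomposition of the hypersurface `f` with respect to the projection `ι ∘ ρ` of the
ambient space: `j : E₁ → E` is the inclusion of the factor and `π : E → E₁` the projection. -/
structure IsFactor (ε κ : ℝ) (f : E → V) (U : Set E) (ι : V₁ →L[ℝ] V) (ρ : V →L[ℝ] V₁)
    (j : E₁ →L[ℝ] E) (π : E →L[ℝ] E₁) : Prop where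
  ρ_ι : ∀ x, ρ (ι x) = x
  π_j : ∀ a, π (j a) = a
  commute : ∀ y ∈ U, ∀ z x, ι (ρ (gaussOp ε f y z x)) = gaussOp ε f y z (ι (ρ x))
  tangent : ∀ y ∈ U, ∀ a, ι (ρ (fderiv ℝ f y (j a))) = fderiv ℝ f y (j a)
  transversal : ∀ y ∈ U, ∀ u, fderiv ℝ f y u ≠ ι (ρ (f y))
  decomp : ∀ y ∈ U, ∀ (z : E) (c : ℝ), ι (ρ (fderiv ℝ f y z + (-ε * c) • f y)) =
      fderiv ℝ f y z + (-ε * c) • f y →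
    fderiv ℝ f y z + (-ε * c) • f y = fderiv ℝ f y (j (π z)) + (κ * c) • ι (ρ (f y))

variable {κ ε₁ s : ℝ} {ι : V₁ →L[ℝ] V} {ρ : V →L[ℝ] V₁} {j : E₁ →L[ℝ] E} {π : E →L[ℝ] E₁}
  {y₀ : E} {U₁ : Set E₁} {ψ : E₁ → V₁} {v : E₁}

lemma hasFDerivAt_slice (v : E₁) : HasFDerivAt (fun v => y₀ + j v) j v :=
  j.hasFDerivAt.const_add y₀

lemma fderiv_comp_slice {F : Type*} [NormedAddCommGroup F] [NormedSpace ℝ F] {g : E → F}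
    (hg : DifferentiableAt ℝ g (y₀ + j v)) (a : E₁) :
    fderiv ℝ (fun v => g (y₀ + j v)) v a = fderiv ℝ g (y₀ + j v) (j a) := by
  have := (hg.hasFDerivAt.comp v (hasFDerivAt_slice (y₀ := y₀) (j := j) v)).fderiv
  exact DFunLike.congr_fun this a

lemma differentiableAt_comp_slice {F : Type*} [NormedAddCommGroup F] [NormedSpace ℝ F] {g : E → F}
    (hg : DifferentiableAt ℝ g (y₀ + j v)) : DifferentiableAt ℝ (fun v => g (y₀ + j v)) v :=
  (hg.hasFDerivAt.comp v (hasFDerivAt_slice (y₀ := y₀) (j := j) v)).differentiableAt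

variable (hf : IsConvexOn ε f U) (hp : IsParallelOn ε f U)
    (hd : Module.finrank ℝ V = Module.finrank ℝ E + 1)
    (hF : IsFactor ε κ f U ι ρ j π) (hU₁ : IsOpen U₁) (hm : ∀ v ∈ U₁, y₀ + j v ∈ U)
    (hψ : ∀ v ∈ U₁, ψ v = s • ρ (f (y₀ + j v)))

include hf hU₁ hm hψ in
lemma slice_fderiv (hv : v ∈ U₁) (a : E₁) :
    fderiv ℝ ψ v a = s • ρ (fderiv ℝ f (y₀ + j v) (j a)) := by
  have d0 := ContDiffOn.diffAt hf.smooth hf.isOpen (hm v hv)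
  have := ((s • ρ).hasFDerivAt.comp v
    (d0.hasFDerivAt.comp v (hasFDerivAt_slice (y₀ := y₀) (j := j) v))).fderiv
  rw [fderiv_congr_on hU₁ hv hψ]
  exact DFunLike.congr_fun this a

include hf hU₁ hm hψ in
lemma slice_contDiffOn : ContDiffOn ℝ ∞ ψ U₁ := by
  refine ContDiffOn.congr ?_ hψ
  exact ContDiffOn.const_smul s (ρ.contDiff.comp_contDiffOn
    (hf.smooth.comp (contDiff_const.add j.contDiff).contDiffOn hm))

include hf hU₁ hm hψ in
lemma slice_fderiv_fderiv (hv : v ∈ U₁) (a b : E₁) :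
    fderiv ℝ (fderiv ℝ ψ) v a b =
      s • ρ (fderiv ℝ (fderiv ℝ f) (y₀ + j v) (j a) (j b)) := by
  have d1' := ContDiffOn.diffAt (contDiffOn_fderiv (slice_contDiffOn hf hU₁ hm hψ) hU₁) hU₁ hv
  have d1 := ContDiffOn.diffAt (contDiffOn_fderiv hf.smooth hf.isOpen) hf.isOpen (hm v hv)
  have d1b : DifferentiableAt ℝ (fun y => fderiv ℝ f y (j b)) (y₀ + j v) :=
    d1.clm_apply (differentiableAt_const _)
  rw [← fderiv_eval_const d1', fderiv_congr_on hU₁ hv fun v hv =>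
    slice_fderiv hf hU₁ hm hψ hv b]
  have := ((s • ρ).hasFDerivAt.comp v
    (d1b.hasFDerivAt.comp v (hasFDerivAt_slice (y₀ := y₀) (j := j) v))).fderiv
  rw [← fderiv_eval_const d1]
  exact DFunLike.congr_fun this a

include hf hF hU₁ hm hψ in
lemma slice_frame_isInvertible (hd₁ : Module.finrank ℝ V₁ = Module.finrank ℝ E₁ + 1)
    (hs : s ≠ 0) (hv : v ∈ U₁) : (frame ψ v).IsInvertible := by
  refine frame_isInvertible_of_injective hd₁ fun a r h => ?_
  have hy := hm v hv
  rw [slice_fderiv hf hU₁ hm hψ hv, hψ v hv, smul_comm r, ← smul_add, smul_eq_zero_iff_right hs] at h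
  have h1 := congrArg ι h
  rw [map_add, hF.tangent _ hy, map_smul, map_zero] at h1
  have hr : r = 0 := by
    by_contra hr
    refine hF.transversal _ hy (-r⁻¹ • j a) ?_
    rw [map_smul, eq_neg_of_add_eq_zero_left h1, smul_neg, neg_smul, neg_neg, smul_smul,
      inv_mul_cancel₀ hr, one_smul]
  subst hr
  rw [zero_smul, add_zero] at h1
  have h2 := hf.immersion _ hy (h1.trans (map_zero _).symm)
  rw [← hF.π_j a, h2, map_zero]
  exact ⟨rfl, rfl⟩

include hf hF in
lemma factor_fderiv_fderiv {y : E} (hy : y ∈ U) (z : E) (b : E₁) :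
    ι (ρ (fderiv ℝ (fderiv ℝ f) y z (j b))) = fderiv ℝ (fderiv ℝ f) y z (j b) := by
  have d1 := ContDiffOn.diffAt (contDiffOn_fderiv hf.smooth hf.isOpen) hf.isOpen hy
  have d1b : DifferentiableAt ℝ (fun y => fderiv ℝ f y (j b)) y :=
    d1.clm_apply (differentiableAt_const _)
  have h1 := DFunLike.congr_fun (fderiv_congr_on hf.isOpen hy fun y hy => hF.tangent y hy b) z
  have h2 : fderiv ℝ (fun y => ι (ρ (fderiv ℝ f y (j b)))) y z =
      ι (ρ (fderiv ℝ (fun y => fderiv ℝ f y (j b)) y z)) :=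
    DFunLike.congr_fun ((ι.comp ρ).hasFDerivAt.comp y d1b.hasFDerivAt).fderiv z
  rw [fderiv_eval_const d1] at h1 h2
  exact h2.symm.trans h1

include hf hF hd hU₁ hm hψ in
lemma slice_gauss (hd₁ : Module.finrank ℝ V₁ = Module.finrank ℝ E₁ + 1) (hs : s ≠ 0)
    (hε₁ : ε₁ * ε₁ = 1) (hv : v ∈ U₁) (a b : E₁) :
    inducedConn ψ v a b = π (inducedConn f (y₀ + j v) (j a) (j b)) ∧
      metric ε₁ ψ v a b = -ε₁ * κ * metric ε f (y₀ + j v) (j a) (j b) := by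
  have hy := hm v hv
  have hinv := hf.frame_isInvertible hd hy
  refine gauss_unique hε₁ (slice_frame_isInvertible hf hF hU₁ hm hψ hd₁ hs hv) ?_
  have h1 := factor_fderiv_fderiv hf hF hy (j a) b
  rw [gauss_formula hf.sq_sign hinv] at h1
  rw [slice_fderiv_fderiv hf hU₁ hm hψ hv, gauss_formula hf.sq_sign hinv, hF.decomp _ hy _ _ h1,
    slice_fderiv hf hU₁ hm hψ hv, hψ v hv, map_add, map_smul, hF.ρ_ι, smul_add, smul_comm _ s,
    ← mul_assoc, ← mul_assoc, neg_mul_neg, hε₁, one_mul]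

include hf hF hd in
lemma factor_leviCivita {y : E} (hy : y ∈ U) (z : E) (b : E₁) :
    leviCivita (metric ε f) y z (j b) = j (π (leviCivita (metric ε f) y z (j b))) := by
  have hinv := hf.frame_isInvertible hd hy
  have h1 := hF.commute y hy z (fderiv ℝ f y (j b))
  rw [hF.tangent y hy, gaussOp_fderiv' hf.sq_sign hinv, map_sub, map_sub,
    factor_fderiv_fderiv hf hF hy] at h1
  have h2 := hF.decomp y hy (leviCivita (metric ε f) y z (j b)) 0
  simp only [mul_zero, zero_smul, add_zero] at h2
  exact hf.immersion y hy (h2 (by simpa using h1))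

include hf hF hd in
lemma factor_metric_inducedConn {y : E} (hy : y ∈ U) (a b c : E₁) :
    metric ε f y (j (π (inducedConn f y (j a) (j b)))) (j c) =
      metric ε f y (inducedConn f y (j a) (j b)) (j c) := by
  have hinv := hf.frame_isInvertible hd hy
  obtain ⟨t, r, ht⟩ : ∃ t r, ι (ρ (f y)) = fderiv ℝ f y t + r • f y :=
    ⟨_, _, exists_frame_coord hinv _⟩
  have h1 := hF.commute y hy (j c) (f y)
  rw [gaussOp_self hinv, hF.tangent y hy, ht, map_add, map_smul, gaussOp_fderiv hinv,
    gaussOp_self hinv] at h1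
  have h2 := (frame_eq_iff hinv (a := j c) (s := 0)
    (b := diffTensor ε f y (j c) t + r • j c) (r := -ε * metric ε f y (j c) t) (by
      rw [zero_smul, add_zero, h1, map_add, map_smul]; abel)).2
  have h3 : metric ε f y t (j c) = 0 := by
    rw [hf.metric_symm hy]
    exact (mul_eq_zero.1 h2.symm).resolve_left (by rcases hf.sign with h | h <;> simp [h])
  have h4 := factor_fderiv_fderiv hf hF hy (j a) b
  rw [gauss_formula hf.sq_sign hinv] at h4
  have h5 := hF.decomp _ hy _ _ h4
  rw [ht, smul_add, smul_smul, ← map_smul, ← add_assoc, ← map_add] at h5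
  conv_rhs => rw [(frame_eq_iff hinv h5).1]
  rw [map_add, add_apply, map_smul, smul_apply, h3, smul_zero, add_zero]

include hf hF hd hU₁ hm hψ in
theorem slice_isConvexOn (hd₁ : Module.finrank ℝ V₁ = Module.finrank ℝ E₁ + 1) (hs : s ≠ 0)
    (hε₁ : ε₁ = 1 ∨ ε₁ = -1) (hκ : 0 < -ε₁ * κ) : IsConvexOn ε₁ ψ U₁ := by
  have hε₁' : ε₁ * ε₁ = 1 := by rcases hε₁ with h | h <;> simp [h]
  refine ⟨hε₁, hU₁, slice_contDiffOn hf hU₁ hm hψ, fun v hv a b hab => ?_, fun v hv u hu => ?_,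
    fun v hv u hu => ?_⟩
  · exact (frame_eq_iff (slice_frame_isInvertible hf hF hU₁ hm hψ hd₁ hs hv)
      (s := 0) (r := 0) (by simpa using hab)).1
  · have := (frame_eq_iff (slice_frame_isInvertible hf hF hU₁ hm hψ hd₁ hs hv) (a := u) (b := 0)
      (s := 0) (r := 1) (by simpa using hu)).2
    exact zero_ne_one this
  · rw [(slice_gauss hf hd hF hU₁ hm hψ hd₁ hs hε₁' hv u u).2]
    refine mul_pos hκ (hf.metric_pos _ (hm v hv) _ fun h => hu ?_)
    rw [← hF.π_j u, h, map_zero]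

include hf hF hd hU₁ hm hψ in
lemma slice_fderiv_metric (hd₁ : Module.finrank ℝ V₁ = Module.finrank ℝ E₁ + 1) (hs : s ≠ 0)
    (hε₁ : ε₁ = 1 ∨ ε₁ = -1) (hκ : 0 < -ε₁ * κ) (hv : v ∈ U₁) (w a b : E₁) :
    fderiv ℝ (metric ε₁ ψ) v w a b =
      -ε₁ * κ * fderiv ℝ (metric ε f) (y₀ + j v) (j w) (j a) (j b) := by
  have hc := slice_isConvexOn hf hd hF hU₁ hm hψ hd₁ hs hε₁ hκ
  have dh := ContDiffOn.diffAt (hf.contDiffOn_metric hd) hf.isOpen (hm v hv)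
  have dh₁ := ContDiffOn.diffAt (hc.contDiffOn_metric hd₁) hc.isOpen hv
  have dab : DifferentiableAt ℝ (fun y => metric ε f y (j a) (j b)) (y₀ + j v) :=
    (dh.clm_apply (differentiableAt_const _)).clm_apply (differentiableAt_const _)
  have dab' : DifferentiableAt ℝ (fun v => metric ε f (y₀ + j v) (j a) (j b)) v :=
    differentiableAt_comp_slice dab
  rw [← fderiv_eval_const₂ dh₁, fderiv_congr_on hU₁ hv fun v hv =>
    (slice_gauss hf hd hF hU₁ hm hψ hd₁ hs hc.sq_sign hv a b).2, fderiv_const_mul dab',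
    smul_apply, fderiv_comp_slice dab, fderiv_eval_const₂ dh, smul_eq_mul]

include hf hF hd hU₁ hm hψ in
lemma slice_leviCivita (hd₁ : Module.finrank ℝ V₁ = Module.finrank ℝ E₁ + 1) (hs : s ≠ 0)
    (hε₁ : ε₁ = 1 ∨ ε₁ = -1) (hκ : 0 < -ε₁ * κ) (hv : v ∈ U₁) (a b : E₁) :
    j (leviCivita (metric ε₁ ψ) v a b) = leviCivita (metric ε f) (y₀ + j v) (j a) (j b) := by
  have hc := slice_isConvexOn hf hd hF hU₁ hm hψ hd₁ hs hε₁ hκ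
  have hy := hm v hv
  rw [(hc.isRiemannianOn hd₁).leviCivita_unique hv
    (G := fun a b => π (leviCivita (metric ε f) (y₀ + j v) (j a) (j b))),
    ← factor_leviCivita hf hd hF hy]
  · intro a b
    rw [(hf.isRiemannianOn hd).leviCivita_symm hy]
  · intro w a b
    rw [slice_fderiv_metric hf hd hF hU₁ hm hψ hd₁ hs hε₁ hκ hv,
      (slice_gauss hf hd hF hU₁ hm hψ hd₁ hs hc.sq_sign hv _ _).2,
      (slice_gauss hf hd hF hU₁ hm hψ hd₁ hs hc.sq_sign hv _ _).2,
      ← factor_leviCivita hf hd hF hy, ← factor_leviCivita hf hd hF hy,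
      (hf.isRiemannianOn hd).compat hy]
    ring

include hf hF hd hU₁ hm hψ in
lemma slice_cubicForm (hd₁ : Module.finrank ℝ V₁ = Module.finrank ℝ E₁ + 1) (hs : s ≠ 0)
    (hε₁ : ε₁ = 1 ∨ ε₁ = -1) (hκ : 0 < -ε₁ * κ) (hv : v ∈ U₁) (a b c : E₁) :
    cubicForm ε₁ ψ v a b c = -ε₁ * κ * cubicForm ε f (y₀ + j v) (j a) (j b) (j c) := by
  have hc := slice_isConvexOn hf hd hF hU₁ hm hψ hd₁ hs hε₁ hκ
  have hy := hm v hv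
  simp only [cubicForm]
  rw [slice_fderiv_metric hf hd hF hU₁ hm hψ hd₁ hs hε₁ hκ hv, hc.metric_symm hv b,
    (slice_gauss hf hd hF hU₁ hm hψ hd₁ hs hc.sq_sign hv _ _).2,
    (slice_gauss hf hd hF hU₁ hm hψ hd₁ hs hc.sq_sign hv _ _).2,
    (slice_gauss hf hd hF hU₁ hm hψ hd₁ hs hc.sq_sign hv _ _).1,
    (slice_gauss hf hd hF hU₁ hm hψ hd₁ hs hc.sq_sign hv _ _).1,
    factor_metric_inducedConn hf hd hF hy, factor_metric_inducedConn hf hd hF hy,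
    hf.metric_symm hy (j b)]
  ring

include hf hp hF hd hU₁ hm hψ in
theorem slice_isParallelOn (hd₁ : Module.finrank ℝ V₁ = Module.finrank ℝ E₁ + 1) (hs : s ≠ 0)
    (hε₁ : ε₁ = 1 ∨ ε₁ = -1) (hκ : 0 < -ε₁ * κ) : IsParallelOn ε₁ ψ U₁ := by
  intro v hv z a b c
  have hy := hm v hv
  have h := hp _ hy (j z) (j a) (j b) (j c)
  have dC : DifferentiableAt ℝ (fun y => cubicForm ε f y (j a) (j b) (j c)) (y₀ + j v) := by
    have dh := ContDiffOn.diffAt (hf.contDiffOn_metric hd) hf.isOpen hy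
    have dh' := ContDiffOn.diffAt (contDiffOn_fderiv (hf.contDiffOn_metric hd) hf.isOpen)
      hf.isOpen hy
    have dG := ContDiffOn.diffAt (hf.contDiffOn_inducedConn hd) hf.isOpen hy
    simp only [cubicForm]
    fun_prop
  have dC' : DifferentiableAt ℝ (fun v => cubicForm ε f (y₀ + j v) (j a) (j b) (j c)) v :=
    differentiableAt_comp_slice dC
  simp only [covDerivCubicForm] at h ⊢
  rw [fderiv_congr_on hU₁ hv fun v hv =>
      slice_cubicForm hf hd hF hU₁ hm hψ hd₁ hs hε₁ hκ hv a b c, fderiv_const_mul dC',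
    smul_apply, fderiv_comp_slice dC, smul_eq_mul,
    slice_cubicForm hf hd hF hU₁ hm hψ hd₁ hs hε₁ hκ hv,
    slice_cubicForm hf hd hF hU₁ hm hψ hd₁ hs hε₁ hκ hv,
    slice_cubicForm hf hd hF hU₁ hm hψ hd₁ hs hε₁ hκ hv,
    slice_leviCivita hf hd hF hU₁ hm hψ hd₁ hs hε₁ hκ hv,
    slice_leviCivita hf hd hF hU₁ hm hψ hd₁ hs hε₁ hκ hv,
    slice_leviCivita hf hd hF hU₁ hm hψ hd₁ hs hε₁ hκ hv, ← mul_sub, ← mul_sub, ← mul_sub, h,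
    mul_zero]

end Factor

section Split

variable {E V : Type*} [NormedAddCommGroup E] [NormedSpace ℝ E] [FiniteDimensional ℝ E]
  [NormedAddCommGroup V] [NormedSpace ℝ V] [FiniteDimensional ℝ V]
  {ε α : ℝ} {f : E → V} {U : Set E} {y : E} {A : V →L[ℝ] V}

lemma IsSplitAt.apply_self (hinv : (frame f y).IsInvertible) (h : IsSplitAt ε f A y) :
    A (f y) = fderiv ℝ f y (splitVec f A y) := by
  obtain ⟨⟨t, ht⟩, -⟩ := h
  have : A (f y) = fderiv ℝ f y t + (0 : ℝ) • f y := by rw [← ht, gaussOp_self hinv]; simp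
  rw [splitVec, frame_inverse_eq hinv this]
  simpa using this

lemma IsSplitAt.gaussOp_splitVec (hinv : (frame f y).IsInvertible) (h : IsSplitAt ε f A y) :
    gaussOp ε f y (splitVec f A y) = A := by
  obtain ⟨⟨t, ht⟩, -⟩ := h
  have : A (f y) = fderiv ℝ f y t + (0 : ℝ) • f y := by rw [← ht, gaussOp_self hinv]; simp
  rw [splitVec, frame_inverse_eq hinv this, ht]

lemma IsConvexOn.split_norm (hf : IsConvexOn ε f U)
    (hd : Module.finrank ℝ V = Module.finrank ℝ E + 1) (hy : y ∈ U) (hs : IsSplitAt ε f A y)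
    (hA : ∀ x, A (A x) = (α + ε) • A x - (α * ε) • x) :
    metric ε f y (splitVec f A y) (splitVec f A y) = α ∧
      diffTensor ε f y (splitVec f A y) (splitVec f A y) = (α + ε) • splitVec f A y := by
  have hinv := hf.frame_isInvertible hd hy
  have h1 := hA (f y)
  have h2 := hs.gaussOp_splitVec hinv
  set t := splitVec f A y
  rw [hs.apply_self hinv] at h1
  nth_rewrite 1 [← h2] at h1
  rw [gaussOp_fderiv hinv] at h1
  obtain ⟨a1, a2⟩ := frame_eq_iff hinv (b := (α + ε) • t) (r := -(α * ε)) (h1.trans (by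
    rw [map_smul]; module))
  refine ⟨?_, a1⟩
  have hε : -ε ≠ 0 := by rcases hf.sign with h | h <;> simp [h]
  exact mul_left_cancel₀ hε (by linarith)

lemma IsConvexOn.exists_split_decomp (hf : IsConvexOn ε f U)
    (hd : Module.finrank ℝ V = Module.finrank ℝ E + 1) (hy : y ∈ U) (hs : IsSplitAt ε f A y)
    (hA : ∀ x, A (A x) = (α + ε) • A x - (α * ε) • x) (hα : 0 < α) (hαε : ε < α) (z : E) :
    ∃ z₁ z₂ : E, metric ε f y (splitVec f A y) z₁ = 0 ∧ metric ε f y (splitVec f A y) z₂ = 0 ∧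
      fderiv ℝ f y z₁ = (α - ε)⁻¹ • (A (fderiv ℝ f y z - metric ε f y (splitVec f A y) z • f y) -
        ε • (fderiv ℝ f y z - metric ε f y (splitVec f A y) z • f y)) ∧
      fderiv ℝ f y z₂ = (α - ε)⁻¹ •
        (α • (fderiv ℝ f y z + (-(ε / α) * metric ε f y (splitVec f A y) z) • f y) -
        A (fderiv ℝ f y z + (-(ε / α) * metric ε f y (splitVec f A y) z) • f y)) := by
  have hinv := hf.frame_isInvertible hd hy
  obtain ⟨n1, n2⟩ := hf.split_norm hd hy hs hA
  have h2 := hs.gaussOp_splitVec hinv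
  have h3 := hs.apply_self hinv
  have hadj := hf.diffTensor_adjoint hd hy (splitVec f A y) (splitVec f A y) z
  have hne : α - ε ≠ 0 := (sub_pos.2 hαε).ne'
  set t := splitVec f A y
  have h4 : A (fderiv ℝ f y z) = fderiv ℝ f y (diffTensor ε f y t z) +
      (-ε * metric ε f y t z) • f y := by
    rw [← h2, gaussOp_fderiv hinv]
  rw [n2, map_smul, smul_apply, smul_eq_mul] at hadj
  set s := metric ε f y t z with hs'
  set k := diffTensor ε f y t z
  set z₁ := (α - ε)⁻¹ • (k - ε • z - s • t) with hz₁
  have m1 : metric ε f y t z₁ = 0 := by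
    rw [hz₁, map_smul, map_sub, map_sub, map_smul, map_smul, ← hadj, n1, ← hs']
    simp only [smul_eq_mul]
    ring
  have e1 : (α - ε) • fderiv ℝ f y z₁ = fderiv ℝ f y (k - ε • z - s • t) := by
    rw [hz₁, map_smul, smul_smul, mul_inv_cancel₀ hne, one_smul]
  refine ⟨z₁, z - z₁ - (s / α) • t, m1, ?_, ?_, ?_⟩
  · rw [map_sub, map_sub, m1, map_smul, n1, smul_eq_mul, div_mul_cancel₀ _ hα.ne', ← hs']
    ring
  · rw [eq_inv_smul_iff₀ hne, e1, map_sub A, map_smul A, h4, h3]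
    simp only [map_sub, map_smul]
    module
  · rw [eq_inv_smul_iff₀ hne, map_sub, map_sub, smul_sub, smul_sub, e1, map_add A, map_smul A, h4,
      h3]
    simp only [map_sub, map_smul]
    match_scalars <;> field_simp <;> ring

end Split

section Linear

variable {F G : Type*} [NormedAddCommGroup F] [NormedSpace ℝ F] [FiniteDimensional ℝ F]
  [NormedAddCommGroup G] [NormedSpace ℝ G] [FiniteDimensional ℝ G]

lemma exists_clm_ker_eq_span {b : F} (hb : b ≠ 0)
    (hd : Module.finrank ℝ F = Module.finrank ℝ G + 1) :
    ∃ c : F →L[ℝ] G, ∀ x, c x = 0 → ∃ a : ℝ, x = a • b := by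
  have h1 := (ℝ ∙ b).finrank_quotient_add_finrank
  rw [finrank_span_singleton hb, hd] at h1
  let e : (F ⧸ (ℝ ∙ b)) ≃ₗ[ℝ] G := LinearEquiv.ofFinrankEq _ _ (by omega)
  refine ⟨LinearMap.toContinuousLinearMap (e.toLinearMap ∘ₗ (ℝ ∙ b).mkQ), fun x hx => ?_⟩
  have h2 : (ℝ ∙ b).mkQ x = 0 := by simpa using hx
  obtain ⟨a, ha⟩ := Submodule.mem_span_singleton.1 ((Submodule.Quotient.mk_eq_zero _).1 h2)
  exact ⟨a, ha.symm⟩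

lemma eq_of_fderiv_segment {g : F → G} {U : Set F} (hU : Convex ℝ U) (hUo : IsOpen U)
    (hg : DifferentiableOn ℝ g U) {b b' : F} (hb : b ∈ U) (hb' : b' ∈ U)
    (h : ∀ y ∈ U, fderiv ℝ g y (b' - b) = 0) : g b' = g b := by
  have hγ : ∀ s ∈ Set.Icc (0 : ℝ) 1, b + s • (b' - b) ∈ U := fun s hs =>
    hU.add_smul_sub_mem hb hb' hs
  have hd : ∀ s ∈ Set.Icc (0 : ℝ) 1, HasDerivAt (fun s : ℝ => g (b + s • (b' - b))) 0 s := by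
    intro s hs
    have h1 := ((hasDerivAt_id s).smul_const (b' - b)).const_add b
    rw [one_smul] at h1
    have h2 := ((hg.differentiableAt (hUo.mem_nhds (hγ s hs))).hasFDerivAt).comp_hasDerivAt s h1
    rwa [h _ (hγ s hs)] at h2
  have := constant_of_has_deriv_right_zero (f := fun s : ℝ => g (b + s • (b' - b)))
    (a := 0) (b := 1) (fun s hs => (hd s hs).continuousAt.continuousWithinAt)
    (fun s hs => (hd s ⟨hs.1, hs.2.le⟩).hasDerivWithinAt) 1 (by simp)
  simpa using this

end Linear

section LocalProduct

variable {E V E₁ V₁ E₂ V₂ : Type*} [NormedAddCommGroup E] [NormedSpace ℝ E]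
  [FiniteDimensional ℝ E]
  [NormedAddCommGroup V] [NormedSpace ℝ V] [FiniteDimensional ℝ V]
  [NormedAddCommGroup E₁] [NormedSpace ℝ E₁] [FiniteDimensional ℝ E₁]
  [NormedAddCommGroup V₁] [NormedSpace ℝ V₁] [FiniteDimensional ℝ V₁]
  [NormedAddCommGroup E₂] [NormedSpace ℝ E₂] [FiniteDimensional ℝ E₂]
  [NormedAddCommGroup V₂] [NormedSpace ℝ V₂] [FiniteDimensional ℝ V₂]
  {ε α : ℝ} {f : E → V} {U : Set E} {y : E} {A : V →L[ℝ] V}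
  {ι₁ : V₁ →L[ℝ] V} {ρ₁ : V →L[ℝ] V₁} {ι₂ : V₂ →L[ℝ] V} {ρ₂ : V →L[ℝ] V₂}

/-- The splitting of the ambient space into the eigenspaces of `A`. -/
structure IsEigenSplitting (ε α : ℝ) (A : V →L[ℝ] V) (ι₁ : V₁ →L[ℝ] V) (ρ₁ : V →L[ℝ] V₁)
    (ι₂ : V₂ →L[ℝ] V) (ρ₂ : V →L[ℝ] V₂) : Prop where
  quad : ∀ x, A (A x) = (α + ε) • A x - (α * ε) • x
  ρ_ι₁ : ∀ x, ρ₁ (ι₁ x) = x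
  ρ_ι₂ : ∀ x, ρ₂ (ι₂ x) = x
  proj₁ : ∀ x, ι₁ (ρ₁ x) = (α - ε)⁻¹ • (A x - ε • x)
  proj₂ : ∀ x, ι₂ (ρ₂ x) = (α - ε)⁻¹ • (α • x - A x)

namespace IsEigenSplitting

lemma add_eq (h : IsEigenSplitting ε α A ι₁ ρ₁ ι₂ ρ₂) (hαε : ε < α) (x : V) :
    ι₁ (ρ₁ x) + ι₂ (ρ₂ x) = x := by
  have hne : α - ε ≠ 0 := (sub_pos.2 hαε).ne'
  rw [h.proj₁, h.proj₂]
  match_scalars <;> field_simp <;> ring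

lemma ρ₁_eq_zero (h : IsEigenSplitting ε α A ι₁ ρ₁ ι₂ ρ₂) (x : V) : ρ₁ (ι₂ (ρ₂ x)) = 0 := by
  have : ι₁ (ρ₁ (ι₂ (ρ₂ x))) = 0 := by
    rw [h.proj₂, h.proj₁]
    simp only [map_smul, map_sub, h.quad]
    module
  rw [← h.ρ_ι₁ (ρ₁ (ι₂ (ρ₂ x))), this, map_zero]

lemma ρ₂_eq_zero (h : IsEigenSplitting ε α A ι₁ ρ₁ ι₂ ρ₂) (x : V) : ρ₂ (ι₁ (ρ₁ x)) = 0 := by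
  have : ι₂ (ρ₂ (ι₁ (ρ₁ x))) = 0 := by
    rw [h.proj₁, h.proj₂]
    simp only [map_smul, map_sub, h.quad]
    module
  rw [← h.ρ_ι₂ (ρ₂ (ι₁ (ρ₁ x))), this, map_zero]

lemma proj₁_self (h : IsEigenSplitting ε α A ι₁ ρ₁ ι₂ ρ₂) (hinv : (frame f y).IsInvertible)
    (hs : IsSplitAt ε f A y) :
    ι₁ (ρ₁ (f y)) = fderiv ℝ f y ((α - ε)⁻¹ • splitVec f A y) + (-((α - ε)⁻¹ * ε)) • f y := by
  rw [h.proj₁, hs.apply_self hinv, map_smul]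
  module

lemma proj₂_self (h : IsEigenSplitting ε α A ι₁ ρ₁ ι₂ ρ₂) (hinv : (frame f y).IsInvertible)
    (hs : IsSplitAt ε f A y) :
    ι₂ (ρ₂ (f y)) = fderiv ℝ f y (-(α - ε)⁻¹ • splitVec f A y) + ((α - ε)⁻¹ * α) • f y := by
  rw [h.proj₂, hs.apply_self hinv, map_smul]
  module

end IsEigenSplitting

theorem exists_local_product (hf : IsConvexOn ε f U)
    (hd : Module.finrank ℝ V = Module.finrank ℝ E + 1)
    (hs : ∀ y ∈ U, IsSplitAt ε f A y) (hα : 0 < α) (hαε : ε < α)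
    (hι : IsEigenSplitting ε α A ι₁ ρ₁ ι₂ ρ₂)
    (hd₁ : Module.finrank ℝ V₁ = Module.finrank ℝ E₁ + 1)
    (hd₂ : Module.finrank ℝ V₂ = Module.finrank ℝ E₂ + 1)
    (hdE : Module.finrank ℝ E = Module.finrank ℝ E₁ + Module.finrank ℝ E₂ + 1)
    (hy : y ∈ U) :
    ∃ (Ψ : OpenPartialHomeomorph E (ℝ × E₁ × E₂)) (I : Set ℝ) (U₁ : Set E₁) (U₂ : Set E₂)
      (ψ₁ : E₁ → V₁) (ψ₂ : E₂ → V₂),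
      Ψ.source ⊆ U ∧ y ∈ Ψ.source ∧ Ψ.target = I ×ˢ U₁ ×ˢ U₂ ∧ IsOpen U₁ ∧ IsOpen U₂ ∧
      ContDiffOn ℝ ∞ Ψ Ψ.source ∧ ContDiffOn ℝ ∞ Ψ.symm Ψ.target ∧
      ∀ u ∈ I, ∀ p ∈ U₁, ∀ r ∈ U₂, f (Ψ.symm (u, p, r)) =
        Real.exp u • ι₁ (ψ₁ p) + Real.exp (ε / α * u) • ι₂ (ψ₂ r) := by
  have hne : α - ε ≠ 0 := (sub_pos.2 hαε).ne'
  have hε0 : ε ≠ 0 := by rcases hf.sign with h | h <;> simp [h]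
  obtain ⟨R, hR, hball⟩ := Metric.isOpen_iff.1 hf.isOpen y hy
  set B := Metric.ball y R with hB
  have hBo : IsOpen B := Metric.isOpen_ball
  -- the potential of the closed form `h(t, ·)`
  set t := splitVec f A with ht
  set θ : E → E →L[ℝ] ℝ := fun a => metric ε f a (t a) with hθ
  have sθ : ContDiffOn ℝ ∞ θ U := (hf.contDiffOn_metric hd).clm_apply (hf.contDiffOn_splitVec hd)
  have hθs : ∀ a ∈ B, ∀ x z, fderiv ℝ θ a x z = fderiv ℝ θ a z x := by
    intro a ha
    have haU := hball ha
    have hk : ∀ x z, fderiv ℝ θ a x z = metric ε f a (t a) (leviCivita (metric ε f) a x z) := by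
      intro x z
      rw [← fderiv_eval_const (ContDiffOn.diffAt sθ hf.isOpen haU), hf.fderiv_metric_eval hd haU
        (ContDiffOn.diffAt (hf.contDiffOn_splitVec hd) hf.isOpen haU),
        (hf.fderiv_split hd haU (hs a haU).2 x).1, ← ht, neg_add_cancel, map_zero, zero_apply,
        zero_add]
    intro x z
    rw [hk, hk, (hf.isRiemannianOn hd).leviCivita_symm haU]
  obtain ⟨u, hu⟩ := (convex_ball y R).exists_forall_hasFDerivAt_of_fderiv_symmetric hBo
    ((sθ.mono hball).differentiableOn (by simp)) hθs
  have su : ContDiffOn ℝ ∞ u B := by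
    rw [contDiffOn_infty_iff_fderiv_of_isOpen hBo]
    exact ⟨fun a ha => (hu a ha).differentiableAt.differentiableWithinAt,
      (sθ.mono hball).congr fun a ha => (hu a ha).fderiv⟩
  -- the two components
  set φ₁ : E → V₁ := fun a => Real.exp (-u a) • ρ₁ (f a) with hφ₁
  set φ₂ : E → V₂ := fun a => Real.exp (-(ε / α) * u a) • ρ₂ (f a) with hφ₂
  have hdf : ∀ a ∈ B, HasFDerivAt f (fderiv ℝ f a) a := fun a ha =>
    (ContDiffOn.diffAt hf.smooth hf.isOpen (hball ha)).hasFDerivAt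
  have dφ₁ : ∀ a ∈ B, ∀ z, fderiv ℝ φ₁ a z =
      Real.exp (-u a) • ρ₁ (fderiv ℝ f a z - θ a z • f a) := by
    intro a ha z
    have h1 := ((hu a ha).fun_neg.exp).smul (ρ₁.hasFDerivAt.comp a (hdf a ha))
    have h2 := DFunLike.congr_fun h1.fderiv z
    refine (Eq.trans ?_ h2).trans ?_
    · rfl
    · simp only [add_apply, smul_apply, ContinuousLinearMap.smulRight_apply, neg_apply,
        ContinuousLinearMap.comp_apply, Function.comp_apply, map_sub, map_smul, smul_eq_mul]
      module
  have dφ₂ : ∀ a ∈ B, ∀ z, fderiv ℝ φ₂ a z =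
      Real.exp (-(ε / α) * u a) • ρ₂ (fderiv ℝ f a z + (-(ε / α) * θ a z) • f a) := by
    intro a ha z
    have h1 := (((hu a ha).const_mul (-(ε / α))).exp).smul (ρ₂.hasFDerivAt.comp a (hdf a ha))
    have h2 := DFunLike.congr_fun h1.fderiv z
    refine (Eq.trans ?_ h2).trans ?_
    · rfl
    · simp only [add_apply, smul_apply, ContinuousLinearMap.smulRight_apply,
        ContinuousLinearMap.comp_apply, Function.comp_apply, map_add, map_smul, smul_eq_mul]
      module
  have sφ₁ : ContDiffOn ℝ ∞ φ₁ B :=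
    (su.neg.exp).smul (ρ₁.contDiff.comp_contDiffOn (hf.smooth.mono hball))
  have sφ₂ : ContDiffOn ℝ ∞ φ₂ B :=
    ((contDiffOn_const.mul su).exp).smul (ρ₂.contDiff.comp_contDiffOn (hf.smooth.mono hball))
  have hinv : ∀ a ∈ B, (frame f a).IsInvertible := fun a ha => hf.frame_isInvertible hd (hball ha)
  have hyB : y ∈ B := Metric.mem_ball_self hR
  have hp₁ := hι.proj₁_self (hinv y hyB) (hs y hy)
  have hp₂ := hι.proj₂_self (hinv y hyB) (hs y hy)
  have e0 : fderiv ℝ f y 0 + (0 : ℝ) • f y = 0 := by rw [map_zero, zero_smul, add_zero]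
  have hb₁ : ρ₁ (f y) ≠ 0 := fun h0 => by
    rw [h0, map_zero] at hp₁
    have := (frame_eq_iff (hinv y hyB) (a := 0) (s := 0)
      (e0.trans hp₁)).2
    exact neg_ne_zero.2 (mul_ne_zero (inv_ne_zero hne) hε0) this.symm
  have hb₂ : ρ₂ (f y) ≠ 0 := fun h0 => by
    rw [h0, map_zero] at hp₂
    have := (frame_eq_iff (hinv y hyB) (a := 0) (s := 0)
      (e0.trans hp₂)).2
    exact mul_ne_zero (inv_ne_zero hne) hα.ne' this.symm
  obtain ⟨c₁, hc₁⟩ := exists_clm_ker_eq_span (G := E₁) hb₁ hd₁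
  obtain ⟨c₂, hc₂⟩ := exists_clm_ker_eq_span (G := E₂) hb₂ hd₂
  -- the coordinates
  set Γ : E → ℝ × E₁ × E₂ := fun a => (u a, c₁ (φ₁ a), c₂ (φ₂ a)) with hΓ
  have sΓ : ContDiffOn ℝ ∞ Γ B :=
    su.prodMk ((c₁.contDiff.comp_contDiffOn sφ₁).prodMk (c₂.contDiff.comp_contDiffOn sφ₂))
  have dΓ : ∀ a ∈ B, ∀ z, fderiv ℝ Γ a z = (θ a z, c₁ (fderiv ℝ φ₁ a z), c₂ (fderiv ℝ φ₂ a z)) := by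
    intro a ha z
    have e1 := (ContDiffOn.diffAt sφ₁ hBo ha).hasFDerivAt
    have e2 := (ContDiffOn.diffAt sφ₂ hBo ha).hasFDerivAt
    have := ((hu a ha).prodMk ((c₁.hasFDerivAt.comp a e1).prodMk
      (c₂.hasFDerivAt.comp a e2))).fderiv
    exact DFunLike.congr_fun this z
  have hdim : Module.finrank ℝ E = Module.finrank ℝ (ℝ × E₁ × E₂) := by
    rw [Module.finrank_prod, Module.finrank_prod, hdE, Module.finrank_self]; ring
  have hinj : Function.Injective (fderiv ℝ Γ y).toLinearMap := by
    rw [← LinearMap.ker_eq_bot, LinearMap.ker_eq_bot']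
    intro z hz
    have hz' : fderiv ℝ Γ y z = 0 := hz
    rw [dΓ y hyB, dφ₁ y hyB, dφ₂ y hyB, Prod.mk_eq_zero, Prod.mk_eq_zero] at hz'
    obtain ⟨z0, z1, z2⟩ := hz'
    rw [z0, zero_smul, sub_zero, map_smul,
      smul_eq_zero_iff_right (Real.exp_pos _).ne'] at z1
    rw [z0, mul_zero, zero_smul, add_zero, map_smul,
      smul_eq_zero_iff_right (Real.exp_pos _).ne'] at z2
    obtain ⟨a, ha⟩ := hc₁ _ z1
    obtain ⟨b, hb⟩ := hc₂ _ z2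
    have h1 := hι.add_eq hαε (fderiv ℝ f y z)
    rw [ha, hb, map_smul, map_smul, hp₁, hp₂] at h1
    have h2 := frame_eq_iff (hinv y hyB) (a := z) (s := 0)
      (b := (a * (α - ε)⁻¹ - b * (α - ε)⁻¹) • t y)
      (r := -(a * (α - ε)⁻¹ * ε) + b * (α - ε)⁻¹ * α) (by
        rw [← h1]
        simp only [map_smul]
        module)
    have h3 : (a * (α - ε)⁻¹ - b * (α - ε)⁻¹) * α = 0 := by
      have h4 : metric ε f y (t y) z = 0 := z0
      rw [h2.1, map_smul, (hf.split_norm hd hy (hs y hy) hι.quad).1, smul_eq_mul] at h4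
      exact h4
    rw [h2.1, (mul_eq_zero.1 h3).resolve_right hα.ne', zero_smul]
  let M₀ : E ≃L[ℝ] ℝ × E₁ × E₂ :=
    (LinearEquiv.ofInjectiveOfFinrankEq _ hinj hdim).toContinuousLinearEquiv
  have hM₀ : (M₀ : E →L[ℝ] ℝ × E₁ × E₂) = fderiv ℝ Γ y := by ext1 z; rfl
  have hΓy : HasFDerivAt Γ (M₀ : E →L[ℝ] ℝ × E₁ × E₂) y := by
    rw [hM₀]; exact (ContDiffOn.diffAt sΓ hBo hyB).hasFDerivAt
  have cΓy : ContDiffAt ℝ ∞ Γ y := sΓ.contDiffAt (hBo.mem_nhds hyB)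
  let Ψ₀ := cΓy.toOpenPartialHomeomorph Γ hΓy (by simp)
  have hΨ₀ : ∀ a, Ψ₀ a = Γ a := fun a => rfl
  have hyΨ : y ∈ Ψ₀.source := cΓy.mem_toOpenPartialHomeomorph_source hΓy (by simp)
  set W := Ψ₀.source ∩ (B ∩ fderiv ℝ Γ ⁻¹' (Set.range ((↑) : (E ≃L[ℝ] ℝ × E₁ × E₂) → _))) with hW
  have hWo : IsOpen W := Ψ₀.open_source.inter
    ((contDiffOn_fderiv sΓ hBo).continuousOn.isOpen_inter_preimage hBo
      (ContinuousLinearEquiv.isOpen (𝕜 := ℝ)))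
  have hyW : y ∈ W := ⟨hyΨ, hyB, M₀, hM₀⟩
  have himo : IsOpen (Ψ₀ '' W) := Ψ₀.isOpen_image_of_subset_source hWo Set.inter_subset_left
  obtain ⟨δ, hδ, hQ⟩ := Metric.isOpen_iff.1 himo (Ψ₀ y) ⟨y, hyW, rfl⟩
  set Q := Metric.ball (Ψ₀ y) δ with hQdef
  have hQo : IsOpen Q := Metric.isOpen_ball
  have hQt : Q ⊆ Ψ₀.target := fun b hb => by
    obtain ⟨a, ha, rfl⟩ := hQ hb
    exact Ψ₀.map_source ha.1
  have hQW : ∀ b ∈ Q, Ψ₀.symm b ∈ W := fun b hb => by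
    obtain ⟨a, ha, rfl⟩ := hQ hb
    rwa [Ψ₀.left_inv ha.1]
  have sΨ : ContDiffOn ℝ ∞ Ψ₀.symm Q := fun b hb => by
    obtain ⟨M, hM⟩ := (hQW b hb).2.2
    have hb' := (hQW b hb).2.1
    have h1 : HasFDerivAt Ψ₀ (M : E →L[ℝ] ℝ × E₁ × E₂) (Ψ₀.symm b) := by
      rw [hM]; exact (ContDiffOn.diffAt sΓ hBo hb').hasFDerivAt
    exact (Ψ₀.contDiffAt_symm (hQt hb) h1 (sΓ.contDiffAt (hBo.mem_nhds hb'))).contDiffWithinAt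
  have hright : ∀ b ∈ Q, Γ (Ψ₀.symm b) = b := fun b hb => Ψ₀.right_inv (hQt hb)
  have hdright : ∀ b ∈ Q, ∀ x, fderiv ℝ Γ (Ψ₀.symm b) (fderiv ℝ Ψ₀.symm b x) = x := by
    intro b hb x
    have e1 := (ContDiffOn.diffAt sΓ hBo (hQW b hb).2.1).hasFDerivAt
    have e2 := (ContDiffOn.diffAt sΨ hQo hb).hasFDerivAt
    have e3 := (e1.comp b e2).fderiv
    have e4 : fderiv ℝ (Γ ∘ Ψ₀.symm) b = ContinuousLinearMap.id ℝ _ :=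
      (Filter.EventuallyEq.fderiv_eq (f₁ := Γ ∘ Ψ₀.symm) (f := id)
        (Filter.eventually_of_mem (hQo.mem_nhds hb) hright)).trans fderiv_id
    exact (DFunLike.congr_fun (e4.symm.trans e3) x).symm
  have hker : ∀ a ∈ W, ∀ z, fderiv ℝ Γ a z = 0 → z = 0 := by
    intro a ha z hz
    obtain ⟨M, hM⟩ := ha.2.2
    rw [← hM] at hz
    exact (map_eq_zero_iff M M.injective).1 hz
  have hv₁ : ∀ b ∈ Q, ∀ x : ℝ × E₁ × E₂, x.2.1 = 0 → fderiv ℝ (φ₁ ∘ Ψ₀.symm) b x = 0 := by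
    intro b hb x hx
    have haW := hQW b hb
    have haB := haW.2.1
    rw [fderiv_comp b (ContDiffOn.diffAt sφ₁ hBo haB) (ContDiffOn.diffAt sΨ hQo hb),
      ContinuousLinearMap.comp_apply]
    have hz := hdright b hb x
    set a := Ψ₀.symm b
    set z := fderiv ℝ Ψ₀.symm b x
    obtain ⟨z₁, -, m1, -, e1, -⟩ := hf.exists_split_decomp hd (hball haB) (hs a (hball haB)) hι.quad
      hα hαε z
    rw [← hι.proj₁] at e1
    have h1 : fderiv ℝ φ₁ a z₁ = fderiv ℝ φ₁ a z := by
      rw [dφ₁ a haB, dφ₁ a haB, show θ a z₁ = 0 from m1, zero_smul, sub_zero, e1, hι.ρ_ι₁]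
    have h2 : fderiv ℝ φ₂ a z₁ = 0 := by
      rw [dφ₂ a haB, show θ a z₁ = 0 from m1, mul_zero, zero_smul, add_zero, e1, hι.ρ₂_eq_zero,
        smul_zero]
    have h3 : c₁ (fderiv ℝ φ₁ a z) = 0 := by
      rw [dΓ a haB] at hz
      rw [← hx, ← hz]
    have h4 : z₁ = 0 := hker a haW z₁ (by
      rw [dΓ a haB, h1, h2, h3, show θ a z₁ = 0 from m1, map_zero]; rfl)
    rw [← h1, h4, map_zero]
  have hv₂ : ∀ b ∈ Q, ∀ x : ℝ × E₁ × E₂, x.2.2 = 0 → fderiv ℝ (φ₂ ∘ Ψ₀.symm) b x = 0 := by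
    intro b hb x hx
    have haW := hQW b hb
    have haB := haW.2.1
    rw [fderiv_comp b (ContDiffOn.diffAt sφ₂ hBo haB) (ContDiffOn.diffAt sΨ hQo hb),
      ContinuousLinearMap.comp_apply]
    have hz := hdright b hb x
    set a := Ψ₀.symm b
    set z := fderiv ℝ Ψ₀.symm b x
    obtain ⟨-, z₂, -, m2, -, e2⟩ := hf.exists_split_decomp hd (hball haB) (hs a (hball haB)) hι.quad
      hα hαε z
    rw [← hι.proj₂] at e2
    have h1 : fderiv ℝ φ₂ a z₂ = fderiv ℝ φ₂ a z := by
      rw [dφ₂ a haB, dφ₂ a haB, show θ a z₂ = 0 from m2, mul_zero, zero_smul, add_zero, e2,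
        hι.ρ_ι₂]
    have h2 : fderiv ℝ φ₁ a z₂ = 0 := by
      rw [dφ₁ a haB, show θ a z₂ = 0 from m2, zero_smul, sub_zero, e2, hι.ρ₁_eq_zero,
        smul_zero]
    have h3 : c₂ (fderiv ℝ φ₂ a z) = 0 := by
      rw [dΓ a haB] at hz
      rw [← hx, ← hz]
    have h4 : z₂ = 0 := hker a haW z₂ (by
      rw [dΓ a haB, h1, h2, h3, show θ a z₂ = 0 from m2, map_zero]; rfl)
    rw [← h1, h4, map_zero]
  have hmQ : Set.MapsTo Ψ₀.symm Q B := fun b hb => (hQW b hb).2.1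
  have dg₁ : DifferentiableOn ℝ (φ₁ ∘ Ψ₀.symm) Q :=
    (sφ₁.differentiableOn (by simp)).comp (sΨ.differentiableOn (by simp)) hmQ
  have dg₂ : DifferentiableOn ℝ (φ₂ ∘ Ψ₀.symm) Q :=
    (sφ₂.differentiableOn (by simp)).comp (sΨ.differentiableOn (by simp)) hmQ
  obtain ⟨u₀, p₀, r₀, hb₀⟩ : ∃ u₀ p₀ r₀, Ψ₀ y = (u₀, p₀, r₀) := ⟨_, _, _, rfl⟩
  have hQprod : Q = Metric.ball u₀ δ ×ˢ Metric.ball p₀ δ ×ˢ Metric.ball r₀ δ := by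
    rw [hQdef, hb₀, ball_prod_same, ball_prod_same]
  refine ⟨(Ψ₀.symm.restrOpen Q hQo).symm, Metric.ball u₀ δ, Metric.ball p₀ δ, Metric.ball r₀ δ,
    fun p => φ₁ (Ψ₀.symm (u₀, p, r₀)), fun r => φ₂ (Ψ₀.symm (u₀, p₀, r)), ?_, ?_, ?_,
    Metric.isOpen_ball, Metric.isOpen_ball, ?_, ?_, ?_⟩
  · intro a ha
    have h1 : a ∈ Ψ₀.source ∧ Ψ₀ a ∈ Q := by simpa using ha
    have h2 := hQW _ h1.2
    rw [Ψ₀.left_inv h1.1] at h2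
    exact hball h2.2.1
  · have : y ∈ Ψ₀.source ∧ Ψ₀ y ∈ Q := ⟨hyΨ, Metric.mem_ball_self hδ⟩
    simpa using this
  · rw [← hQprod]
    have : Ψ₀.target ∩ Q = Q := Set.inter_eq_right.2 hQt
    simpa using this
  · refine sΓ.mono fun a ha => ?_
    have h1 : a ∈ Ψ₀.source ∧ Ψ₀ a ∈ Q := by simpa using ha
    have h2 := hQW _ h1.2
    rw [Ψ₀.left_inv h1.1] at h2
    exact h2.2.1
  · refine sΨ.mono fun b hb => ?_
    have : b ∈ Ψ₀.target ∧ b ∈ Q := by simpa using hb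
    exact this.2
  · intro x hx p hp r hr
    have hmem : ∀ x' ∈ Metric.ball u₀ δ, ∀ p' ∈ Metric.ball p₀ δ, ∀ r' ∈ Metric.ball r₀ δ,
        (x', p', r') ∈ Q := fun x' hx' p' hp' r' hr' => by
      rw [hQprod]; exact ⟨hx', hp', hr'⟩
    have hbQ := hmem x hx p hp r hr
    have m0 : u₀ ∈ Metric.ball u₀ δ := Metric.mem_ball_self hδ
    have mp : p₀ ∈ Metric.ball p₀ δ := Metric.mem_ball_self hδ
    have mr : r₀ ∈ Metric.ball r₀ δ := Metric.mem_ball_self hδ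
    have hcQ : Convex ℝ Q := convex_ball _ _
    have g1 := eq_of_fderiv_segment hcQ hQo dg₁ (hmem u₀ m0 p hp r₀ mr) hbQ
      (fun b hb => hv₁ b hb _ (by simp))
    have g2 := eq_of_fderiv_segment hcQ hQo dg₂ (hmem u₀ m0 p₀ mp r hr) hbQ
      (fun b hb => hv₂ b hb _ (by simp))
    simp only [Function.comp_apply] at g1 g2
    have hux : u (Ψ₀.symm (x, p, r)) = x := congrArg Prod.fst (hright _ hbQ)
    have hgoal : f (Ψ₀.symm (x, p, r)) = Real.exp x • ι₁ (φ₁ (Ψ₀.symm (u₀, p, r₀))) +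
        Real.exp (ε / α * x) • ι₂ (φ₂ (Ψ₀.symm (u₀, p₀, r))) := by
      rw [← g1, ← g2, hφ₁, hφ₂]
      simp only [hux]
      rw [map_smul, map_smul, smul_smul, smul_smul, ← Real.exp_add, ← Real.exp_add, add_neg_cancel,
        neg_mul, add_neg_cancel, Real.exp_zero, one_smul, one_smul, hι.add_eq hαε]
    simpa using hgoal

end LocalProduct

section ProductFactors

variable {E V E₁ V₁ E₂ V₂ : Type*} [NormedAddCommGroup E] [NormedSpace ℝ E]
  [FiniteDimensional ℝ E]
  [NormedAddCommGroup V] [NormedSpace ℝ V] [FiniteDimensional ℝ V]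
  [NormedAddCommGroup E₁] [NormedSpace ℝ E₁] [FiniteDimensional ℝ E₁]
  [NormedAddCommGroup V₁] [NormedSpace ℝ V₁] [FiniteDimensional ℝ V₁]
  [NormedAddCommGroup E₂] [NormedSpace ℝ E₂] [FiniteDimensional ℝ E₂]
  [NormedAddCommGroup V₂] [NormedSpace ℝ V₂] [FiniteDimensional ℝ V₂]
  {ε α : ℝ} {f : E → V} {U : Set E} {y : E} {A : V →L[ℝ] V}
  {ι₁ : V₁ →L[ℝ] V} {ρ₁ : V →L[ℝ] V₁} {ι₂ : V₂ →L[ℝ] V} {ρ₂ : V →L[ℝ] V₂}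

lemma isFactor_of_scaling (hρι₁ : ∀ x, ρ₁ (ι₁ x) = x) (hρι₂ : ∀ x, ρ₂ (ι₂ x) = x)
    (hadd : ∀ x, ι₁ (ρ₁ x) + ι₂ (ρ₂ x) = x)
    (hcomm : ∀ y ∈ U, ∀ z x, ι₁ (ρ₁ (gaussOp ε f y z x)) = gaussOp ε f y z (ι₁ (ρ₁ x)))
    (htr₁ : ∀ y ∈ U, ∀ u, fderiv ℝ f y u ≠ ι₁ (ρ₁ (f y)))
    (htr₂ : ∀ y ∈ U, ∀ u, fderiv ℝ f y u ≠ ι₂ (ρ₂ (f y)))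
    {w : E} {j₁ : E₁ →L[ℝ] E} {j₂ : E₂ →L[ℝ] E} {π₁ : E →L[ℝ] E₁} {π₂ : E →L[ℝ] E₂}
    {σ : E →L[ℝ] ℝ} (hπj : ∀ a, π₁ (j₁ a) = a) (hz : ∀ z, z = σ z • w + j₁ (π₁ z) + j₂ (π₂ z))
    {g₁ g₂ : ℝ} (hg : g₂ ≠ 0)
    (hw₁ : ∀ y ∈ U, ρ₁ (fderiv ℝ f y w) = g₁ • ρ₁ (f y))
    (hw₂ : ∀ y ∈ U, ρ₂ (fderiv ℝ f y w) = g₂ • ρ₂ (f y))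
    (hj₁ : ∀ y ∈ U, ∀ a, ρ₂ (fderiv ℝ f y (j₁ a)) = 0)
    (hj₂ : ∀ y ∈ U, ∀ b, ρ₁ (fderiv ℝ f y (j₂ b)) = 0) :
    IsFactor ε (ε * g₁ / g₂ - ε) f U ι₁ ρ₁ j₁ π₁ := by
  have ht₁ : ∀ y ∈ U, ∀ a, ι₁ (ρ₁ (fderiv ℝ f y (j₁ a))) = fderiv ℝ f y (j₁ a) := by
    intro y hy a
    have := hadd (fderiv ℝ f y (j₁ a))
    rwa [hj₁ y hy, map_zero, add_zero] at this
  refine ⟨hρι₁, hπj, hcomm, ht₁, htr₁, fun y hy z c hX => ?_⟩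
  have hX2 : ρ₂ (fderiv ℝ f y z + (-ε * c) • f y) = 0 := by
    have h1 := hadd (fderiv ℝ f y z + (-ε * c) • f y)
    rw [hX, add_eq_left] at h1
    rw [← hρι₂ (ρ₂ _), h1, map_zero]
  have e0 : fderiv ℝ f y z = σ z • fderiv ℝ f y w + fderiv ℝ f y (j₁ (π₁ z)) +
      fderiv ℝ f y (j₂ (π₂ z)) := by
    conv_lhs => rw [hz z]
    simp only [map_add, map_smul]
  have hb : ι₂ (ρ₂ (fderiv ℝ f y (j₂ (π₂ z)))) = fderiv ℝ f y (j₂ (π₂ z)) := by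
    have := hadd (fderiv ℝ f y (j₂ (π₂ z)))
    rwa [hj₂ y hy, map_zero, zero_add] at this
  rw [e0, map_add, map_add, map_add, map_smul, map_smul, hw₂ y hy, hj₁ y hy, add_zero] at hX2
  have h3 : (σ z * g₂ + -ε * c) • ι₂ (ρ₂ (f y)) + fderiv ℝ f y (j₂ (π₂ z)) = 0 := by
    rw [← hb, ← map_smul, ← map_add, ← map_zero ι₂, ← hX2]
    congr 1
    module
  have h4 : σ z * g₂ + -ε * c = 0 := by
    by_contra hne
    refine htr₂ y hy (-(σ z * g₂ + -ε * c)⁻¹ • j₂ (π₂ z)) ?_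
    rw [map_smul, eq_neg_of_add_eq_zero_right h3, neg_smul, smul_neg, neg_neg, smul_smul,
      inv_mul_cancel₀ hne, one_smul]
  have h5 : σ z = ε * c / g₂ := by rw [eq_div_iff hg]; linarith
  rw [← hX, e0]
  simp only [map_add, map_smul]
  rw [hw₁ y hy, hj₂ y hy, ht₁ y hy, h5]
  simp only [map_smul, map_zero]
  module

lemma fderiv_eq_of_scaling {F : Type*} [NormedAddCommGroup F] [NormedSpace ℝ F] {ρ : V →L[ℝ] F}
    (hf : DifferentiableAt ℝ f y) {w : E} {g : ℝ}
    (h : ∀ᶠ θ in nhds (0 : ℝ), ρ (f (y + θ • w)) = Real.exp (g * θ) • ρ (f y)) :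
    ρ (fderiv ℝ f y w) = g • ρ (f y) := by
  have h1 : HasDerivAt (fun θ : ℝ => y + θ • w) w 0 := by
    simpa using ((hasDerivAt_id (0 : ℝ)).smul_const w).const_add y
  have h2 : HasFDerivAt f (fderiv ℝ f y) (y + (0 : ℝ) • w) := by simpa using hf.hasFDerivAt
  have h3 := (ρ.hasFDerivAt.comp_hasDerivAt (0 : ℝ) (h2.comp_hasDerivAt (0 : ℝ) h1))
  have h4 : HasDerivAt (fun θ : ℝ => Real.exp (g * θ) • ρ (f y)) (g • ρ (f y)) 0 := by
    simpa using (((hasDerivAt_id (0 : ℝ)).const_mul g).exp).smul_const (ρ (f y))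
  exact h3.unique (h4.congr_of_eventuallyEq h)

lemma IsEigenSplitting.ρ₁_ι₂ (h : IsEigenSplitting ε α A ι₁ ρ₁ ι₂ ρ₂) (x : V₂) :
    ρ₁ (ι₂ x) = 0 := by
  rw [← h.ρ_ι₂ x, h.ρ₁_eq_zero]

lemma IsEigenSplitting.ρ₂_ι₁ (h : IsEigenSplitting ε α A ι₁ ρ₁ ι₂ ρ₂) (x : V₁) :
    ρ₂ (ι₁ x) = 0 := by
  rw [← h.ρ_ι₁ x, h.ρ₂_eq_zero]

theorem factors_of_product (hf : IsConvexOn ε f U) (hp : IsParallelOn ε f U)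
    (hd : Module.finrank ℝ V = Module.finrank ℝ E + 1)
    (hd₁ : Module.finrank ℝ V₁ = Module.finrank ℝ E₁ + 1)
    (hd₂ : Module.finrank ℝ V₂ = Module.finrank ℝ E₂ + 1)
    (hs : ∀ y ∈ U, IsSplitAt ε f A y) (hα : 0 < α) (hαε : ε < α)
    (hι : IsEigenSplitting ε α A ι₁ ρ₁ ι₂ ρ₂) (L : E ≃L[ℝ] ℝ × E₁ × E₂)
    {I : Set ℝ} {U₁ : Set E₁} {U₂ : Set E₂} {ψ₁ : E₁ → V₁} {ψ₂ : E₂ → V₂}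
    (hU : U = L ⁻¹' (I ×ˢ U₁ ×ˢ U₂)) (hU₁ : IsOpen U₁) (hU₂ : IsOpen U₂)
    (hprod : ∀ u ∈ I, ∀ p ∈ U₁, ∀ r ∈ U₂, f (L.symm (u, p, r)) =
      Real.exp u • ι₁ (ψ₁ p) + Real.exp (ε / α * u) • ι₂ (ψ₂ r)) (hne : U.Nonempty) :
    (IsConvexOn (-1) ψ₁ U₁ ∧ IsParallelOn (-1) ψ₁ U₁) ∧
      (IsConvexOn ε ψ₂ U₂ ∧ IsParallelOn ε ψ₂ U₂) := by
  have hnz : α - ε ≠ 0 := (sub_pos.2 hαε).ne'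
  have hε0 : ε ≠ 0 := by rcases hf.sign with h | h <;> simp [h]
  have hεε := hf.sq_sign
  have hadd := hι.add_eq hαε
  have hρ₁ : ∀ u ∈ I, ∀ p ∈ U₁, ∀ r ∈ U₂, ρ₁ (f (L.symm (u, p, r))) = Real.exp u • ψ₁ p := by
    intro u hu p hp r hr
    rw [hprod u hu p hp r hr, map_add, map_smul, map_smul, hι.ρ_ι₁, hι.ρ₁_ι₂, smul_zero, add_zero]
  have hρ₂ : ∀ u ∈ I, ∀ p ∈ U₁, ∀ r ∈ U₂,
      ρ₂ (f (L.symm (u, p, r))) = Real.exp (ε / α * u) • ψ₂ r := by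
    intro u hu p hp r hr
    rw [hprod u hu p hp r hr, map_add, map_smul, map_smul, hι.ρ_ι₂, hι.ρ₂_ι₁, smul_zero, zero_add]
  have hmem : ∀ u p r, L.symm (u, p, r) ∈ U ↔ u ∈ I ∧ p ∈ U₁ ∧ r ∈ U₂ := by
    intro u p r
    rw [hU, Set.mem_preimage, L.apply_symm_apply]
    rfl
  have hrep : ∀ y : E, ∃ u p r, y = L.symm (u, p, r) := fun y =>
    ⟨(L y).1, (L y).2.1, (L y).2.2, (L.symm_apply_apply y).symm⟩
  have hev : ∀ y ∈ U, ∀ w : E, ∀ᶠ θ in nhds (0 : ℝ), y + θ • w ∈ U := by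
    intro y hy w
    have hc : ContinuousAt (fun θ : ℝ => y + θ • w) 0 := by fun_prop
    exact hc.eventually (hf.isOpen.mem_nhds (by simpa using hy))
  have hline : ∀ u p r u' p' r', ∀ θ : ℝ, L.symm (u, p, r) + θ • L.symm (u', p', r') =
      L.symm (u + θ * u', p + θ • p', r + θ • r') := by
    intro u p r u' p' r' θ
    rw [← map_smul, ← map_add]
    rfl
  have dfy : ∀ y ∈ U, DifferentiableAt ℝ f y := fun y hy =>
    ContDiffOn.diffAt hf.smooth hf.isOpen hy
  have hw₁ : ∀ y ∈ U, ρ₁ (fderiv ℝ f y (L.symm (1, 0, 0))) = (1 : ℝ) • ρ₁ (f y) := by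
    intro y hy
    refine fderiv_eq_of_scaling (dfy y hy) ?_
    filter_upwards [hev y hy (L.symm (1, 0, 0))] with θ hθ
    obtain ⟨u, p, r, rfl⟩ := hrep y
    rw [hline] at hθ ⊢
    obtain ⟨a1, a2, a3⟩ := (hmem _ _ _).1 hθ
    obtain ⟨b1, b2, b3⟩ := (hmem _ _ _).1 hy
    rw [hρ₁ _ a1 _ a2 _ a3, hρ₁ _ b1 _ b2 _ b3, smul_smul, ← Real.exp_add, smul_zero, add_zero]
    congr 2
    ring
  have hw₂ : ∀ y ∈ U, ρ₂ (fderiv ℝ f y (L.symm (1, 0, 0))) = (ε / α) • ρ₂ (f y) := by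
    intro y hy
    refine fderiv_eq_of_scaling (dfy y hy) ?_
    filter_upwards [hev y hy (L.symm (1, 0, 0))] with θ hθ
    obtain ⟨u, p, r, rfl⟩ := hrep y
    rw [hline] at hθ ⊢
    obtain ⟨a1, a2, a3⟩ := (hmem _ _ _).1 hθ
    obtain ⟨b1, b2, b3⟩ := (hmem _ _ _).1 hy
    rw [hρ₂ _ a1 _ a2 _ a3, hρ₂ _ b1 _ b2 _ b3, smul_smul, ← Real.exp_add, smul_zero, add_zero]
    congr 2
    ring
  have hj₁ : ∀ y ∈ U, ∀ a, ρ₂ (fderiv ℝ f y (L.symm (0, a, 0))) = 0 := by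
    intro y hy a
    rw [← zero_smul ℝ (ρ₂ (f y))]
    refine fderiv_eq_of_scaling (dfy y hy) ?_
    filter_upwards [hev y hy (L.symm (0, a, 0))] with θ hθ
    obtain ⟨u, p, r, rfl⟩ := hrep y
    rw [hline] at hθ ⊢
    obtain ⟨a1, a2, a3⟩ := (hmem _ _ _).1 hθ
    obtain ⟨b1, b2, b3⟩ := (hmem _ _ _).1 hy
    rw [hρ₂ _ a1 _ a2 _ a3, hρ₂ _ b1 _ b2 _ b3]
    simp
  have hj₂ : ∀ y ∈ U, ∀ b, ρ₁ (fderiv ℝ f y (L.symm (0, 0, b))) = 0 := by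
    intro y hy b
    rw [← zero_smul ℝ (ρ₁ (f y))]
    refine fderiv_eq_of_scaling (dfy y hy) ?_
    filter_upwards [hev y hy (L.symm (0, 0, b))] with θ hθ
    obtain ⟨u, p, r, rfl⟩ := hrep y
    rw [hline] at hθ ⊢
    obtain ⟨a1, a2, a3⟩ := (hmem _ _ _).1 hθ
    obtain ⟨b1, b2, b3⟩ := (hmem _ _ _).1 hy
    rw [hρ₁ _ a1 _ a2 _ a3, hρ₁ _ b1 _ b2 _ b3]
    simp
  have htr₁ : ∀ y ∈ U, ∀ u, fderiv ℝ f y u ≠ ι₁ (ρ₁ (f y)) := by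
    intro y hy u hu
    have hinv := hf.frame_isInvertible hd hy
    rw [hι.proj₁_self hinv (hs y hy)] at hu
    have := (frame_eq_iff hinv (s := 0) (.trans (by rw [zero_smul, add_zero]) hu)).2
    exact neg_ne_zero.2 (mul_ne_zero (inv_ne_zero hnz) hε0) this.symm
  have htr₂ : ∀ y ∈ U, ∀ u, fderiv ℝ f y u ≠ ι₂ (ρ₂ (f y)) := by
    intro y hy u hu
    have hinv := hf.frame_isInvertible hd hy
    rw [hι.proj₂_self hinv (hs y hy)] at hu
    have := (frame_eq_iff hinv (s := 0) (.trans (by rw [zero_smul, add_zero]) hu)).2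
    exact mul_ne_zero (inv_ne_zero hnz) hα.ne' this.symm
  have hc₁ : ∀ y ∈ U, ∀ z x, ι₁ (ρ₁ (gaussOp ε f y z x)) = gaussOp ε f y z (ι₁ (ρ₁ x)) := by
    intro y hy z x
    rw [hι.proj₁, hι.proj₁, (hs y hy).2, map_smul, map_sub, map_smul]
  have hc₂ : ∀ y ∈ U, ∀ z x, ι₂ (ρ₂ (gaussOp ε f y z x)) = gaussOp ε f y z (ι₂ (ρ₂ x)) := by
    intro y hy z x
    rw [hι.proj₂, hι.proj₂, (hs y hy).2, map_smul, map_sub, map_smul]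
  let j₁ : E₁ →L[ℝ] E := (L.symm : ℝ × E₁ × E₂ →L[ℝ] E) ∘L
    ContinuousLinearMap.inr ℝ ℝ (E₁ × E₂) ∘L ContinuousLinearMap.inl ℝ E₁ E₂
  let j₂ : E₂ →L[ℝ] E := (L.symm : ℝ × E₁ × E₂ →L[ℝ] E) ∘L
    ContinuousLinearMap.inr ℝ ℝ (E₁ × E₂) ∘L ContinuousLinearMap.inr ℝ E₁ E₂
  let σ : E →L[ℝ] ℝ := ContinuousLinearMap.fst ℝ ℝ (E₁ × E₂) ∘L (L : E →L[ℝ] ℝ × E₁ × E₂)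
  let π₁ : E →L[ℝ] E₁ := ContinuousLinearMap.fst ℝ E₁ E₂ ∘L
    ContinuousLinearMap.snd ℝ ℝ (E₁ × E₂) ∘L (L : E →L[ℝ] ℝ × E₁ × E₂)
  let π₂ : E →L[ℝ] E₂ := ContinuousLinearMap.snd ℝ E₁ E₂ ∘L
    ContinuousLinearMap.snd ℝ ℝ (E₁ × E₂) ∘L (L : E →L[ℝ] ℝ × E₁ × E₂)
  have hz : ∀ z, z = σ z • L.symm (1, 0, 0) + j₁ (π₁ z) + j₂ (π₂ z) := by
    intro z
    apply L.injective
    simp [j₁, j₂, σ, π₁, π₂]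
  have hF₁ : IsFactor ε (ε * 1 / (ε / α) - ε) f U ι₁ ρ₁ j₁ π₁ :=
    isFactor_of_scaling hι.ρ_ι₁ hι.ρ_ι₂ hadd hc₁ htr₁ htr₂ (j₂ := j₂) (π₂ := π₂) (σ := σ)
      (fun a => by simp [j₁, π₁]) hz (div_ne_zero hε0 hα.ne') hw₁ hw₂ hj₁ hj₂
  have hF₂ : IsFactor ε (ε * (ε / α) / 1 - ε) f U ι₂ ρ₂ j₂ π₂ :=
    isFactor_of_scaling hι.ρ_ι₂ hι.ρ_ι₁ (fun x => by rw [add_comm, hadd]) hc₂ htr₂ htr₁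
      (j₂ := j₁) (π₂ := π₁) (σ := σ)
      (fun a => by simp [j₂, π₂]) (fun z => by rw [add_right_comm]; exact hz z)
      one_ne_zero hw₂ hw₁ hj₂ hj₁
  obtain ⟨y, hy⟩ := hne
  obtain ⟨u₀, p₀, r₀, rfl⟩ := hrep y
  obtain ⟨b1, b2, b3⟩ := (hmem _ _ _).1 hy
  have hs₁ : ∀ v, L.symm (u₀, 0, r₀) + j₁ v = L.symm (u₀, v, r₀) := fun v => by
    apply L.injective; simp [j₁]
  have hs₂ : ∀ v, L.symm (u₀, p₀, 0) + j₂ v = L.symm (u₀, p₀, v) := fun v => by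
    apply L.injective; simp [j₂]
  have hm₁ : ∀ v ∈ U₁, L.symm (u₀, 0, r₀) + j₁ v ∈ U := fun v hv => by
    rw [hs₁, hmem]; exact ⟨b1, hv, b3⟩
  have hm₂ : ∀ v ∈ U₂, L.symm (u₀, p₀, 0) + j₂ v ∈ U := fun v hv => by
    rw [hs₂, hmem]; exact ⟨b1, b2, hv⟩
  have hψ₁ : ∀ v ∈ U₁, ψ₁ v = Real.exp (-u₀) • ρ₁ (f (L.symm (u₀, 0, r₀) + j₁ v)) := by
    intro v hv
    rw [hs₁, hρ₁ _ b1 _ hv _ b3, smul_smul, ← Real.exp_add, neg_add_cancel, Real.exp_zero, one_smul]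
  have hψ₂ : ∀ v ∈ U₂, ψ₂ v =
      Real.exp (-(ε / α * u₀)) • ρ₂ (f (L.symm (u₀, p₀, 0) + j₂ v)) := by
    intro v hv
    rw [hs₂, hρ₂ _ b1 _ b2 _ hv, smul_smul, ← Real.exp_add, neg_add_cancel, Real.exp_zero, one_smul]
  have hκ₁ : 0 < -(-1) * (ε * 1 / (ε / α) - ε) := by
    rw [show -(-1) * (ε * 1 / (ε / α) - ε) = α - ε by field_simp]
    exact sub_pos.2 hαε
  have hκ₂ : 0 < -ε * (ε * (ε / α) / 1 - ε) := by
    rw [show -ε * (ε * (ε / α) / 1 - ε) = (ε * ε) * ((α - ε) / α) by field_simp; ring, hεε, one_mul]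
    exact div_pos (sub_pos.2 hαε) hα
  exact ⟨⟨slice_isConvexOn hf hd hF₁ hU₁ hm₁ hψ₁ hd₁ (Real.exp_pos _).ne' (Or.inr rfl) hκ₁,
      slice_isParallelOn hf hp hd hF₁ hU₁ hm₁ hψ₁ hd₁ (Real.exp_pos _).ne' (Or.inr rfl) hκ₁⟩,
    slice_isConvexOn hf hd hF₂ hU₂ hm₂ hψ₂ hd₂ (Real.exp_pos _).ne' hf.sign hκ₂,
    slice_isParallelOn hf hp hd hF₂ hU₂ hm₂ hψ₂ hd₂ (Real.exp_pos _).ne' hf.sign hκ₂⟩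

end ProductFactors

section CaseC

variable {E : Type*} [NormedAddCommGroup E] [NormedSpace ℝ E] [FiniteDimensional ℝ E]
  {ε : ℝ} {h : E →L[ℝ] E →L[ℝ] ℝ} {K : E →L[ℝ] E →L[ℝ] E} {n : ℕ} {e : Fin n → E} {m : ℕ}

lemma eq_sum_of_orthonormal (ho : ∀ i j, h (e i) (e j) = if i = j then 1 else 0)
    (hn : Module.finrank ℝ E = n) (z : E) : z = ∑ i, h (e i) z • e i := by
  have hli : LinearIndependent ℝ e := by
    rw [Fintype.linearIndependent_iff]
    intro g hg i
    have := congrArg (h (e i)) hg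
    simpa [ho] using this
  have hspan := hli.span_eq_top_of_card_eq_finrank' (by simpa using hn.symm)
  obtain ⟨c, rfl⟩ := (Submodule.mem_span_range_iff_exists_fun ℝ).1
    (hspan ▸ Submodule.mem_top : z ∈ Submodule.span ℝ (Set.range e))
  refine Finset.sum_congr rfl fun i _ => ?_
  simp [ho]

lemma inner_eq_zero_of_mem_D2 {v z : E} (hv : v ∈ D2 m e) (hz : ∀ i : Fin n, 1 ≤ (i : ℕ) → (i : ℕ) < m → h (e i) z = 0) :
    h v z = 0 := by
  induction hv using Submodule.span_induction with
  | mem x hx => obtain ⟨i, hi, rfl⟩ := hx; exact hz i hi.1 hi.2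
  | zero => simp
  | add x y _ _ hx hy => rw [map_add, add_apply, hx, hy, add_zero]
  | smul a x _ hx => rw [map_smul, smul_apply, hx, smul_zero]

lemma exists_orthogonal_projection_D2 (ho : ∀ i j, h (e i) (e j) = if i = j then 1 else 0)
    (z : E) : ∃ d ∈ D2 m e, ∀ v ∈ D2 m e, h v (z - d) = 0 := by
  refine ⟨∑ i ∈ Finset.univ.filter fun i : Fin n => 1 ≤ (i : ℕ) ∧ (i : ℕ) < m, h (e i) z • e i,
    Submodule.sum_mem _ fun i hi => Submodule.smul_mem _ _
      (Submodule.subset_span ⟨i, (Finset.mem_filter.1 hi).2, rfl⟩), fun v hv => ?_⟩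
  refine inner_eq_zero_of_mem_D2 hv fun i h1 h2 => ?_
  simp [ho, h1, h2]

variable [NeZero n] {lam : Fin n → ℝ}

lemma IsCaseC.apply_D2 (hc : IsCaseC ε h K m e lam) {v : E} (hv : v ∈ D2 m e) :
    K (e 0) v = (lam 0 / 2) • v := by
  induction hv using Submodule.span_induction with
  | mem x hx =>
    obtain ⟨i, hi, rfl⟩ := hx
    rw [hc.typical.eigen, hc.eig_D2 i hi.1 hi.2]
  | zero => simp
  | add x y _ _ hx hy => rw [map_add, hx, hy, smul_add]
  | smul a x _ hx => rw [map_smul, hx, smul_comm]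

lemma mem_D2 {i : Fin n} (h1 : 1 ≤ (i : ℕ)) (h2 : (i : ℕ) < m) : e i ∈ D2 m e :=
  Submodule.subset_span ⟨i, ⟨h1, h2⟩, rfl⟩

lemma IsCaseC.apply_of_orthogonal (hc : IsCaseC ε h K m e lam) (hn : Module.finrank ℝ E = n)
    {y : E} (h0 : h (e 0) y = 0) (hD : ∀ v ∈ D2 m e, h v y = 0) :
    K (e 0) y = ((lam 0 - √(lam 0 ^ 2 - 4 * ε)) / 2) • y := by
  conv_lhs => rw [eq_sum_of_orthonormal hc.typical.orthonormal hn y]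
  conv_rhs => rw [eq_sum_of_orthonormal hc.typical.orthonormal hn y]
  rw [map_sum, Finset.smul_sum]
  refine Finset.sum_congr rfl fun i _ => ?_
  rw [map_smul, hc.typical.eigen]
  by_cases h1 : 1 ≤ (i : ℕ)
  · by_cases h2 : (i : ℕ) < m
    · rw [hD _ (mem_D2 h1 h2), zero_smul, zero_smul, smul_zero]
    · rw [hc.eig_D3 i (not_lt.1 h2), smul_comm]
  · have : i = 0 := Fin.ext (by rw [Fin.val_zero]; omega)
    rw [this, h0, zero_smul, zero_smul, smul_zero]

lemma IsCubicModel.eq_zero_of_cubic_nonpos (hM : IsCubicModel ε h K)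
    (hK : ∀ u, h u u = 1 → h (K u u) u ≤ 0) (a b : E) : K a b = 0 := by
  have h1 : ∀ u, h (K u u) u ≤ 0 := by
    intro u
    by_cases hu : u = 0
    · simp [hu]
    · have hp := hM.pos u hu
      set s := √(h u u) with hs
      have hs0 : 0 < s := Real.sqrt_pos.2 hp
      have hss : h u u = s * s := (Real.mul_self_sqrt hp.le).symm
      have h2 := hK (s⁻¹ • u) (by
        simp only [map_smul, smul_apply, smul_eq_mul, hss]
        field_simp)
      simp only [map_smul, smul_apply, smul_eq_mul] at h2
      have h3 : h (K u u) u = s ^ 3 * (s⁻¹ * (s⁻¹ * (s⁻¹ * h (K u u) u))) := by field_simp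
      rw [h3]
      exact mul_nonpos_of_nonneg_of_nonpos (by positivity) h2
  have h2 : ∀ u, h (K u u) u = 0 := by
    intro u
    refine le_antisymm (h1 u) ?_
    have := h1 (-u)
    simp only [map_neg, neg_apply, neg_neg] at this
    linarith
  have h3 : ∀ u v, h (K v v) u = 0 := by
    intro u v
    have e1 := h2 (u + v)
    have e2 := h2 (u - v)
    have e3 := h2 u
    have e4 := h2 v
    have a1 : h (K u v) v = h (K v v) u := by rw [hM.symmK u v, hM.adj v u v, hM.symm]
    have a2 : h (K u u) v = h (K u v) u := by rw [hM.adj u u v, hM.symm]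
    simp only [map_add, map_sub, add_apply, sub_apply, hM.symmK v u] at e1 e2
    linarith
  have h4 : ∀ v, K v v = 0 := fun v => by
    by_contra hne
    exact (hM.pos _ hne).ne' (h3 _ v)
  have h5 := h4 (a + b)
  simp only [map_add, add_apply, h4, hM.symmK b a, zero_add, add_zero] at h5
  rwa [← two_smul ℝ, smul_eq_zero_iff_right two_ne_zero] at h5

lemma IsCaseC.lam_pos (hc : IsCaseC ε h K m e lam) (hM : IsCubicModel ε h K)
    (hne : ∃ a b, K a b ≠ 0) : 0 < lam 0 := by
  have h0 : h (K (e 0) (e 0)) (e 0) = lam 0 := by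
    rw [hc.typical.eigen, map_smul, smul_apply, hc.typical.orthonormal, if_pos rfl, smul_eq_mul,
      mul_one]
  have h1 := hc.typical.isMax
  rw [h0] at h1
  have h2 := h1 (-e 0) (by
    simp only [map_neg, neg_apply, neg_neg, hc.typical.orthonormal, if_pos])
  simp only [map_neg, neg_apply, neg_neg, h0] at h2
  refine lt_of_le_of_ne (by linarith) fun hl => ?_
  obtain ⟨a, b, hab⟩ := hne
  exact hab (hM.eq_zero_of_cubic_nonpos (fun u hu => hl ▸ h1 u hu) a b)

lemma IsCubicModel.apply_eq_zero_of_sup_nullV (hM : IsCubicModel ε h K) {D : Submodule ℝ E}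
    {l : ℝ} {e₁ v : E} (hv : h v v = 1) (hsum : Submodule.span ℝ {v} ⊔ nullV h K l e₁ D v = D)
    {u : E} (hu : u ∈ D) (hvu : h v u = 0) : K v u = 0 := by
  rw [← hsum] at hu
  obtain ⟨x, hx, b, hb, rfl⟩ := Submodule.mem_sup.1 hu
  obtain ⟨a, rfl⟩ := Submodule.mem_span_singleton.1 hx
  obtain ⟨⟨-, hb1⟩, hb2⟩ := hb
  have hb1 : h v b = 0 := hb1
  have hb2 : K v (K v b - (l / 2) • h v b • e₁) = 0 := hb2
  rw [hb1, zero_smul, smul_zero, sub_zero] at hb2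
  rw [map_add, hb1, add_zero, map_smul, hv, smul_eq_mul, mul_one] at hvu
  rw [hvu, zero_smul, zero_add]
  by_contra hne
  refine (hM.pos _ hne).ne' ?_
  rw [hM.adj, hb2, map_zero]

theorem IsCaseC.exists_splitting (hc : IsCaseC ε h K m e lam) (hM : IsCubicModel ε h K)
    (hn : Module.finrank ℝ E = n) (hne : ∃ a b, K a b ≠ 0) {v : Fin 1 → E}
    (hdec : IsD2Decomposition h K (lam 0) (e 0) (D2 m e) v) :
    ∃ (t : E) (α : ℝ), h t t = α ∧ 0 < α ∧ ε < α ∧ h t (v 0) = 0 ∧ K t (v 0) = α • v 0 ∧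
      K t t = (α + ε) • t ∧
      (∀ z u, K t (K z u) - K z (K t u) = ε • (h z u • t - h t u • z)) ∧
      ∀ z, K t (K t z) = (α + ε) • K t z - (α * ε) • z + (ε * h t z) • t := by
  have ho := hc.typical.orthonormal
  have hsum := hdec.sum
  rw [ciSup_unique] at hsum
  refine hM.exists_splitting (D := D2 m e) (e₁ := e 0) (l := lam 0) (η := √(lam 0 ^ 2 - 4 * ε))
    (by simp [ho]) (hc.typical.eigen 0) (fun v hv => hc.apply_D2 hv) (fun v hv => ?_)
    (fun y h0 hD => hc.apply_of_orthogonal hn h0 hD) (exists_orthogonal_projection_D2 ho)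
    (hc.lam_pos hM hne) (Real.sqrt_pos.2 hc.discr_pos) (Real.sq_sqrt hc.discr_pos.le)
    (hdec.mem 0) (hdec.unit 0)
    (fun u hu hvu => hM.apply_eq_zero_of_sup_nullV (hdec.unit 0) hsum hu hvu)
  rw [hM.symm]
  refine inner_eq_zero_of_mem_D2 hv fun i h1 h2 => ?_
  rw [ho, if_neg]
  rintro rfl
  simp at h1

end CaseC

section SplitPoint

variable {E V : Type*} [NormedAddCommGroup E] [NormedSpace ℝ E] [FiniteDimensional ℝ E]
  [NormedAddCommGroup V] [NormedSpace ℝ V] [FiniteDimensional ℝ V]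
  {ε α : ℝ} {f : E → V} {U : Set E} {y t : E}

lemma IsConvexOn.isSplitAt_gaussOp (hf : IsConvexOn ε f U)
    (hd : Module.finrank ℝ V = Module.finrank ℝ E + 1) (hy : y ∈ U)
    (hcomm : ∀ z u, diffTensor ε f y t (diffTensor ε f y z u) -
      diffTensor ε f y z (diffTensor ε f y t u) =
        ε • (metric ε f y z u • t - metric ε f y t u • z)) :
    IsSplitAt ε f (gaussOp ε f y t) y := by
  have hinv := hf.frame_isInvertible hd hy
  refine ⟨⟨t, rfl⟩, fun z x => ?_⟩
  obtain ⟨u, s, rfl⟩ : ∃ (u : E) (s : ℝ), x = fderiv ℝ f y u + s • f y :=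
    ⟨_, _, exists_frame_coord hinv x⟩
  have h1 : metric ε f y t (diffTensor ε f y z u) = metric ε f y z (diffTensor ε f y t u) := by
    rw [← hf.diffTensor_adjoint hd hy, ← hf.diffTensor_adjoint hd hy, hf.diffTensor_symm hd hy z t]
  have h2 := sub_eq_iff_eq_add.1 (hcomm z u)
  simp only [map_add, map_smul, gaussOp_fderiv hinv, gaussOp_self hinv, h1, h2, map_sub,
    hf.diffTensor_symm hd hy z t, hf.metric_symm hy z t]
  module

lemma IsConvexOn.gaussOp_quad (hf : IsConvexOn ε f U)
    (hd : Module.finrank ℝ V = Module.finrank ℝ E + 1) (hy : y ∈ U)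
    (ht : metric ε f y t t = α) (hK : diffTensor ε f y t t = (α + ε) • t)
    (hKK : ∀ z, diffTensor ε f y t (diffTensor ε f y t z) = (α + ε) • diffTensor ε f y t z -
      (α * ε) • z + (ε * metric ε f y t z) • t) (x : V) :
    gaussOp ε f y t (gaussOp ε f y t x) = (α + ε) • gaussOp ε f y t x - (α * ε) • x := by
  have hinv := hf.frame_isInvertible hd hy
  obtain ⟨u, s, rfl⟩ : ∃ (u : E) (s : ℝ), x = fderiv ℝ f y u + s • f y :=
    ⟨_, _, exists_frame_coord hinv x⟩
  have h1 : metric ε f y t (diffTensor ε f y t u) = (α + ε) * metric ε f y t u := by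
    rw [← hf.diffTensor_adjoint hd hy, hK, map_smul, smul_apply, smul_eq_mul]
  simp only [map_add, map_smul, gaussOp_fderiv hinv, gaussOp_self hinv, h1, hKK, hK, ht, map_sub]
  module

lemma IsConvexOn.exists_isSplitAt_of_caseC (hf : IsConvexOn ε f U) (hp : IsParallelOn ε f U)
    (hd : Module.finrank ℝ V = Module.finrank ℝ E + 1) (hy : y ∈ U)
    (hC : ∃ u v w, cubicForm ε f y u v w ≠ 0) {n m : ℕ} [NeZero n] {e : Fin n → E} {lam : Fin n → ℝ}
    (hn : Module.finrank ℝ E = n)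
    (hc : IsCaseC ε (metric ε f y) (diffTensor ε f y) m e lam) {v : Fin 1 → E}
    (hdec : IsD2Decomposition (metric ε f y) (diffTensor ε f y) (lam 0) (e 0) (D2 m e) v) :
    ∃ (A : V →L[ℝ] V) (α : ℝ), IsSplitAt ε f A y ∧ 0 < α ∧ ε < α ∧
      (∀ x, A (A x) = (α + ε) • A x - (α * ε) • x) ∧
      ∃ u ≠ 0, A (fderiv ℝ f y u) = α • fderiv ℝ f y u := by
  obtain ⟨a, b, c, hC⟩ := hC
  rw [hf.cubicForm_eq_neg_two hd hy] at hC
  obtain ⟨t, α, h1, h2, h3, h4, h5, h6, h7, h8⟩ := hc.exists_splitting (hf.isCubicModel hp hd hy) hn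
    ⟨a, b, fun h0 => hC (by rw [h0, map_zero, zero_apply, mul_zero])⟩ hdec
  refine ⟨gaussOp ε f y t, α, hf.isSplitAt_gaussOp hd hy h7, h2, h3, hf.gaussOp_quad hd hy h1 h6 h8,
    v 0, fun h0 => ?_, ?_⟩
  · have := hdec.unit 0
    rw [h0, map_zero] at this
    exact zero_ne_one this
  · rw [gaussOp_fderiv (hf.frame_isInvertible hd hy), h5, h4, mul_zero, zero_smul, add_zero,
      map_smul]

end SplitPoint

section EigenSplitting

variable {V : Type*} [NormedAddCommGroup V] [NormedSpace ℝ V] [FiniteDimensional ℝ V]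
  {ε α : ℝ} {A : V →L[ℝ] V}

lemma exists_isEigenSplitting (hA : ∀ x, A (A x) = (α + ε) • A x - (α * ε) • x) (hαε : ε < α) :
    ∃ (k₁ k₂ : ℕ) (ι₁ : Eu k₁ →L[ℝ] V) (ρ₁ : V →L[ℝ] Eu k₁) (ι₂ : Eu k₂ →L[ℝ] V)
      (ρ₂ : V →L[ℝ] Eu k₂), IsEigenSplitting ε α A ι₁ ρ₁ ι₂ ρ₂ := by
  have hne : α - ε ≠ 0 := (sub_pos.2 hαε).ne'
  have key : ∀ P : V →L[ℝ] V, (∀ x, P (P x) = P x) →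
      ∃ (k : ℕ) (ι : Eu k →L[ℝ] V) (ρ : V →L[ℝ] Eu k), (∀ x, ρ (ι x) = x) ∧
        ∀ x, ι (ρ x) = P x := by
    intro P hP
    let e : LinearMap.range P.toLinearMap ≃ₗ[ℝ]
        Eu (Module.finrank ℝ (LinearMap.range P.toLinearMap)) :=
      LinearEquiv.ofFinrankEq _ _ (by simp)
    refine ⟨_, LinearMap.toContinuousLinearMap
      ((LinearMap.range P.toLinearMap).subtype ∘ₗ e.symm.toLinearMap),
      LinearMap.toContinuousLinearMap (e.toLinearMap ∘ₗ P.toLinearMap.rangeRestrict),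
      fun x => ?_, fun x => ?_⟩
    · have : P.toLinearMap.rangeRestrict (e.symm x : V) = e.symm x := by
        obtain ⟨w, hw⟩ := (e.symm x).2
        refine Subtype.ext ?_
        rw [← hw]
        exact hP w
      simpa using (congrArg e this).trans (e.apply_symm_apply x)
    · simp
  obtain ⟨k₁, ι₁, ρ₁, a1, b1⟩ := key ((α - ε)⁻¹ • (A - ε • ContinuousLinearMap.id ℝ V)) (by
    intro x
    simp only [smul_apply, sub_apply, ContinuousLinearMap.id_apply, map_smul, map_sub, hA]
    match_scalars <;> field_simp <;> ring)
  obtain ⟨k₂, ι₂, ρ₂, a2, b2⟩ := key ((α - ε)⁻¹ • (α • ContinuousLinearMap.id ℝ V - A)) (by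
    intro x
    simp only [smul_apply, sub_apply, ContinuousLinearMap.id_apply, map_smul, map_sub, hA]
    match_scalars <;> field_simp 
    ring)
  exact ⟨k₁, k₂, ι₁, ρ₁, ι₂, ρ₂, hA, a1, a2, b1, b2⟩

variable {V₁ V₂ : Type*} [NormedAddCommGroup V₁] [NormedSpace ℝ V₁] [FiniteDimensional ℝ V₁]
  [NormedAddCommGroup V₂] [NormedSpace ℝ V₂] [FiniteDimensional ℝ V₂]
  {ι₁ : V₁ →L[ℝ] V} {ρ₁ : V →L[ℝ] V₁} {ι₂ : V₂ →L[ℝ] V} {ρ₂ : V →L[ℝ] V₂}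

/-- The isomorphism of the product of the two eigenspaces with the ambient space. -/
def IsEigenSplitting.equiv (h : IsEigenSplitting ε α A ι₁ ρ₁ ι₂ ρ₂) (hαε : ε < α) :
    (V₁ × V₂) ≃L[ℝ] V :=
  ContinuousLinearEquiv.equivOfInverse (ι₁.coprod ι₂) (ρ₁.prod ρ₂)
    (fun x => by ext <;> simp [h.ρ_ι₁, h.ρ_ι₂, h.ρ₁_ι₂, h.ρ₂_ι₁]) (fun x => by simp [h.add_eq hαε])

variable {E : Type*} [NormedAddCommGroup E] [NormedSpace ℝ E] [FiniteDimensional ℝ E]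
  {f : E → V} {U : Set E} {y : E}

lemma IsEigenSplitting.two_le_finrank (h : IsEigenSplitting ε α A ι₁ ρ₁ ι₂ ρ₂) (hαε : ε < α)
    (hf : IsConvexOn ε f U) (hd : Module.finrank ℝ V = Module.finrank ℝ E + 1) (hy : y ∈ U)
    (hs : IsSplitAt ε f A y) {u : E} (hu : u ≠ 0) (hAu : A (fderiv ℝ f y u) = α • fderiv ℝ f y u) :
    2 ≤ Module.finrank ℝ V₁ := by
  have hne : α - ε ≠ 0 := (sub_pos.2 hαε).ne'
  have hε0 : ε ≠ 0 := by rcases hf.sign with h | h <;> simp [h]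
  have hinv := hf.frame_isInvertible hd hy
  have h1 : ι₁ (ρ₁ (fderiv ℝ f y u)) = fderiv ℝ f y u := by
    rw [h.proj₁, hAu, ← sub_smul, smul_smul, inv_mul_cancel₀ hne, one_smul]
  have hli : LinearIndependent ℝ ![ρ₁ (f y), ρ₁ (fderiv ℝ f y u)] := by
    rw [LinearIndependent.pair_iff]
    intro a b hab
    have h2 := congrArg ι₁ hab
    rw [map_add, map_smul, map_smul, map_zero, h1, h.proj₁_self hinv hs] at h2
    obtain ⟨h3, h4⟩ := frame_eq_iff hinv (b := 0) (r := 0)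
      (a := a • (α - ε)⁻¹ • splitVec f A y + b • u) (s := a * -((α - ε)⁻¹ * ε)) (by
        rw [map_zero, zero_smul, add_zero, ← h2]
        simp only [map_add, map_smul]
        module)
    have ha : a = 0 := (mul_eq_zero.1 h4).resolve_right
      (neg_ne_zero.2 (mul_ne_zero (inv_ne_zero hne) hε0))
    rw [ha, zero_smul, zero_add] at h3
    exact ⟨ha, (smul_eq_zero.1 h3).resolve_right hu⟩
  simpa using hli.fintype_card_le_finrank

lemma IsEigenSplitting.one_le_finrank (h : IsEigenSplitting ε α A ι₁ ρ₁ ι₂ ρ₂) (hα : 0 < α)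
    (hαε : ε < α) (hf : IsConvexOn ε f U) (hd : Module.finrank ℝ V = Module.finrank ℝ E + 1)
    (hy : y ∈ U) (hs : IsSplitAt ε f A y) : 1 ≤ Module.finrank ℝ V₂ := by
  have hne : α - ε ≠ 0 := (sub_pos.2 hαε).ne'
  have hinv := hf.frame_isInvertible hd hy
  refine Module.finrank_pos_iff_exists_ne_zero.2 ⟨ρ₂ (f y), fun h0 => ?_⟩
  have h1 := h.proj₂_self hinv hs
  rw [h0, map_zero] at h1
  have := (frame_eq_iff hinv (a := 0) (s := 0) (.trans (by simp) h1)).2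
  exact mul_ne_zero (inv_ne_zero hne) hα.ne' this.symm

end EigenSplitting

lemma IsConvexOn.mono {E V : Type*} [NormedAddCommGroup E] [NormedSpace ℝ E]
    [NormedAddCommGroup V] [NormedSpace ℝ V] {ε : ℝ} {f : E → V} {U U' : Set E}
    (hf : IsConvexOn ε f U) (hU' : IsOpen U') (h : U' ⊆ U) : IsConvexOn ε f U' :=
  ⟨hf.sign, hU', hf.smooth.mono h, fun y hy => hf.immersion y (h hy),
    fun y hy => hf.transversal y (h hy), fun y hy => hf.metric_pos y (h hy)⟩

lemma finrank_eu_succ (n : ℕ) :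
    Module.finrank ℝ (Eu (n + 1)) = Module.finrank ℝ (Eu n) + 1 := by
  simp

section Manifold

variable {n : ℕ} {M : Type*} [TopologicalSpace M] [ChartedSpace (Eu n) M]
  [IsManifold (𝓡 n) ∞ M] {ε : ℝ} {x : M → Eu (n + 1)} {A : Eu (n + 1) →L[ℝ] Eu (n + 1)}

lemma isSplitAt_chart_change (hx : IsConvexHypersurface ε x) {φ φ' : OpenPartialHomeomorph M (Eu n)}
    (hφ : φ ∈ IsManifold.maximalAtlas (𝓡 n) ∞ M) (hφ' : φ' ∈ IsManifold.maximalAtlas (𝓡 n) ∞ M)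
    {q : M} (hq : q ∈ φ.source) (hq' : q ∈ φ'.source) (h : IsSplitAt ε (x ∘ φ.symm) A (φ q)) :
    IsSplitAt ε (x ∘ φ'.symm) A (φ' q) := by
  have hsub : (φ'.symm.trans φ).source ⊆ φ'.target := fun y hy => by
    simpa using (by simpa using hy : y ∈ φ'.target ∧ φ'.symm y ∈ φ.source).1
  have hsrc : ∀ y ∈ (φ'.symm.trans φ).source, φ'.symm y ∈ φ.source := fun y hy => by
    simpa using (by simpa using hy : y ∈ φ'.target ∧ φ'.symm y ∈ φ.source).2
  have hτ : ContDiffOn ℝ ∞ (φ ∘ φ'.symm) (φ'.symm.trans φ).source := by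
    rw [← contMDiffOn_iff_contDiffOn]
    exact (contMDiffOn_of_mem_maximalAtlas hφ).comp
      ((contMDiffOn_symm_of_mem_maximalAtlas hφ').mono hsub) hsrc
  refine isSplitAt_reparam (hx φ hφ) ((hx φ' hφ').mono (φ'.symm.trans φ).open_source hsub)
    (finrank_eu_succ n) hτ (fun y hy => φ.map_source (hsrc y hy)) (fun y hy => ?_) ?_ ?_
  · simp [φ.left_inv (hsrc y hy)]
  · simp [hq, hq']
  · simpa [φ'.left_inv hq'] using h

lemma isSplitAt_of_connected [ConnectedSpace M] (hx : IsConvexHypersurface ε x)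
    (hpar : HasParallelCubicForm ε x) {p : M}
    (h : IsSplitAt ε (x ∘ (chartAt (Eu n) p).symm) A (chartAt (Eu n) p p))
    {φ : OpenPartialHomeomorph M (Eu n)} (hφ : φ ∈ IsManifold.maximalAtlas (𝓡 n) ∞ M) :
    ∀ y ∈ φ.target, IsSplitAt ε (x ∘ φ.symm) A y := by
  have hchart : ∀ q : M, chartAt (Eu n) q ∈ IsManifold.maximalAtlas (𝓡 n) ∞ M := fun q =>
    IsManifold.chart_mem_maximalAtlas q
  have hloc : IsLocallyConstant fun q : M =>
      IsSplitAt ε (x ∘ (chartAt (Eu n) q).symm) A (chartAt (Eu n) q q) := by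
    rw [IsLocallyConstant.iff_eventually_eq]
    intro q
    set φ := chartAt (Eu n) q
    have hq := mem_chart_source (Eu n) q
    obtain ⟨R, hR, hball⟩ := Metric.isOpen_iff.1 φ.open_target (φ q) (φ.map_source hq)
    have hev : ∀ᶠ q' in nhds q, q' ∈ φ.source ∧ φ q' ∈ Metric.ball (φ q) R :=
      Filter.Eventually.and (φ.open_source.mem_nhds hq)
        ((φ.continuousAt hq).eventually (Metric.ball_mem_nhds _ hR))
    filter_upwards [hev] with q' hq'
    have hB := (hx φ (hchart q)).mono Metric.isOpen_ball hball
    have hBp : IsParallelOn ε (x ∘ φ.symm) (Metric.ball (φ q) R) := fun y hy =>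
      hpar φ (hchart q) y (hball hy)
    have hc : φ q ∈ Metric.ball (φ q) R := Metric.mem_ball_self hR
    refine propext ⟨fun h' => ?_, fun h' => ?_⟩
    · exact hB.isSplitAt_of_segment hBp (finrank_eu_succ n) (convex_ball _ _) hq'.2 hc
        (isSplitAt_chart_change hx (hchart q') (hchart q) (mem_chart_source (Eu n) q') hq'.1 h')
    · exact isSplitAt_chart_change hx (hchart q) (hchart q') hq'.1 (mem_chart_source (Eu n) q')
        (hB.isSplitAt_of_segment hBp (finrank_eu_succ n) (convex_ball _ _) hc hq'.2 h')
  intro y hy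
  have h1 := (hloc.apply_eq_of_preconnectedSpace p (φ.symm y)).mp h
  have h2 := isSplitAt_chart_change hx (hchart (φ.symm y)) hφ
    (mem_chart_source (Eu n) (φ.symm y)) (φ.map_target hy) h1
  rwa [φ.right_inv hy] at h2

variable {α : ℝ} {n₁ n₂ : ℕ} {ι₁ : Eu (n₁ + 1) →L[ℝ] Eu (n + 1)} {ρ₁ : Eu (n + 1) →L[ℝ] Eu (n₁ + 1)}
  {ι₂ : Eu (n₂ + 1) →L[ℝ] Eu (n + 1)} {ρ₂ : Eu (n + 1) →L[ℝ] Eu (n₂ + 1)}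

theorem exists_calabi_chart (hx : IsConvexHypersurface ε x) (hpar : HasParallelCubicForm ε x)
    (hs : ∀ φ ∈ IsManifold.maximalAtlas (𝓡 n) ∞ M, ∀ y ∈ φ.target, IsSplitAt ε (x ∘ φ.symm) A y)
    (hα : 0 < α) (hαε : ε < α) (hι : IsEigenSplitting ε α A ι₁ ρ₁ ι₂ ρ₂) (hn : n₁ + n₂ + 1 = n)
    (q : M) :
    ∃ (I : Set ℝ) (U₁ : Set (Eu n₁)) (U₂ : Set (Eu n₂))
      (ψ₁ : Eu n₁ → Eu (n₁ + 1)) (ψ₂ : Eu n₂ → Eu (n₂ + 1))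
      (Φ : OpenPartialHomeomorph (ℝ × Eu n₁ × Eu n₂) M),
      (IsConvexOn (-1) ψ₁ U₁ ∧ IsParallelOn (-1) ψ₁ U₁) ∧
      (IsConvexOn ε ψ₂ U₂ ∧ IsParallelOn ε ψ₂ U₂) ∧
      Φ.source = I ×ˢ U₁ ×ˢ U₂ ∧ q ∈ Φ.target ∧
      ContMDiffOn 𝓘(ℝ, ℝ × Eu n₁ × Eu n₂) (𝓡 n) ∞ Φ Φ.source ∧
      ContMDiffOn (𝓡 n) 𝓘(ℝ, ℝ × Eu n₁ × Eu n₂) ∞ Φ.symm Φ.target ∧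
      ∀ u ∈ I, ∀ p ∈ U₁, ∀ r ∈ U₂,
        x (Φ (u, p, r)) = Real.exp u • ι₁ (ψ₁ p) + Real.exp (ε / α * u) • ι₂ (ψ₂ r) := by
  set φ := chartAt (Eu n) q with hφdef
  have hφ : φ ∈ IsManifold.maximalAtlas (𝓡 n) ∞ M := IsManifold.chart_mem_maximalAtlas q
  have hq : q ∈ φ.source := mem_chart_source (Eu n) q
  obtain ⟨Ψ, I, U₁, U₂, ψ₁, ψ₂, hsub, hqΨ, htar, hU₁, hU₂, sΨ, sΨ', hprod⟩ :=
    exists_local_product (hx φ hφ) (finrank_eu_succ n) (hs φ hφ) hα hαε hι (finrank_eu_succ n₁)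
      (finrank_eu_succ n₂) (by simp [← hn]) (φ.map_source hq)
  have hsub' : Set.MapsTo Ψ.symm Ψ.target φ.target := fun b hb => hsub (Ψ.map_target hb)
  -- the product chart
  set Φ : OpenPartialHomeomorph (ℝ × Eu n₁ × Eu n₂) M := Ψ.symm.trans φ.symm with hΦ
  have hΦs : Φ.source = Ψ.target := by
    rw [hΦ, OpenPartialHomeomorph.trans_source]
    exact Set.inter_eq_left.2 hsub'
  have hΦt : ∀ q' ∈ Φ.target, q' ∈ φ.source ∧ φ q' ∈ Ψ.source := fun q' hq' => by
    simpa [hΦ, OpenPartialHomeomorph.trans_target] using hq'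
  have cΦ : ContMDiffOn 𝓘(ℝ, ℝ × Eu n₁ × Eu n₂) (𝓡 n) ∞ Φ Φ.source := by
    rw [hΦs]
    exact (contMDiffOn_symm_of_mem_maximalAtlas hφ).comp sΨ'.contMDiffOn hsub'
  have cΦ' : ContMDiffOn (𝓡 n) 𝓘(ℝ, ℝ × Eu n₁ × Eu n₂) ∞ Φ.symm Φ.target :=
    sΨ.contMDiffOn.comp ((contMDiffOn_of_mem_maximalAtlas hφ).mono fun q' hq' => (hΦt q' hq').1)
      fun q' hq' => (hΦt q' hq').2
  have hqΦ : q ∈ Φ.target := by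
    simpa [hΦ, OpenPartialHomeomorph.trans_target] using ⟨hq, hqΨ⟩
  let L : Eu n ≃L[ℝ] ℝ × Eu n₁ × Eu n₂ :=
    ContinuousLinearEquiv.ofFinrankEq (by simp [← hn]; ring)
  set φ' : OpenPartialHomeomorph M (Eu n) :=
    (L.toHomeomorph.toOpenPartialHomeomorph.trans Φ).symm with hφ'
  have ht' : φ'.target = L ⁻¹' (I ×ˢ U₁ ×ˢ U₂) := by
    rw [hφ', OpenPartialHomeomorph.symm_target, OpenPartialHomeomorph.trans_source, hΦs, htar]
    simp
  have hs' : φ'.source = Φ.target := by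
    rw [hφ', OpenPartialHomeomorph.symm_source, OpenPartialHomeomorph.trans_target]
    simp
  have hmem : φ' ∈ IsManifold.maximalAtlas (𝓡 n) ∞ M := by
    refine φ'.mem_maximalAtlas_of_contMDiffOn ?_ ?_
    · rw [hs']
      exact L.symm.contDiff.contMDiff.comp_contMDiffOn cΦ'
    · refine cΦ.comp L.contDiff.contMDiff.contMDiffOn fun b hb => ?_
      rw [ht'] at hb
      change L b ∈ Φ.source
      rw [hΦs, htar]
      exact hb
  have hfac := factors_of_product (hx φ' hmem) (hpar φ' hmem) (finrank_eu_succ n)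
    (finrank_eu_succ n₁) (finrank_eu_succ n₂) (hs φ' hmem) hα hαε hι L ht' hU₁ hU₂
    (ψ₁ := ψ₁) (ψ₂ := ψ₂) (fun u hu p hp r hr => by
      rw [← hprod u hu p hp r hr]
      simp [hφ', hΦ]) ⟨φ' q, φ'.map_source (by rwa [hs'])⟩
  exact ⟨I, U₁, U₂, ψ₁, ψ₂, Φ, hfac.1, hfac.2, hΦs.trans htar, hqΦ, cΦ, cΦ',
    fun u hu p hp r hr => hprod u hu p hp r hr⟩

end Manifold

section Conclusion

variable {n : ℕ} {M : Type*} [TopologicalSpace M] [ChartedSpace (Eu n) M]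
  [IsManifold (𝓡 n) ∞ M] {ε α : ℝ} {x : M → Eu (n + 1)} {A : Eu (n + 1) →L[ℝ] Eu (n + 1)}

theorem isCalabiProductNear {n₁ n₂ : ℕ} {ι₁ : Eu (n₁ + 1) →L[ℝ] Eu (n + 1)}
    {ρ₁ : Eu (n + 1) →L[ℝ] Eu (n₁ + 1)} {ι₂ : Eu (n₂ + 1) →L[ℝ] Eu (n + 1)}
    {ρ₂ : Eu (n + 1) →L[ℝ] Eu (n₂ + 1)}
    (hx : IsConvexHypersurface ε x) (hpar : HasParallelCubicForm ε x) (hε : ε ≠ 0)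
    (hs : ∀ φ ∈ IsManifold.maximalAtlas (𝓡 n) ∞ M, ∀ y ∈ φ.target, IsSplitAt ε (x ∘ φ.symm) A y)
    (hα : 0 < α) (hαε : ε < α) (hι : IsEigenSplitting ε α A ι₁ ρ₁ ι₂ ρ₂) (hn : n₁ + n₂ + 1 = n)
    (hn₁ : 1 ≤ n₁) (hn₂ : 1 ≤ n₂) (q : M) : IsCalabiProductNear x q := by
  obtain ⟨I, U₁, U₂, ψ₁, ψ₂, Φ, h₁, h₂, hΦ, hq, s, s', hp⟩ :=
    exists_calabi_chart hx hpar hs hα hαε hι hn q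
  refine ⟨n₁, n₂, hn₁, hn₂, hn, -(ε / α), neg_ne_zero.2 (div_ne_zero hε hα.ne'),
    neg_injective.ne ((div_lt_one hα).2 hαε).ne, I, U₁, U₂, ψ₁, ψ₂, hι.equiv hαε, Φ, ⟨_, h₁⟩,
    ⟨_, h₂⟩, hΦ, hq, s, s', fun u hu p hp' r hr => ?_⟩
  rw [hp u hu p hp' r hr, neg_neg]
  simp [IsEigenSplitting.equiv]

theorem isCalabiProductWithPointNear {n₁ : ℕ} {ι₁ : Eu (n₁ + 1) →L[ℝ] Eu (n + 1)}
    {ρ₁ : Eu (n + 1) →L[ℝ] Eu (n₁ + 1)} {ι₂ : Eu (0 + 1) →L[ℝ] Eu (n + 1)}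
    {ρ₂ : Eu (n + 1) →L[ℝ] Eu (0 + 1)}
    (hx : IsConvexHypersurface ε x) (hpar : HasParallelCubicForm ε x) (hε : ε ≠ 0)
    (hs : ∀ φ ∈ IsManifold.maximalAtlas (𝓡 n) ∞ M, ∀ y ∈ φ.target, IsSplitAt ε (x ∘ φ.symm) A y)
    (hα : 0 < α) (hαε : ε < α) (hι : IsEigenSplitting ε α A ι₁ ρ₁ ι₂ ρ₂) (hn : n₁ + 1 = n)
    (hn₁ : 1 ≤ n₁) (q : M) : IsCalabiProductWithPointNear x q := by
  obtain ⟨I, U₁, U₂, ψ₁, ψ₂, Φ, h₁, h₂, hΦ, hq, s, s', hp⟩ :=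
    exists_calabi_chart hx hpar hs hα hαε hι hn q
  have h0 : (0 : Eu 0) ∈ U₂ := by
    have hmem : Φ.symm q ∈ I ×ˢ U₁ ×ˢ U₂ := hΦ ▸ Φ.map_target hq
    rw [Subsingleton.elim (0 : Eu 0) (Φ.symm q).2.2]
    exact hmem.2.2
  have hb : ψ₂ 0 ≠ 0 := fun h => h₂.1.transversal 0 h0 0 (by rw [map_zero, h])
  let g : ℝ ≃L[ℝ] Eu (0 + 1) := (LinearEquiv.ofInjectiveOfFinrankEq
    (LinearMap.toSpanSingleton ℝ (Eu (0 + 1)) (ψ₂ 0)) (smul_left_injective ℝ hb)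
    (by simp)).toContinuousLinearEquiv
  have hg : ∀ c, g c = c • ψ₂ 0 := fun c => rfl
  let J : (ℝ × Eu n₁) ≃L[ℝ] ℝ × Eu n₁ × Eu 0 := ContinuousLinearEquiv.equivOfInverse
    ((ContinuousLinearMap.fst ℝ ℝ (Eu n₁)).prod ((ContinuousLinearMap.snd ℝ ℝ (Eu n₁)).prod 0))
    ((ContinuousLinearMap.fst ℝ ℝ (Eu n₁ × Eu 0)).prod
      ((ContinuousLinearMap.fst ℝ (Eu n₁) (Eu 0)).comp
        (ContinuousLinearMap.snd ℝ ℝ (Eu n₁ × Eu 0))))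
    (fun _ => rfl) (fun _ => Prod.ext rfl (Prod.ext rfl (Subsingleton.elim _ _)))
  have hJ : ∀ u p, J (u, p) = (u, p, 0) := fun _ _ => rfl
  have hsrc : (J.toHomeomorph.toOpenPartialHomeomorph.trans Φ).source = J ⁻¹' Φ.source := by
    rw [OpenPartialHomeomorph.trans_source]
    simp
  have htar : (J.toHomeomorph.toOpenPartialHomeomorph.trans Φ).target = Φ.target := by
    rw [OpenPartialHomeomorph.trans_target]
    simp
  refine ⟨n₁, hn₁, hn, -(ε / α), neg_ne_zero.2 (div_ne_zero hε hα.ne'),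
    neg_injective.ne ((div_lt_one hα).2 hαε).ne, I, U₁, ψ₁,
    ((ContinuousLinearEquiv.refl ℝ _).prodCongr g).trans (hι.equiv hαε),
    J.toHomeomorph.toOpenPartialHomeomorph.trans Φ, ⟨_, h₁⟩, ?_, ?_, ?_, ?_, fun u hu p hp' => ?_⟩
  · rw [hsrc, hΦ]
    ext ⟨u, p⟩
    simp [hJ, h0]
  · rwa [htar]
  · rw [hsrc]
    exact s.comp J.contDiff.contMDiff.contMDiffOn fun _ h => h
  · rw [htar]
    exact J.symm.contDiff.contMDiff.comp_contMDiffOn s'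
  · have h1 := hp u hu p hp' 0 h0
    rw [← hJ] at h1
    refine Eq.trans ?_ (h1.trans ?_)
    · rfl
    · simp [IsEigenSplitting.equiv, hg]

end Conclusion

end Centroaffine

theorem theorem7p1 {n : ℕ} [NeZero n] {M : Type*} [TopologicalSpace M]
    [ChartedSpace (Centroaffine.Eu n) M] [IsManifold (𝓡 n) ∞ M] [ConnectedSpace M]
    (ε : ℝ) (x : M → Centroaffine.Eu (n + 1))
    (hx : Centroaffine.IsConvexHypersurface ε x)
    (hpar : Centroaffine.HasParallelCubicForm ε x)
    (hC : Centroaffine.HasNonvanishingCubicForm ε x)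
    (m : ℕ) (hm : 2 ≤ m) (hmn : m + 1 ≤ n)
    (p : M) (e : Fin n → Centroaffine.Eu n) (lam : Fin n → ℝ)
    (hcase : Centroaffine.IsCaseC ε (Centroaffine.metricAt ε x p)
      (Centroaffine.diffTensorAt ε x p) m e lam)
    (k₀ : ℕ) (v : Fin k₀ → Centroaffine.Eu n)
    (hdec : Centroaffine.IsD2Decomposition (Centroaffine.metricAt ε x p)
      (Centroaffine.diffTensorAt ε x p) (lam 0) (e 0) (Centroaffine.D2 m e) v)
    (hk₀ : k₀ = 1) :
    (∀ q : M, Centroaffine.IsCalabiProductNear x q) ∨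
      (∀ q : M, Centroaffine.IsCalabiProductWithPointNear x q) := by
  subst hk₀
  have hchart := IsManifold.chart_mem_maximalAtlas (I := 𝓡 n) (n := ∞) p
  set φ := chartAt (Centroaffine.Eu n) p
  have hy : φ p ∈ φ.target := φ.map_source (mem_chart_source _ p)
  have hf := hx φ hchart
  have hd := Centroaffine.finrank_eu_succ n
  obtain ⟨A, α, hs, hα, hαε, hA, u, hu, hAu⟩ := hf.exists_isSplitAt_of_caseC
    (hpar φ hchart) hd hy (hC φ hchart _ hy) (by simp) hcase hdec
  obtain ⟨k₁, k₂, ι₁, ρ₁, ι₂, ρ₂, hι⟩ := Centroaffine.exists_isEigenSplitting hA hαε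
  have hk₁ : 2 ≤ k₁ := by simpa using hι.two_le_finrank hαε hf hd hy hs hu hAu
  have hk₂ : 1 ≤ k₂ := by simpa using hι.one_le_finrank hα hαε hf hd hy hs
  have hk : k₁ + k₂ = n + 1 := by
    simpa using (hι.equiv hαε).toLinearEquiv.finrank_eq
  have hsA := fun φ' (hφ' : φ' ∈ IsManifold.maximalAtlas (𝓡 n) ∞ M) =>
    Centroaffine.isSplitAt_of_connected hx hpar hs hφ'
  have hε : ε ≠ 0 := by rcases hf.sign with h | h <;> simp [h]
  obtain ⟨n₁, rfl⟩ : ∃ n₁, k₁ = n₁ + 1 := ⟨k₁ - 1, by omega⟩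
  obtain ⟨n₂, rfl⟩ : ∃ n₂, k₂ = n₂ + 1 := ⟨k₂ - 1, by omega⟩
  rcases Nat.eq_zero_or_pos n₂ with rfl | hn₂
  · exact Or.inr fun q => Centroaffine.isCalabiProductWithPointNear hx hpar hε hsA hα hαε hι
      (by omega) (by omega) q
  · exact Or.inl fun q => Centroaffine.isCalabiProductNear hx hpar hε hsA hα hαε hι
      (by omega) (by omega) hn₂ q
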